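/- \textbf{Conventions.} Let $G$ be a group with a finite generating set $S$, word norm $|\cdot|$ and word metric $d(x,y)=|x^{-1}y|$; $B(e,r)=\{g\in G:|g|\le r\}$ for real $r\geq 0$. A geodesic in $G$ is the image of an isometric embedding of a nonempty interval of $\mathbb Z$ into $(G,d)$; $[x,y]$ denotes an arbitrary geodesic segment from $x$ to $y$, and a condition on $[x,y]$ is required for all such segments. For $A,Y,Y'\subseteq G$ let $\pi_A(Y)$ be the set of all points of $A$ nearest to some $y\in Y$, and $d_A(Y,Y')=\operatorname{diam}(\pi_A(Y)\cup\pi_A(Y'))$; for $A\subseteq G$ put $|A|=\sup_{g\in A}|g|$. For $D>0$, a geodesic $\gamma$ is $D$-contracting if $\operatorname{diam}\pi_\gamma(\kappa)<D$ for every geodesic $\kappa$ with $d(\gamma,\kappa)>D$. An axis of $g\in G$ is a bi-infinite geodesic at finite Hausdorff distance from $\{g^i\}_{i\in\mathbb Z}$; $g$ is $D$-contracting if it has a $D$-contracting axis, and contracting if it is $D$-contracting for some $D>0$. Two elements are independent if they have axes whose projections onto each other have finite diameter. A sequence $(\kappa_1,\dots,\kappa_n)$ of geodesic segments (possibly points),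 $\kappa_i$ from $x_i$ to $y_i$, is $C$-aligned if $d_{\kappa_i}(y_i,\kappa_{i+1})<C$ and $d_{\kappa_{i+1}}(x_{i+1},\kappa_i)<C$ for $1\le i<n$. Two segments $E$-fellow travel if their initial points, their terminal points and the segments themselves (in Hausdorff distance) are at distance $<E$. Call a pair $(D,E)$ with $E>D$ (i) a \emph{pair constant} if, for all $D$-contracting segments $\kappa$ (starting at $x$) and $\gamma$ (starting at $x'$), $D$-alignment of $(\kappa,x')$ and of $(x,\gamma)$ implies $E$-alignment of $(\kappa,\gamma)$; (ii) a \emph{converse constant} if, whenever $[x,y]$ contains subsegments, in order from left to right, that $D$-fellow travel with geodesic segments $\kappa_1,\dots,\kappa_N$, the sequence $(x,\kappa_1,\dots,\kappa_N,y)$ is $E$-aligned; (iii) a \emph{hereditary constant} if, for points $x,x',y',y$ in this order on a geodesic and a $D$-contracting segment $\gamma$, $D$-alignment of $(x',\gamma,y')$ implies $E$-alignment of $(x,\gamma,y)$. Call $(D,E,L)$ with $E,L>D$ a \emph{concatenation constant} if, whenever $(x,\kappa_1,\dots,\kappa_N,y)$ is $D$-aligned and the $\kappa_i$ are $D$-contracting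 segments longer than $L$, every $[x,y]$ contains subsegments, in order from left to right, that $E$-fellow travel with $\kappa_1,\dots,\kappa_N$. An \emph{admissible choice} consists of $D,D_1,\dots,D_4,L_1,L_2>0$, of pairwise independent $D$-contracting elements $a_1,a_2,a_3$ with $|a_i|\le D$, and of powers $h_i=a_i^{p_i}$, $p_i\in\mathbb N$, such that: every $[e,a_i^n]$ ($n\in\mathbb Z$) is $D$-contracting; $|\pi_{[e,a_i^n]}([e,a_j^m])|\le D$ for $i\neq j$ and $n,m\in\mathbb Z$; $(45D,D_1)$ is a pair constant; $(D_1,D_2,L_1)$ is a concatenation constant, and so is $(D_2,E,L_1)$ for some $E$; $(D_2,D_3)$ is a converse constant; $(12D_3,D_4)$ is a hereditary constant; $(D_4,E,L_2)$ is a concatenation constant for some $E$; and, with $L=L_1+L_2$, $L\le|h_i|\le L+D$ for $i=1,2,3$. Given an admissible choice, $f\in G$ and intervals $I_n\subseteq\{0,\dots,n\}$ of integers $(n\in\mathbb N)$, let $\mathcal A$ be the set of all $g\in G$ that can be written $g=u_1v_1fv_2u_2$ with $v_1,v_2\in\{h_1,h_2,h_3\}$, $|u_1|\in I_{|g|}$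 and $(e,\,u_1[e,v_1],\,u_1v_1f[e,v_2],\,g)$ $D_4$-aligned, and let $\mathcal B_n=\{g\in G\setminus\mathcal A:|g|=n\}$. \textbf{Proposition.} Let $G$ be a finitely generated group, with finite generating set $S$, that is not virtually cyclic and has a contracting element. Then admissible choices exist, and for every admissible choice there is $C>0$ such that for all $f\in G$, all sequences of intervals $I_n\subseteq\{0,\dots,n\}$, all real $M>10(L+D_2)+|f|$ and all $n\ge1$, $$\#B(e,n)\ \ge\ \#\mathcal B_n\cdot\frac1{C\,\#B(e,M)}\left(1+\frac1{C\,\#B(e,M)}\right)^{\lfloor |I_n|/M\rfloor},$$ where $|I_n|$ is the number of elements of $I_n$. -/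

import Mathlib

namespace GrowthGap

/-- `G` has a cyclic subgroup of finite index. -/
def IsVirtuallyCyclic (G : Type*) [Group G] : Prop :=
  ∃ H : Subgroup G, IsCyclic H ∧ H.FiniteIndex

section WordMetric

variable {G : Type*} [Group G]

/-- Word norm: the least length of a word in `S ∪ S⁻¹` that represents `g`. -/
noncomputable def wordNorm (S : Finset G) (g : G) : ℕ :=
  sInf {n | ∃ l : List G, l.length = n ∧ (∀ s ∈ l, s ∈ S ∨ s⁻¹ ∈ S) ∧ l.prod = g}

/-- The left-invariant word metric. -/
noncomputable def wordDist (S : Finset G) (x y : G) : ℕ := wordNorm S (x⁻¹ * y)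

theorem wordDist_self (S : Finset G) (x : G) : wordDist S x x = 0 := by
  have h : (0 : ℕ) ∈ {n | ∃ l : List G, l.length = n ∧ (∀ s ∈ l, s ∈ S ∨ s⁻¹ ∈ S) ∧
      l.prod = x⁻¹ * x} := ⟨[], by simp⟩
  exact Nat.le_zero.mp (Nat.sInf_le h)

theorem wordDist_mul_left (S : Finset G) (g x y : G) :
    wordDist S (g * x) (g * y) = wordDist S x y := by
  simp [wordDist, mul_assoc]

/-- The closed ball of real radius `r` around the identity. -/
def ball (S : Finset G) (r : ℝ) : Set G := {g | (wordNorm S g : ℝ) ≤ r}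

/-- `diam A < r`. As distances are natural numbers, the supremum of a bounded set of distances is
attained, so for `0 < r` this is the strict inequality for the diameter. -/
def DiamLT (S : Finset G) (A : Set G) (r : ℝ) : Prop :=
  ∀ p ∈ A, ∀ q ∈ A, (wordDist S p q : ℝ) < r

/-- Nearest point projection `π_A(Y) = ⋃_{y ∈ Y} π_A(y)`. -/
def proj (S : Finset G) (A Y : Set G) : Set G :=
  {a | a ∈ A ∧ ∃ y ∈ Y, ∀ b ∈ A, wordDist S y a ≤ wordDist S y b}

/-- Finite, one-sided infinite or two-sided infinite geodesics in `G`, as sets of points: the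
images of isometric embeddings of nonempty intervals of `ℤ`. -/
def IsGeodesic (S : Finset G) (γ : Set G) : Prop :=
  ∃ (J : Set ℤ) (c : ℤ → G), J.Nonempty ∧ J.OrdConnected ∧
    (∀ i ∈ J, ∀ j ∈ J, (wordDist S (c i) (c j) : ℤ) = |i - j|) ∧ γ = c '' J

/-- `γ` is `D`-contracting: every geodesic `κ` with `d(γ, κ) > D` has `diam (π_γ(κ)) < D`. -/
def IsContracting (S : Finset G) (D : ℝ) (γ : Set G) : Prop :=
  ∀ κ : Set G, IsGeodesic S κ → (∀ p ∈ γ, ∀ q ∈ κ, D < (wordDist S p q : ℝ)) →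
    DiamLT S (proj S γ κ) D

/-- `γ` is an axis of `g`: a bi-infinite geodesic at bounded Hausdorff distance from the orbit
`{g ^ i : i ∈ ℤ}`. -/
def IsAxis (S : Finset G) (g : G) (γ : Set G) : Prop :=
  (∃ c : ℤ → G, (∀ i j, (wordDist S (c i) (c j) : ℤ) = |i - j|) ∧ γ = Set.range c) ∧
  ∃ R : ℕ, (∀ p ∈ γ, ∃ i : ℤ, wordDist S p (g ^ i) ≤ R) ∧
    (∀ i : ℤ, ∃ p ∈ γ, wordDist S p (g ^ i) ≤ R)

/-- `g` is a `D`-contracting element. -/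
def IsContractingElement (S : Finset G) (D : ℝ) (g : G) : Prop :=
  0 < D ∧ ∃ γ : Set G, IsAxis S g γ ∧ IsContracting S D γ

/-- `g` and `h` are independent: they have axes whose projections onto each other have finite
diameter. -/
def Independent (S : Finset G) (g h : G) : Prop :=
  ∃ K : ℝ, 0 < K ∧ ∃ γ η : Set G, IsAxis S g γ ∧ IsAxis S h η ∧
    DiamLT S (proj S γ η) K ∧ DiamLT S (proj S η γ) K

/-- An oriented geodesic segment of length `len`, with vertices `pts 0, …, pts len`
(the values of `pts` beyond `len` are irrelevant). -/
structure GeodSeg (S : Finset G) where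
  len : ℕ
  pts : ℕ → G
  isom : ∀ i k : ℕ, i + k ≤ len → wordDist S (pts i) (pts (i + k)) = k

namespace GeodSeg

variable {S : Finset G}

def first (κ : GeodSeg S) : G := κ.pts 0

def last (κ : GeodSeg S) : G := κ.pts κ.len

/-- The set of vertices of the segment. -/
def carrier (κ : GeodSeg S) : Set G := κ.pts '' Set.Iic κ.len

/-- A point, as a degenerate segment. -/
def point (S : Finset G) (x : G) : GeodSeg S where
  len := 0
  pts := fun _ => x
  isom := by
    intro i k h
    have hk : k = 0 := by omega
    rw [hk, wordDist_self]

/-- The translate `g κ`. -/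
def translate (g : G) (κ : GeodSeg S) : GeodSeg S where
  len := κ.len
  pts := fun i => g * κ.pts i
  isom := by
    intro i k h
    rw [wordDist_mul_left]
    exact κ.isom i k h

/-- The subsegment from the `a`-th to the `b`-th vertex (used for `a ≤ b ≤ len`). -/
def sub (κ : GeodSeg S) (a b : ℕ) : GeodSeg S where
  len := min b κ.len - a
  pts := fun i => κ.pts (a + i)
  isom := by
    intro i k h
    rcases Nat.eq_zero_or_pos k with hk | hk
    · subst hk
      rw [Nat.add_zero, wordDist_self]
    · rw [← Nat.add_assoc]
      exact κ.isom (a + i) k (by omega)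

end GeodSeg

variable (S : Finset G)

/-- `(κ, κ')` is `C`-aligned: with `y` the last point of `κ` and `x'` the first point of `κ'`,
`d_κ(y, κ') < C` and `d_κ'(x', κ) < C`, where `d_A(Y, Y') = diam (π_A(Y) ∪ π_A(Y'))`. -/
def PairAligned (C : ℝ) (κ κ' : GeodSeg S) : Prop :=
  DiamLT S (proj S κ.carrier {κ.last} ∪ proj S κ.carrier κ'.carrier) C ∧
  DiamLT S (proj S κ'.carrier {κ'.first} ∪ proj S κ'.carrier κ.carrier) C

/-- A finite sequence of segments is `C`-aligned if all pairs of consecutive terms are. -/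
def Aligned (C : ℝ) (l : List (GeodSeg S)) : Prop := l.IsChain (PairAligned S C)

/-- `E`-fellow traveling: the first points, the last points and the vertex sets
(in Hausdorff distance) are at distance less than `E`. -/
def FellowTravel (E : ℝ) (γ κ : GeodSeg S) : Prop :=
  (wordDist S γ.first κ.first : ℝ) < E ∧ (wordDist S γ.last κ.last : ℝ) < E ∧
  (∀ p ∈ γ.carrier, ∃ q ∈ κ.carrier, (wordDist S p q : ℝ) < E) ∧
  (∀ q ∈ κ.carrier, ∃ p ∈ γ.carrier, (wordDist S p q : ℝ) < E)

/-- `τ` contains subsegments, in order from left to right, that `E`-fellow travel with the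
terms of `κs`. -/
def ContainsFellow (E : ℝ) (τ : GeodSeg S) (κs : List (GeodSeg S)) : Prop :=
  ∃ s t : Fin κs.length → ℕ, (∀ i, s i ≤ t i ∧ t i ≤ τ.len) ∧ (∀ i j, i < j → t i ≤ s j) ∧
    ∀ i, FellowTravel S E (τ.sub (s i) (t i)) (κs.get i)

/-- `E = E(D)` in the sense of the one-segment lemma: for `D`-contracting segments `κ` from `x`
and `γ` from `x'`, if `(κ, x')` and `(x, γ)` are `D`-aligned then `(κ, γ)` is `E`-aligned. -/
def IsPairConst (D E : ℝ) : Prop :=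
  D < E ∧ ∀ κ γ : GeodSeg S, IsContracting S D κ.carrier → IsContracting S D γ.carrier →
    Aligned S D [κ, GeodSeg.point S γ.first] → Aligned S D [GeodSeg.point S κ.first, γ] →
    Aligned S E [κ, γ]

/-- `E = E(D)` and `L = L(D)` in the sense of the concatenation lemma: if
`(x, κ₁, …, κ_N, y)` is `D`-aligned with `κᵢ` `D`-contracting and longer than `L`, then every
geodesic `[x, y]` contains subsegments, in order, that `E`-fellow travel with the `κᵢ`. -/
def IsConcatConst (D E L : ℝ) : Prop :=
  D < E ∧ D < L ∧ ∀ (x y : G) (κs : List (GeodSeg S)),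
    (∀ κ ∈ κs, IsContracting S D κ.carrier ∧ L < (κ.len : ℝ)) →
    Aligned S D ([GeodSeg.point S x] ++ κs ++ [GeodSeg.point S y]) →
    ∀ τ : GeodSeg S, τ.first = x → τ.last = y → ContainsFellow S E τ κs

/-- `E = E(D)` in the sense of the converse of the concatenation lemma: if a geodesic `[x, y]`
contains subsegments, in order, that `D`-fellow travel with geodesics `κᵢ`, then
`(x, κ₁, …, κ_N, y)` is `E`-aligned. -/
def IsConcatConverseConst (D E : ℝ) : Prop :=
  D < E ∧ ∀ (τ : GeodSeg S) (κs : List (GeodSeg S)), ContainsFellow S D τ κs →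
    Aligned S E ([GeodSeg.point S τ.first] ++ κs ++ [GeodSeg.point S τ.last])

/-- `E = E(D)` in the sense of the heredity of alignment: if `x, x', y', y` lie on a geodesic in
this order, `γ` is `D`-contracting and `(x', γ, y')` is `D`-aligned, then `(x, γ, y)` is
`E`-aligned. -/
def IsHereditaryConst (D E : ℝ) : Prop :=
  D < E ∧ ∀ (τ γ : GeodSeg S) (i i' j' j : ℕ), i ≤ i' → i' ≤ j' → j' ≤ j → j ≤ τ.len →
    IsContracting S D γ.carrier →
    Aligned S D [GeodSeg.point S (τ.pts i'), γ, GeodSeg.point S (τ.pts j')] →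
    Aligned S E [GeodSeg.point S (τ.pts i), γ, GeodSeg.point S (τ.pts j)]

/-- The choice of three contracting elements and of the constants `D, D₁, D₂, D₃, D₄, L`.
The elements `h₁, h₂, h₃` are powers `a i ^ p i` of independent `D`-contracting elements of norm
at most `D`. A geodesic written `[x, y]` is an arbitrary one: the conditions hold for all of
them. -/
structure ContractingTriple where
  a : Fin 3 → G
  p : Fin 3 → ℕ
  D : ℝ
  D₁ : ℝ
  D₂ : ℝ
  D₃ : ℝ
  D₄ : ℝ
  L₁ : ℝ
  L₂ : ℝ
  contracting : ∀ i, IsContractingElement S D (a i)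
  independent : ∀ i j, i ≠ j → Independent S (a i) (a j)
  norm_le : ∀ i, (wordNorm S (a i) : ℝ) ≤ D
  /-- `[e, a ^ n]` is `D`-contracting. -/
  power_contracting : ∀ (i : Fin 3) (n : ℤ) (γ : GeodSeg S),
    γ.first = 1 → γ.last = a i ^ n → IsContracting S D γ.carrier
  /-- `|π_{[e, a ^ n]}([e, b ^ m])| ≤ D` for `a ≠ b`. -/
  power_proj : ∀ (i j : Fin 3) (n m : ℤ) (γ κ : GeodSeg S), i ≠ j →
    γ.first = 1 → γ.last = a i ^ n → κ.first = 1 → κ.last = a j ^ m →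
    ∀ q ∈ proj S γ.carrier κ.carrier, (wordNorm S q : ℝ) ≤ D
  /-- `D₁ = E(45 D)`. -/
  hD₁ : IsPairConst S (45 * D) D₁
  /-- `D₂ = E(D₁)`, and `L₁` is large enough for `D₁`. -/
  hD₂ : IsConcatConst S D₁ D₂ L₁
  /-- `L₁ = L(D₂)`. -/
  hL₁ : ∃ E, IsConcatConst S D₂ E L₁
  /-- `D₃ = E(D₂)`. -/
  hD₃ : IsConcatConverseConst S D₂ D₃
  /-- `D₄ = E(12 D₃)`. -/
  hD₄ : IsHereditaryConst S (12 * D₃) D₄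
  /-- `L₂ = L(D₄)`. -/
  hL₂ : ∃ E, IsConcatConst S D₄ E L₂
  /-- `L ≤ |hᵢ| ≤ L + D` for `L = L₁ + L₂`. -/
  le_norm_h : ∀ i, L₁ + L₂ ≤ (wordNorm S (a i ^ p i) : ℝ)
  norm_h_le : ∀ i, (wordNorm S (a i ^ p i) : ℝ) ≤ L₁ + L₂ + D

namespace ContractingTriple

variable {S}

/-- `L = L₁ + L₂`. -/
def L (T : ContractingTriple S) : ℝ := T.L₁ + T.L₂

/-- The elements `h₁, h₂, h₃`. -/
def h (T : ContractingTriple S) (i : Fin 3) : G := T.a i ^ T.p i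

/-- The set `𝒜` of all `g = u₁ v₁ f v₂ u₂` with `v₁, v₂ ∈ {h₁, h₂, h₃}`, `|u₁| ∈ I_{|g|}` and
`(e, u₁[e, v₁], u₁ v₁ f [e, v₂], g)` `D₄`-aligned, for all geodesics `[e, v₁]`, `[e, v₂]`. -/
def setA (T : ContractingTriple S) (f : G) (I : ℕ → Set ℕ) : Set G :=
  {g | ∃ u₁ v₁ v₂ u₂ : G, g = u₁ * v₁ * f * v₂ * u₂ ∧
    v₁ ∈ Set.range T.h ∧ v₂ ∈ Set.range T.h ∧ wordNorm S u₁ ∈ I (wordNorm S g) ∧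
    ∀ κ₁ κ₂ : GeodSeg S, κ₁.first = 1 → κ₁.last = v₁ → κ₂.first = 1 → κ₂.last = v₂ →
      Aligned S T.D₄ [GeodSeg.point S 1, κ₁.translate u₁, κ₂.translate (u₁ * v₁ * f),
        GeodSeg.point S g]}

/-- The set `ℬ_n` of elements of norm `n` outside `𝒜`. -/
def setB (T : ContractingTriple S) (f : G) (I : ℕ → Set ℕ) (n : ℕ) : Set G :=
  {g | g ∉ T.setA f I ∧ wordNorm S g = n}

end ContractingTriple

end WordMetric

end GrowthGap

open GrowthGap

namespace GrowthGap

/-! ### Word norm, word metric and finiteness of balls. -/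

section Basics

variable {G : Type*} [Group G] {S : Finset G}

/-! The estimate compares elements of `ℬ_n` with the elements obtained from them by local surgery.
Cut out of `I_n` about `|I_n| / M` disjoint blocks of positions, each of length at most `M` and at
least `2(L + D) + |f|`. Given `g` in `ℬ_n`, a geodesic from `e` to `g` and a set of blocks, replace
the word in every chosen block by some `h_i f h_j`. No word gets longer, so the result lies in `B(e,
n)`. Since each of the requirements on an inserted `h_i` fails for at most one of the three indices
(`exists_good_index`), the indices can be chosen so that the inserted segments form an aligned
sequence (`exists_isGoodCode`). Every geodesic `ρ` from `e` to the new element then fellow travels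
them in order.

The surgery is not injective, but its failure is controlled. Record each replacement as a letter
(block, kept gap, two indices, removed word), so that `g` and the set of blocks can be read off from
the list of letters and the result. Fix a result `g'` and two lists leading to it, and look at the
first place after a common prefix. If one list ends there, or its next block comes later, then the
pair inserted for the other list lies on `ρ` along a stretch where the geodesic of the first list is
unmodified. The converse and hereditary constants turn this into alignment with that geodesic's
endpoints, which puts an element of `ℬ_n` into `𝒜`, a contradiction (`mem_setA_of_pattern`,
`IsGoodCode.ne_nil`, `IsGoodCode.not_lt`). So the lists over `g'` are prefix-free with the same next
block, and the gaps there differ by at most `8 D₂` (`IsGoodCode.norm_gap_le`). Hence at most `K = 9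
#B(e, 8 D₂) #B(e, M)` letters can follow a prefix.

Kraft's inequality (`sum_inv_pow_length_le_one`) bounds the sum of `K ^ (-length)` over each fibre
by `1`. Summing over all results, and using the binomial theorem over sets of blocks, gives `#ℬ_n (1
+ 1/K)^m ≤ #B(e, n)`, which is slightly stronger than the claim.

For the existence of admissible choices, the constants come from elementary estimates for
projections to contracting sets. Three independent elements are found as conjugates of one
contracting element `g`: if no three translates of its axis had bounded mutual projections, finitely
many cosets of two conjugates of `⟨g⟩` would cover `G`, so that `G` would be virtually cyclic. -/

theorem wordNorm_le_length (l : List G) (hl : ∀ s ∈ l, s ∈ S ∨ s⁻¹ ∈ S) :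
    wordNorm S l.prod ≤ l.length :=
  Nat.sInf_le ⟨l, rfl, hl, rfl⟩

/-- Generation by `S` makes the set of word lengths nonempty, so its infimum is attained; without it
`sInf ∅ = 0` would give elements outside the generated subgroup norm zero. -/
theorem exists_minimal_word (hS : Subgroup.closure (S : Set G) = ⊤) (g : G) :
    ∃ l : List G, l.length = wordNorm S g ∧ (∀ s ∈ l, s ∈ S ∨ s⁻¹ ∈ S) ∧ l.prod = g := by
  have hg : g ∈ (Subgroup.closure (S : Set G)).toSubmonoid := by rw [hS]; trivial
  rw [Subgroup.closure_toSubmonoid] at hg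
  obtain ⟨l, hl, hp⟩ := Submonoid.exists_list_of_mem_closure hg
  exact Nat.sInf_mem (s := {n | ∃ l : List G, l.length = n ∧ (∀ s ∈ l, s ∈ S ∨ s⁻¹ ∈ S) ∧
    l.prod = g}) ⟨l.length, l, rfl, by simpa using hl, hp⟩

theorem wordNorm_one : wordNorm S (1 : G) = 0 := by
  simpa using wordNorm_le_length (S := S) ([] : List G) (by simp)

theorem wordNorm_eq_zero (hS : Subgroup.closure (S : Set G) = ⊤) {g : G} :
    wordNorm S g = 0 ↔ g = 1 := by
  constructor
  · intro h
    obtain ⟨l, hl, -, hp⟩ := exists_minimal_word hS g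
    rw [h, List.length_eq_zero_iff] at hl
    simpa [hl] using hp.symm
  · rintro rfl
    exact wordNorm_one

theorem wordNorm_mul_le (hS : Subgroup.closure (S : Set G) = ⊤) (g h : G) :
    wordNorm S (g * h) ≤ wordNorm S g + wordNorm S h := by
  obtain ⟨l, hl, hl', rfl⟩ := exists_minimal_word hS g
  obtain ⟨k, hk, hk', rfl⟩ := exists_minimal_word hS h
  rw [← hl, ← hk, ← List.prod_append, ← List.length_append]
  refine wordNorm_le_length _ fun s hs => ?_
  rcases List.mem_append.1 hs with h | h
  exacts [hl' s h, hk' s h]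

theorem wordNorm_inv (hS : Subgroup.closure (S : Set G) = ⊤) (g : G) :
    wordNorm S g⁻¹ = wordNorm S g := by
  have key : ∀ g : G, wordNorm S g⁻¹ ≤ wordNorm S g := by
    intro g
    obtain ⟨l, hl, hl', rfl⟩ := exists_minimal_word hS g
    rw [List.prod_inv_reverse, ← hl]
    refine (wordNorm_le_length _ fun s hs => ?_).trans (by simp)
    simp only [List.mem_reverse, List.mem_map] at hs
    obtain ⟨t, ht, rfl⟩ := hs
    simpa [or_comm] using hl' t ht
  exact le_antisymm (key g) (by simpa using key g⁻¹)

theorem wordDist_comm (hS : Subgroup.closure (S : Set G) = ⊤) (x y : G) :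
    wordDist S x y = wordDist S y x := by
  rw [wordDist, ← wordNorm_inv hS, wordDist]
  simp

theorem wordDist_triangle (hS : Subgroup.closure (S : Set G) = ⊤) (x y z : G) :
    (wordDist S x z : ℝ) ≤ wordDist S x y + wordDist S y z := by
  have := wordNorm_mul_le hS (x⁻¹ * y) (y⁻¹ * z)
  rw [show x⁻¹ * y * (y⁻¹ * z) = x⁻¹ * z by group] at this
  exact_mod_cast this

theorem wordDist_eq_zero (hS : Subgroup.closure (S : Set G) = ⊤) {x y : G} :
    wordDist S x y = 0 ↔ x = y := by
  rw [wordDist, wordNorm_eq_zero hS, inv_mul_eq_one]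

theorem wordDist_one (x : G) : wordDist S 1 x = wordNorm S x := by simp [wordDist]

theorem wordNorm_le_add_wordDist (hS : Subgroup.closure (S : Set G) = ⊤) (x y : G) :
    (wordNorm S y : ℝ) ≤ wordNorm S x + wordDist S x y := by
  simpa [wordDist_one] using wordDist_triangle hS 1 x y

theorem finite_wordNorm_le (hS : Subgroup.closure (S : Set G) = ⊤) (n : ℕ) :
    {g : G | wordNorm S g ≤ n}.Finite := by
  induction n with
  | zero =>
    refine (Set.finite_singleton (1 : G)).subset fun g hg => ?_
    simpa [wordNorm_eq_zero hS] using hg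
  | succ n ih =>
    have hfin : ((S : Set G) ∪ (S : Set G)⁻¹).Finite := S.finite_toSet.union S.finite_toSet.inv
    refine ((hfin.image2 (fun a b => a * b) ih).union ih).subset fun g hg => ?_
    obtain ⟨l, hl, hl', rfl⟩ := exists_minimal_word hS g
    cases l with
    | nil => exact Or.inr (by simp [wordNorm_one])
    | cons s t =>
      left
      refine ⟨s, ?_, t.prod, ?_, by simp⟩
      · simpa using hl' s (by simp)
      · refine (wordNorm_le_length t fun s hs => hl' s (by simp [hs])).trans ?_
        simp only [Set.mem_ofPred_eq, List.length_cons] at hg hl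
        omega

theorem finite_ball (hS : Subgroup.closure (S : Set G) = ⊤) (r : ℝ) : (ball S r).Finite :=
  (finite_wordNorm_le hS ⌊r⌋₊).subset fun _ hg => Nat.le_floor hg

theorem ncard_ball_pos (hS : Subgroup.closure (S : Set G) = ⊤) {r : ℝ} (hr : 0 ≤ r) :
    0 < (ball S r).ncard :=
  (Set.ncard_pos (finite_ball hS r)).2 ⟨1, by simpa [ball, wordNorm_one] using hr⟩

end Basics

/-! ### Geodesic segments, their reversals and subsegments. -/

namespace GeodSeg

variable {G : Type*} [Group G] {S : Finset G}

theorem dist_pts (κ : GeodSeg S) {i j : ℕ} (hij : i ≤ j) (hj : j ≤ κ.len) :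
    (wordDist S (κ.pts i) (κ.pts j) : ℝ) = j - i := by
  obtain ⟨k, rfl⟩ := Nat.exists_eq_add_of_le hij
  rw [κ.isom i k hj]
  push_cast
  ring

theorem dist_pts_abs (hS : Subgroup.closure (S : Set G) = ⊤) (κ : GeodSeg S) {i j : ℕ}
    (hi : i ≤ κ.len) (hj : j ≤ κ.len) :
    (wordDist S (κ.pts i) (κ.pts j) : ℝ) = |(i : ℝ) - j| := by
  rcases le_total i j with h | h
  · rw [κ.dist_pts h hj, abs_sub_comm, abs_of_nonneg (sub_nonneg.2 (by exact_mod_cast h))]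
  · rw [wordDist_comm hS, κ.dist_pts h hi, abs_of_nonneg (sub_nonneg.2 (by exact_mod_cast h))]

theorem len_eq (κ : GeodSeg S) : κ.len = wordDist S κ.first κ.last := by
  have := κ.isom 0 κ.len (by simp)
  simpa [first, last] using this.symm

theorem pts_mem (κ : GeodSeg S) {i : ℕ} (hi : i ≤ κ.len) : κ.pts i ∈ κ.carrier := ⟨i, hi, rfl⟩

theorem first_mem (κ : GeodSeg S) : κ.first ∈ κ.carrier := κ.pts_mem (Nat.zero_le _)

theorem last_mem (κ : GeodSeg S) : κ.last ∈ κ.carrier := κ.pts_mem le_rfl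

theorem carrier_point (x : G) : (point S x).carrier = {x} := by
  ext y
  constructor
  · rintro ⟨i, -, rfl⟩; rfl
  · rintro rfl; exact (point S y).first_mem

@[simp] theorem first_point (x : G) : (point S x).first = x := rfl

@[simp] theorem last_point (x : G) : (point S x).last = x := rfl

@[simp] theorem first_translate (g : G) (κ : GeodSeg S) : (κ.translate g).first = g * κ.first := rfl

@[simp] theorem last_translate (g : G) (κ : GeodSeg S) : (κ.translate g).last = g * κ.last := rfl

@[simp] theorem len_translate (g : G) (κ : GeodSeg S) : (κ.translate g).len = κ.len := rfl

theorem carrier_translate (g : G) (κ : GeodSeg S) :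
    (κ.translate g).carrier = (g * ·) '' κ.carrier := by
  simp only [carrier, translate, Set.image_image]

/-- The segment with reversed orientation. -/
def rev (hS : Subgroup.closure (S : Set G) = ⊤) (κ : GeodSeg S) : GeodSeg S where
  len := κ.len
  pts := fun i => κ.pts (κ.len - i)
  isom := by
    intro i k h
    have := κ.isom (κ.len - (i + k)) k (by omega)
    rw [show κ.len - (i + k) + k = κ.len - i by omega, wordDist_comm hS] at this
    exact this

theorem first_rev (hS : Subgroup.closure (S : Set G) = ⊤) (κ : GeodSeg S) :
    (κ.rev hS).first = κ.last := by simp [rev, first, last]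

theorem last_rev (hS : Subgroup.closure (S : Set G) = ⊤) (κ : GeodSeg S) :
    (κ.rev hS).last = κ.first := by simp [rev, first, last]

theorem carrier_rev (hS : Subgroup.closure (S : Set G) = ⊤) (κ : GeodSeg S) :
    (κ.rev hS).carrier = κ.carrier := by
  ext y
  constructor
  · rintro ⟨i, -, rfl⟩
    exact κ.pts_mem (Nat.sub_le _ _)
  · rintro ⟨i, hi, rfl⟩
    have hi' : i ≤ κ.len := hi
    refine ⟨κ.len - i, Nat.sub_le _ _, ?_⟩
    simp only [rev]
    congr 1
    omega

theorem sub_len (κ : GeodSeg S) {a b : ℕ} (hb : b ≤ κ.len) : (κ.sub a b).len = b - a := by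
  simp [sub, hb]

theorem sub_pts (κ : GeodSeg S) (a b i : ℕ) : (κ.sub a b).pts i = κ.pts (a + i) := rfl

theorem sub_first (κ : GeodSeg S) (a b : ℕ) : (κ.sub a b).first = κ.pts a := rfl

theorem sub_last (κ : GeodSeg S) {a b : ℕ} (hab : a ≤ b) (hb : b ≤ κ.len) :
    (κ.sub a b).last = κ.pts b := by
  rw [last, sub_len κ hb, sub_pts]
  congr 1
  omega

theorem sub_carrier_subset (κ : GeodSeg S) {a b : ℕ} (hab : a ≤ b) (hb : b ≤ κ.len) :
    (κ.sub a b).carrier ⊆ κ.carrier := by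
  rintro _ ⟨i, hi, rfl⟩
  have hi' : i ≤ (κ.sub a b).len := hi
  rw [sub_len κ hb] at hi'
  exact κ.pts_mem (by omega)

theorem isGeodesic (hS : Subgroup.closure (S : Set G) = ⊤) (κ : GeodSeg S) :
    IsGeodesic S κ.carrier := by
  refine ⟨Set.Icc 0 κ.len, fun i => κ.pts i.toNat, ⟨0, by simp⟩, Set.ordConnected_Icc, ?_, ?_⟩
  · rintro i ⟨hi, hi'⟩ j ⟨hj, hj'⟩
    have h := κ.dist_pts_abs hS (i := i.toNat) (j := j.toNat) (by omega) (by omega)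
    have hi2 : ((i.toNat : ℕ) : ℝ) = ((i : ℤ) : ℝ) := by
      exact_mod_cast congrArg (Int.cast (R := ℝ)) (Int.toNat_of_nonneg hi)
    have hj2 : ((j.toNat : ℕ) : ℝ) = ((j : ℤ) : ℝ) := by
      exact_mod_cast congrArg (Int.cast (R := ℝ)) (Int.toNat_of_nonneg hj)
    rw [hi2, hj2] at h
    exact_mod_cast h
  · ext y
    constructor
    · rintro ⟨i, hi, rfl⟩
      have hi' : i ≤ κ.len := hi
      exact ⟨i, by simp [hi'], by simp⟩
    · rintro ⟨i, ⟨hi, hi'⟩, rfl⟩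
      exact κ.pts_mem (by omega)

end GeodSeg

/-! ### Existence of geodesic segments. -/

section Geodesics

variable {G : Type*} [Group G] {S : Finset G}

/-- The prefixes of a minimal word trace a geodesic: a subword that could be shortened would shorten
the whole word. -/
theorem exists_geodSeg (hS : Subgroup.closure (S : Set G) = ⊤) (x y : G) :
    ∃ τ : GeodSeg S, τ.first = x ∧ τ.last = y := by
  obtain ⟨l, hl, hl', hp⟩ := exists_minimal_word hS (x⁻¹ * y)
  have key : ∀ i k : ℕ, i + k ≤ l.length →
      wordNorm S ((l.drop i).take k).prod = k := by
    intro i k hik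
    have h0 : l = l.take i ++ ((l.drop i).take k ++ (l.drop i).drop k) := by simp
    have h1 : l.prod = (l.take i).prod * (((l.drop i).take k).prod * ((l.drop i).drop k).prod) := by
      conv_lhs => rw [h0]
      rw [List.prod_append, List.prod_append]
    have h2 := wordNorm_le_length (S := S) (l.take i)
      fun s hs => hl' s (List.mem_of_mem_take hs)
    have h3 := wordNorm_le_length (S := S) ((l.drop i).take k)
      fun s hs => hl' s (List.mem_of_mem_drop (List.mem_of_mem_take hs))
    have h4 := wordNorm_le_length (S := S) ((l.drop i).drop k)
      fun s hs => hl' s (List.mem_of_mem_drop (List.mem_of_mem_drop hs))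
    have h5 := wordNorm_mul_le hS (l.take i).prod
      (((l.drop i).take k).prod * ((l.drop i).drop k).prod)
    have h6 := wordNorm_mul_le hS ((l.drop i).take k).prod ((l.drop i).drop k).prod
    rw [← h1, hp, ← hl] at h5
    simp only [List.length_take, List.length_drop] at h2 h3 h4
    omega
  refine ⟨⟨l.length, fun i => x * (l.take i).prod, ?_⟩, ?_, ?_⟩
  · intro i k hik
    rw [wordDist_mul_left, wordDist, List.take_add, List.prod_append, inv_mul_cancel_left]
    exact key i k hik
  · simp [GeodSeg.first]
  · simp [GeodSeg.last, hp]

theorem IsGeodesic.exists_geodSeg (hS : Subgroup.closure (S : Set G) = ⊤) {η : Set G}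
    (hη : IsGeodesic S η) {x y : G} (hx : x ∈ η) (hy : y ∈ η) :
    ∃ τ : GeodSeg S, τ.first = x ∧ τ.last = y ∧ τ.carrier ⊆ η := by
  obtain ⟨J, c, -, hJ, hc, rfl⟩ := hη
  have main : ∀ i ∈ J, ∀ j ∈ J, i ≤ j →
      ∃ τ : GeodSeg S, τ.first = c i ∧ τ.last = c j ∧ τ.carrier ⊆ c '' J := by
    intro i hi j hj hij
    have hmem : ∀ k : ℕ, k ≤ (j - i).toNat → i + k ∈ J := fun k hk =>
      hJ.out hi hj ⟨by omega, by omega⟩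
    refine ⟨⟨(j - i).toNat, fun k => c (i + k), ?_⟩, ?_, ?_, ?_⟩
    · intro a k h
      have h1 := hc _ (hmem a (by omega)) _ (hmem (a + k) h)
      push_cast at h1
      rw [show i + (a : ℤ) - (i + (a + k)) = -(k : ℤ) by ring, abs_neg, Nat.abs_cast] at h1
      exact_mod_cast h1
    · simp [GeodSeg.first]
    · simp only [GeodSeg.last]
      congr 1
      omega
    · rintro _ ⟨k, hk, rfl⟩
      exact ⟨_, hmem k hk, rfl⟩
  obtain ⟨i, hi, rfl⟩ := hx
  obtain ⟨j, hj, rfl⟩ := hy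
  rcases le_total i j with h | h
  · exact main i hi j hj h
  · obtain ⟨τ, h1, h2, h3⟩ := main j hj i hi h
    exact ⟨τ.rev hS, by rw [GeodSeg.first_rev, h2], by rw [GeodSeg.last_rev, h1],
      by rwa [GeodSeg.carrier_rev]⟩

end Geodesics

/-! ### Nearest point projections to contracting sets. -/

section Nearest

variable {G : Type*} [Group G] {S : Finset G}

/-- `p` is a point of `A` nearest to `x`. -/
def IsNearest (S : Finset G) (A : Set G) (x p : G) : Prop :=
  p ∈ A ∧ ∀ b ∈ A, wordDist S x p ≤ wordDist S x b

theorem mem_proj {A Y : Set G} {a : G} : a ∈ proj S A Y ↔ ∃ y ∈ Y, IsNearest S A y a :=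
  ⟨fun ⟨h, y, hy, h'⟩ => ⟨y, hy, h, h'⟩, fun ⟨y, hy, h, h'⟩ => ⟨h, y, hy, h'⟩⟩

theorem exists_isNearest {A : Set G} (hA : A.Nonempty) (x : G) : ∃ p, IsNearest S A x p :=
  ⟨Function.argminOn (wordDist S x) A hA, Function.argminOn_mem _ _ _,
    fun _ hb => Function.argminOn_le _ _ hb⟩

theorem IsNearest.le {A : Set G} {x p b : G} (h : IsNearest S A x p) (hb : b ∈ A) :
    (wordDist S x p : ℝ) ≤ wordDist S x b := by
  exact_mod_cast h.2 b hb

theorem isNearest_self {A : Set G} {x : G} (hx : x ∈ A) : IsNearest S A x x :=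
  ⟨hx, fun _ _ => by simp [wordDist_self]⟩

theorem IsNearest.eq_of_mem (hS : Subgroup.closure (S : Set G) = ⊤) {A : Set G} {x p : G}
    (h : IsNearest S A x p) (hx : x ∈ A) : p = x := by
  have h1 := h.2 x hx
  rw [wordDist_self, Nat.le_zero, wordDist_eq_zero hS] at h1
  exact h1.symm

/-- A nearest point of `A` to `y` is nearest to every point on a geodesic from it to `y`. -/
theorem IsNearest.of_between (hS : Subgroup.closure (S : Set G) = ⊤) {A : Set G} {y z w : G}
    (h : IsNearest S A y z)
    (hw : (wordDist S z w : ℝ) + wordDist S w y = wordDist S z y) : IsNearest S A w z := by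
  refine ⟨h.1, fun b hb => ?_⟩
  have h1 := h.le hb
  have h2 := wordDist_triangle hS y w b
  rw [wordDist_comm hS y z, wordDist_comm hS y w] at *
  have h3 : (wordDist S w z : ℝ) ≤ wordDist S w b := by
    rw [wordDist_comm hS w z]; linarith
  exact_mod_cast h3

theorem GeodSeg.carrier_nonempty (κ : GeodSeg S) : κ.carrier.Nonempty := ⟨_, κ.first_mem⟩

theorem IsContracting.mono {D D' : ℝ} {Γ : Set G} (h : IsContracting S D Γ) (hD : D ≤ D') :
    IsContracting S D' Γ := fun κ hκ hd p hp q hq =>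
  (h κ hκ (fun a ha b hb => hD.trans_lt (hd a ha b hb)) p hp q hq).trans_le hD

/-- A geodesic that comes `D`-close to a `D`-contracting set comes close to the projection of its
first point before that. -/
theorem IsContracting.exists_near_first (hS : Subgroup.closure (S : Set G) = ⊤) {Γ : Set G} {D : ℝ}
    (hD : 0 ≤ D) (hΓ : IsContracting S D Γ) (τ : GeodSeg S) {p : G}
    (hp : IsNearest S Γ τ.first p)
    (hex : ∃ k, k ≤ τ.len ∧ ∃ b ∈ Γ, (wordDist S b (τ.pts k) : ℝ) ≤ D) :
    ∃ i, i ≤ τ.len ∧ (wordDist S (τ.pts i) p : ℝ) ≤ 2 * D + 1 ∧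
      ∀ k, k ≤ τ.len → (∃ b ∈ Γ, (wordDist S b (τ.pts k) : ℝ) ≤ D) → i ≤ k := by
  classical
  obtain ⟨hlen, b, hb, hbd⟩ := Nat.find_spec hex
  have hmin : ∀ k, k ≤ τ.len → (∃ b ∈ Γ, (wordDist S b (τ.pts k) : ℝ) ≤ D) → Nat.find hex ≤ k :=
    fun k h1 h2 => Nat.find_min' hex ⟨h1, h2⟩
  rcases Nat.eq_zero_or_pos (Nat.find hex) with h0 | hpos
  · refine ⟨0, Nat.zero_le _, ?_, fun _ _ _ => Nat.zero_le _⟩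
    rw [h0, wordDist_comm hS] at hbd
    have := hp.le hb
    rw [GeodSeg.first] at this
    linarith
  -- Up to the predecessor `m` of the first `D`-close vertex, the geodesic stays outside the
  -- `D`-neighbourhood, so its projection has diameter less than `D`. The edge from `m` to `m + 1`
  -- accounts for the `1` in `2 * D + 1`.
  · obtain ⟨m, hm⟩ : ∃ m, Nat.find hex = m + 1 := ⟨Nat.find hex - 1, by omega⟩
    rw [hm] at hlen hbd
    refine ⟨m, by omega, ?_, fun k h1 h2 => by have := hmin k h1 h2; omega⟩
    obtain ⟨p', hp'⟩ := exists_isNearest (S := S) ⟨b, hb⟩ (τ.pts m)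
    have hdiam := hΓ (τ.sub 0 m).carrier ((τ.sub 0 m).isGeodesic hS) (by
      rintro a ha _ ⟨k, hk, rfl⟩
      have hk' : k ≤ (τ.sub 0 m).len := hk
      rw [GeodSeg.sub_len _ (by omega)] at hk'
      by_contra hcon
      push Not at hcon
      rw [GeodSeg.sub_pts, Nat.zero_add] at hcon
      have := hmin k (by omega) ⟨a, ha, hcon⟩
      omega) p (mem_proj.2 ⟨_, (τ.sub 0 m).first_mem, hp⟩) p' (mem_proj.2 ⟨τ.pts m, by
        have := (τ.sub 0 m).last_mem
        rwa [GeodSeg.sub_last _ (Nat.zero_le _) (by omega)] at this, hp'⟩)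
    have h1 := hp'.le hb
    have h2 := wordDist_triangle hS (τ.pts m) (τ.pts (m + 1)) b
    have h3 := τ.dist_pts (i := m) (j := m + 1) (by omega) hlen
    have h4 := wordDist_triangle hS (τ.pts m) p' p
    rw [wordDist_comm hS p' p] at h4
    rw [wordDist_comm hS b] at hbd
    push_cast at h3
    linarith

/-- A geodesic whose endpoints have distant projections to a contracting set passes near these
projections, in order. -/
theorem IsContracting.exists_near (hS : Subgroup.closure (S : Set G) = ⊤) {Γ : Set G} {D : ℝ}
    (hD : 0 ≤ D) (hΓ : IsContracting S D Γ) (τ : GeodSeg S) {p q : G}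
    (hp : IsNearest S Γ τ.first p) (hq : IsNearest S Γ τ.last q)
    (hpq : D ≤ wordDist S p q) :
    ∃ i j, i ≤ j ∧ j ≤ τ.len ∧ (wordDist S (τ.pts i) p : ℝ) ≤ 2 * D + 1 ∧
      (wordDist S (τ.pts j) q : ℝ) ≤ 2 * D + 1 := by
  have hex : ∃ k, k ≤ τ.len ∧ ∃ b ∈ Γ, (wordDist S b (τ.pts k) : ℝ) ≤ D := by
    by_contra hcon
    push Not at hcon
    refine absurd (hΓ τ.carrier (τ.isGeodesic hS) ?_ p (mem_proj.2 ⟨_, τ.first_mem, hp⟩) q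
      (mem_proj.2 ⟨_, τ.last_mem, hq⟩)) (not_lt.2 hpq)
    rintro a ha _ ⟨k, hk, rfl⟩
    exact hcon k hk a ha
  obtain ⟨k, hk, hnear⟩ := hex
  obtain ⟨i, hi, hip, hi'⟩ := hΓ.exists_near_first hS hD τ hp ⟨k, hk, hnear⟩
  have hrev : ∀ m, m ≤ τ.len → (τ.rev hS).pts (τ.len - m) = τ.pts m := fun m hm => by
    simp only [GeodSeg.rev]
    congr 1
    omega
  -- The same argument from the other end. The `D`-close vertex `k` separates the two vertices
  -- found, whence their order.
  obtain ⟨j, hj, hjq, hj'⟩ := hΓ.exists_near_first hS hD (τ.rev hS) (p := q)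
    (by rwa [GeodSeg.first_rev]) ⟨τ.len - k, Nat.sub_le _ _, by rwa [hrev k hk]⟩
  have hj2 : j ≤ τ.len := hj
  have h1 := hi' k hk hnear
  have h2 := hj' (τ.len - k) (Nat.sub_le _ _) (by rwa [hrev k hk])
  exact ⟨i, τ.len - j, by omega, Nat.sub_le _ _, hip, hjq⟩

/-- Unless `p` and `y` are already `D`-close, every geodesic from `x` to `y` passes within `2 * D +
1` of `p`. So the triangle inequality through a projection point is an equality up to a bounded
error. -/
theorem IsContracting.add_le (hS : Subgroup.closure (S : Set G) = ⊤) {Γ : Set G} {D : ℝ}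
    (hD : 0 ≤ D) (hΓ : IsContracting S D Γ) {x y p : G} (hp : IsNearest S Γ x p) (hy : y ∈ Γ) :
    (wordDist S x p : ℝ) + wordDist S p y ≤ wordDist S x y + (8 * D + 4) := by
  rcases lt_or_ge (wordDist S p y : ℝ) D with h | h
  · have := hp.le hy
    linarith
  · obtain ⟨τ, rfl, rfl⟩ := exists_geodSeg hS x y
    obtain ⟨i, j, hij, hj, h1, h2⟩ := hΓ.exists_near hS hD τ hp (isNearest_self hy) h
    have e1 := τ.dist_pts (i := 0) (j := i) (by omega) (by omega)
    have e2 := τ.dist_pts hij hj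
    have e3 := τ.len_eq
    have e4 := wordDist_triangle hS τ.first (τ.pts i) p
    have e5 := wordDist_triangle hS p (τ.pts i) τ.last
    have e6 := wordDist_triangle hS (τ.pts i) (τ.pts j) τ.last
    rw [wordDist_comm hS p (τ.pts i)] at e5
    have hj' : (j : ℝ) ≤ τ.len := by exact_mod_cast hj
    rw [← e3]
    rw [GeodSeg.first] at *
    push_cast at e1
    linarith

/-- Projection to a contracting set is coarsely Lipschitz. -/
theorem IsContracting.dist_le (hS : Subgroup.closure (S : Set G) = ⊤) {Γ : Set G} {D : ℝ}
    (hD : 0 ≤ D) (hΓ : IsContracting S D Γ) {x y p q : G} (hp : IsNearest S Γ x p)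
    (hq : IsNearest S Γ y q) :
    (wordDist S p q : ℝ) ≤ wordDist S x y + (4 * D + 2) := by
  rcases lt_or_ge (wordDist S p q : ℝ) D with h | h
  · have : (0 : ℝ) ≤ wordDist S x y := Nat.cast_nonneg _
    linarith
  · obtain ⟨τ, rfl, rfl⟩ := exists_geodSeg hS x y
    obtain ⟨i, j, hij, hj, h1, h2⟩ := hΓ.exists_near hS hD τ hp hq h
    have e2 := τ.dist_pts hij hj
    have e5 := wordDist_triangle hS p (τ.pts i) q
    have e6 := wordDist_triangle hS (τ.pts i) (τ.pts j) q
    rw [wordDist_comm hS p (τ.pts i)] at e5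
    have hj' : (j : ℝ) ≤ τ.len := by exact_mod_cast hj
    have hi' : (0 : ℝ) ≤ i := Nat.cast_nonneg _
    rw [← τ.len_eq]
    linarith

/-- A geodesic with endpoints close to a contracting set stays close to it. -/
theorem IsContracting.dist_le_of_endpoints (hS : Subgroup.closure (S : Set G) = ⊤) {Γ : Set G}
    {D A : ℝ} (hD : 0 ≤ D) (hΓ : IsContracting S D Γ) (τ : GeodSeg S) {u v p : G}
    (hu : u ∈ Γ) (hv : v ∈ Γ) (hu' : (wordDist S τ.first u : ℝ) ≤ A)
    (hv' : (wordDist S τ.last v : ℝ) ≤ A) {k : ℕ} (hk : k ≤ τ.len)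
    (hp : IsNearest S Γ (τ.pts k) p) :
    (wordDist S (τ.pts k) p : ℝ) ≤ 2 * A + 8 * D + 4 := by
  have h1 := hΓ.add_le hS hD hp hu
  have h2 := hΓ.add_le hS hD hp hv
  have h3 := wordDist_triangle hS u p v
  have h4 := wordDist_triangle hS (τ.pts k) τ.first u
  have h5 := wordDist_triangle hS (τ.pts k) τ.last v
  have h6 := τ.dist_pts (Nat.zero_le k) hk
  have h7 := τ.dist_pts hk le_rfl
  have h8 := wordDist_triangle hS τ.first u τ.last
  have h9 := wordDist_triangle hS u v τ.last
  rw [← τ.len_eq] at h8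
  rw [wordDist_comm hS u p] at h3
  rw [wordDist_comm hS v] at h9
  rw [wordDist_comm hS (τ.pts 0)] at h6
  rw [GeodSeg.first, GeodSeg.last] at *
  push_cast at h6
  linarith

/-- A geodesic with endpoints close to two points of a contracting geodesic passes close to every
point between them. -/
theorem IsContracting.exists_near_between (hS : Subgroup.closure (S : Set G) = ⊤) {c : ℤ → G}
    {J : Set ℤ} (hc : ∀ i ∈ J, ∀ j ∈ J, (wordDist S (c i) (c j) : ℤ) = |i - j|)
    {D A : ℝ} (hD : 0 ≤ D) (hΓ : IsContracting S D (c '' J)) (τ : GeodSeg S) {i m j : ℤ}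
    (hi : i ∈ J) (hm : m ∈ J) (hj : j ∈ J) (him : i ≤ m) (hmj : m ≤ j)
    (hu : (wordDist S τ.first (c i) : ℝ) ≤ A) (hv : (wordDist S τ.last (c j) : ℝ) ≤ A) :
    ∃ k, k ≤ τ.len ∧ (wordDist S (τ.pts k) (c m) : ℝ) ≤ 9 * A + 16 * D + 8 := by
  have hcR : ∀ i ∈ J, ∀ j ∈ J, (wordDist S (c i) (c j) : ℝ) = |(i : ℝ) - j| := fun i hi j hj => by
    exact_mod_cast hc i hi j hj
  -- The candidate is the vertex at distance `m - i` from the start, capped at the end of `τ`, which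
  -- may be shorter than the stretch it follows.
  obtain ⟨k, hk, hk'⟩ : ∃ k : ℕ, k ≤ τ.len ∧ ((k : ℤ) = m - i ∨ (k = τ.len ∧ (k : ℤ) ≤ m - i)) := by
    rcases le_total (m - i).toNat τ.len with h | h
    · exact ⟨_, h, Or.inl (by omega)⟩
    · exact ⟨τ.len, le_rfl, Or.inr ⟨rfl, by omega⟩⟩
  obtain ⟨_, hp⟩ := exists_isNearest (S := S) (A := c '' J) ⟨c i, i, hi, rfl⟩ (τ.pts k)
  obtain ⟨m', hm', rfl⟩ := hp.1
  have hB := hΓ.dist_le_of_endpoints hS hD τ ⟨i, hi, rfl⟩ ⟨j, hj, rfl⟩ hu hv hk hp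
  have h1 := wordDist_triangle hS (c i) τ.first (c m')
  have h2 := wordDist_triangle hS τ.first (τ.pts k) (c m')
  have h3 := wordDist_triangle hS τ.first (c i) (τ.pts k)
  have h4 := wordDist_triangle hS (c i) (c m') (τ.pts k)
  have h5 := wordDist_triangle hS (c m') (τ.pts k) (c j)
  have h6 := wordDist_triangle hS (τ.pts k) τ.last (c j)
  have h7 := wordDist_triangle hS (τ.pts k) (c m') τ.last
  have h8 := wordDist_triangle hS (c m') (c j) τ.last
  have h9 := wordDist_triangle hS τ.first (c i) τ.last
  have h10 := wordDist_triangle hS (c i) (c j) τ.last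
  have h11 := wordDist_triangle hS (c i) τ.first (c j)
  have h12 := wordDist_triangle hS τ.first τ.last (c j)
  have e1 := τ.dist_pts (Nat.zero_le k) hk
  have e2 := τ.dist_pts hk le_rfl
  have e3 : (τ.len : ℝ) = wordDist S τ.first τ.last := by exact_mod_cast τ.len_eq
  have e4 := wordDist_triangle hS (τ.pts k) (c m') (c m)
  refine ⟨k, hk, ?_⟩
  rw [wordDist_comm hS (c i) τ.first] at *
  rw [wordDist_comm hS (c m') (τ.pts k)] at *
  rw [wordDist_comm hS (c j) τ.last] at *
  rw [hcR i hi j hj] at *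
  rw [hcR i hi m' hm'] at *
  rw [hcR m' hm' j hj] at *
  rw [hcR m' hm' m hm] at *
  change (wordDist S τ.first (τ.pts k) : ℝ) = _ at e1
  push_cast at e1
  change (wordDist S (τ.pts k) τ.last : ℝ) = _ at e2
  have f1 : (i : ℝ) ≤ m := by exact_mod_cast him
  have f2 : (m : ℝ) ≤ j := by exact_mod_cast hmj
  have f3 : (k : ℝ) = m - i ∨ ((k : ℝ) = τ.len ∧ (k : ℝ) ≤ m - i) := by
    rcases hk' with h | ⟨h, h'⟩
    · left; exact_mod_cast h
    · right; exact ⟨by exact_mod_cast h, by exact_mod_cast h'⟩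
  have g1 : |(i : ℝ) - j| = j - i := by rw [abs_sub_comm]; exact abs_of_nonneg (by linarith)
  have hA : 0 ≤ A := le_trans (Nat.cast_nonneg _) hu
  have main : |(m' : ℝ) - m| ≤ 7 * A + 8 * D + 4 := by
    rcases le_total (i : ℝ) m' with h | h
    · have := abs_of_nonpos (by linarith : (i : ℝ) - m' ≤ 0)
      rw [abs_le]
      rcases f3 with h' | ⟨h', h''⟩ <;> constructor <;> linarith
    · have := abs_of_nonpos (by linarith : (m' : ℝ) - j ≤ 0)
      rw [abs_le]
      rcases f3 with h' | ⟨h', h''⟩ <;> constructor <;> linarith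
  linarith

/-- A geodesic whose endpoints are close to those of a contracting segment fellow travels it. -/
theorem IsContracting.fellowTravel (hS : Subgroup.closure (S : Set G) = ⊤) {D A E : ℝ} (hD : 0 ≤ D)
    (κ τ : GeodSeg S) (hκ : IsContracting S D κ.carrier)
    (hu : (wordDist S τ.first κ.first : ℝ) ≤ A) (hv : (wordDist S τ.last κ.last : ℝ) ≤ A)
    (hE : 9 * A + 16 * D + 8 < E) : FellowTravel S E τ κ := by
  have hA : 0 ≤ A := le_trans (Nat.cast_nonneg _) hu
  refine ⟨by linarith, by linarith, ?_, ?_⟩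
  · rintro _ ⟨k, hk, rfl⟩
    obtain ⟨p, hp⟩ := exists_isNearest (S := S) κ.carrier_nonempty (τ.pts k)
    have := hκ.dist_le_of_endpoints hS hD τ κ.first_mem κ.last_mem hu hv hk hp
    exact ⟨p, hp.1, by linarith⟩
  · rintro _ ⟨m, hm, rfl⟩
    have hm' : m ≤ κ.len := hm
    have himg : κ.carrier = (fun i : ℤ => κ.pts i.toNat) '' Set.Icc 0 (κ.len : ℤ) := by
      ext y
      constructor
      · rintro ⟨i, hi, rfl⟩
        have hi' : i ≤ κ.len := hi
        exact ⟨i, by simp [hi'], by simp⟩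
      · rintro ⟨i, ⟨hi, hi'⟩, rfl⟩
        exact κ.pts_mem (by omega)
    rw [himg] at hκ
    obtain ⟨k, hk, hkd⟩ := hκ.exists_near_between hS (i := 0) (m := m) (j := κ.len) (A := A) (by
        rintro i ⟨hi, hi'⟩ j ⟨hj, hj'⟩
        have h := κ.dist_pts_abs hS (i := i.toNat) (j := j.toNat) (by omega) (by omega)
        have hi2 : ((i.toNat : ℕ) : ℝ) = ((i : ℤ) : ℝ) := by
          exact_mod_cast congrArg (Int.cast (R := ℝ)) (Int.toNat_of_nonneg hi)
        have hj2 : ((j.toNat : ℕ) : ℝ) = ((j : ℤ) : ℝ) := by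
          exact_mod_cast congrArg (Int.cast (R := ℝ)) (Int.toNat_of_nonneg hj)
        rw [hi2, hj2] at h
        exact_mod_cast h) hD τ (by simp) (by simp [hm']) (by simp) (by simp)
        (by exact_mod_cast hm') hu hv
    exact ⟨_, τ.pts_mem hk, by simpa using lt_of_le_of_lt hkd hE⟩

end Nearest

/-! ### Alignment, and existence of the four kinds of constants. -/

section Alignment

variable {G : Type*} [Group G] {S : Finset G}

/-- The projection of `z` to `κ` is `C`-close to the last point of `κ`. -/
def NearLast (S : Finset G) (C : ℝ) (κ : GeodSeg S) (z : G) : Prop :=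
  ∀ p, IsNearest S κ.carrier z p → (wordDist S κ.last p : ℝ) < C

/-- The projection of `z` to `κ` is `C`-close to the first point of `κ`. -/
def NearFirst (S : Finset G) (C : ℝ) (κ : GeodSeg S) (z : G) : Prop :=
  ∀ p, IsNearest S κ.carrier z p → (wordDist S κ.first p : ℝ) < C

theorem NearLast.mono {C C' : ℝ} {κ : GeodSeg S} {z : G} (h : NearLast S C κ z) (hC : C ≤ C') :
    NearLast S C' κ z := fun p hp => (h p hp).trans_le hC

theorem NearFirst.mono {C C' : ℝ} {κ : GeodSeg S} {z : G} (h : NearFirst S C κ z) (hC : C ≤ C') :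
    NearFirst S C' κ z := fun p hp => (h p hp).trans_le hC

theorem nearFirst_rev (hS : Subgroup.closure (S : Set G) = ⊤) {C : ℝ} {κ : GeodSeg S} {z : G} :
    NearFirst S C (κ.rev hS) z ↔ NearLast S C κ z := by
  simp only [NearFirst, NearLast, GeodSeg.carrier_rev, GeodSeg.first_rev]

theorem nearLast_rev (hS : Subgroup.closure (S : Set G) = ⊤) {C : ℝ} {κ : GeodSeg S} {z : G} :
    NearLast S C (κ.rev hS) z ↔ NearFirst S C κ z := by
  simp only [NearFirst, NearLast, GeodSeg.carrier_rev, GeodSeg.last_rev]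

theorem PairAligned.nearLast {C : ℝ} {κ κ' : GeodSeg S} (h : PairAligned S C κ κ') {z : G}
    (hz : z ∈ κ'.carrier) : NearLast S C κ z := fun p hp =>
  h.1 _ (Or.inl (mem_proj.2 ⟨_, rfl, isNearest_self κ.last_mem⟩)) p
    (Or.inr (mem_proj.2 ⟨z, hz, hp⟩))

theorem PairAligned.nearFirst {C : ℝ} {κ κ' : GeodSeg S} (h : PairAligned S C κ κ') {z : G}
    (hz : z ∈ κ.carrier) : NearFirst S C κ' z := fun p hp =>
  h.2 _ (Or.inl (mem_proj.2 ⟨_, rfl, isNearest_self κ'.first_mem⟩)) p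
    (Or.inr (mem_proj.2 ⟨z, hz, hp⟩))

theorem PairAligned.mono {C C' : ℝ} {κ κ' : GeodSeg S} (h : PairAligned S C κ κ') (hC : C ≤ C') :
    PairAligned S C' κ κ' :=
  ⟨fun p hp q hq => (h.1 p hp q hq).trans_le hC, fun p hp q hq => (h.2 p hp q hq).trans_le hC⟩

/-- Alignment bounds diameters, whereas the estimates below bound distances from an endpoint `o`;
passing from radius to diameter costs the factor `2`. -/
theorem diamLT_proj_union (hS : Subgroup.closure (S : Set G) = ⊤) {A Y : Set G} {o : G} {C : ℝ}
    (hC : 0 < C) (ho : o ∈ A)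
    (h : ∀ y ∈ Y, ∀ p, IsNearest S A y p → (wordDist S o p : ℝ) < C) :
    DiamLT S (proj S A {o} ∪ proj S A Y) (2 * C) := by
  have key : ∀ p ∈ proj S A {o} ∪ proj S A Y, (wordDist S o p : ℝ) < C := by
    rintro p (hp | hp)
    · obtain ⟨y, rfl, hp'⟩ := mem_proj.1 hp
      rw [hp'.eq_of_mem hS ho, wordDist_self]
      simpa using hC
    · obtain ⟨y, hy, hp⟩ := mem_proj.1 hp
      exact h y hy p hp
  intro p hp q hq
  have h1 := wordDist_triangle hS p o q
  rw [wordDist_comm hS p o] at h1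
  linarith [key p hp, key q hq]

theorem pairAligned_of_near (hS : Subgroup.closure (S : Set G) = ⊤) {C E : ℝ} {κ κ' : GeodSeg S}
    (hC : 0 < C) (hE : 2 * C ≤ E) (h1 : ∀ z ∈ κ'.carrier, NearLast S C κ z)
    (h2 : ∀ z ∈ κ.carrier, NearFirst S C κ' z) : PairAligned S E κ κ' :=
  PairAligned.mono ⟨diamLT_proj_union hS hC κ.last_mem h1,
    diamLT_proj_union hS hC κ'.first_mem h2⟩ hE

theorem nearFirst_point {C : ℝ} (hC : 0 < C) {x z : G} :
    NearFirst S C (GeodSeg.point S x) z := by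
  intro p hp
  have := hp.1
  rw [GeodSeg.carrier_point, Set.mem_singleton_iff] at this
  simpa [this, wordDist_self] using hC

theorem nearLast_point {C : ℝ} (hC : 0 < C) {x z : G} :
    NearLast S C (GeodSeg.point S x) z := by
  intro p hp
  have := hp.1
  rw [GeodSeg.carrier_point, Set.mem_singleton_iff] at this
  simpa [this, wordDist_self] using hC

theorem pairAligned_point_left (hS : Subgroup.closure (S : Set G) = ⊤) {C E : ℝ} {x : G}
    {κ : GeodSeg S} (hC : 0 < C) (hE : 2 * C ≤ E) (h : NearFirst S C κ x) :
    PairAligned S E (GeodSeg.point S x) κ := by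
  refine pairAligned_of_near hS hC hE (fun z _ => nearLast_point hC) fun z hz => ?_
  rw [GeodSeg.carrier_point, Set.mem_singleton_iff] at hz
  rwa [hz]

theorem pairAligned_point_right (hS : Subgroup.closure (S : Set G) = ⊤) {C E : ℝ} {x : G}
    {κ : GeodSeg S} (hC : 0 < C) (hE : 2 * C ≤ E) (h : NearLast S C κ x) :
    PairAligned S E κ (GeodSeg.point S x) := by
  refine pairAligned_of_near hS hC hE (fun z hz => ?_) fun z _ => nearFirst_point hC
  rw [GeodSeg.carrier_point, Set.mem_singleton_iff] at hz
  rwa [hz]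

theorem PairAligned.nearFirst_of_point {C : ℝ} {x : G} {κ : GeodSeg S}
    (h : PairAligned S C (GeodSeg.point S x) κ) : NearFirst S C κ x :=
  h.nearFirst (GeodSeg.point S x).first_mem

theorem PairAligned.nearLast_of_point {C : ℝ} {x : G} {κ : GeodSeg S}
    (h : PairAligned S C κ (GeodSeg.point S x)) : NearLast S C κ x :=
  h.nearLast (GeodSeg.point S x).first_mem

/-! ### Pair constants -/

theorem exists_isPairConst (hS : Subgroup.closure (S : Set G) = ⊤) {D : ℝ} (hD : 0 < D) :
    ∃ E, IsPairConst S D E := by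
  refine ⟨34 * D + 16, by linarith, fun κ γ hκ hγ h1 h2 => ?_⟩
  simp only [Aligned, List.isChain_cons_cons, List.isChain_singleton, and_true] at h1 h2 ⊢
  have hl := h1.nearLast_of_point
  have hf := h2.nearFirst_of_point
  obtain ⟨p, hp⟩ := exists_isNearest (S := S) κ.carrier_nonempty γ.first
  obtain ⟨e, he⟩ := exists_isNearest (S := S) γ.carrier_nonempty κ.first
  have hlp := hl p hp
  have hfe := hf e he
  refine pairAligned_of_near hS (C := 17 * D + 8) (by linarith) (by linarith) ?_ ?_
  · rintro _ ⟨m, hm, rfl⟩ q hq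
    have hm' : m ≤ γ.len := hm
    have hlq := wordDist_triangle hS κ.last p q
    rcases lt_or_ge (wordDist S p q : ℝ) D with hpq | hpq
    · linarith
    obtain ⟨i, j, hij, hj, hi1, hj1⟩ := hκ.exists_near hS hD.le (γ.sub 0 m) (p := p) (q := q)
      hp (by rwa [GeodSeg.sub_last _ (Nat.zero_le _) hm']) hpq
    rw [GeodSeg.sub_len _ hm'] at hj
    simp only [GeodSeg.sub_pts, Nat.zero_add] at hi1 hj1
    obtain ⟨b, hb, rfl⟩ := hq.1
    have hb' : b ≤ κ.len := hb
    -- As `κ.first` projects near `γ.first`, the distance from `κ.first` does not decrease along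
    -- `γ`, up to a bounded error. The vertex `γ.pts i` is near `κ.last`, hence the later vertex
    -- `γ.pts j` cannot be near a point `κ.pts b` far before `κ.last`.
    have a1 := hγ.add_le hS hD.le he (γ.pts_mem (i := j) (by omega))
    have a2 := wordDist_triangle hS γ.first e (γ.pts j)
    have a3 := γ.dist_pts (i := 0) (j := j) (by omega) (by omega)
    have a4 := wordDist_triangle hS κ.first e (γ.pts i)
    have a5 := wordDist_triangle hS e γ.first (γ.pts i)
    have a6 := γ.dist_pts (i := 0) (j := i) (by omega) (by omega)
    have a7 := wordDist_triangle hS κ.first (κ.pts b) (γ.pts j)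
    have a8 := wordDist_triangle hS κ.first (γ.pts i) κ.last
    have a9 := wordDist_triangle hS (γ.pts i) p κ.last
    have a10 := κ.dist_pts (Nat.zero_le b) hb'
    have a11 := κ.dist_pts hb' le_rfl
    have a12 : (κ.len : ℝ) = wordDist S κ.first κ.last := by exact_mod_cast κ.len_eq
    have a13 : (i : ℝ) ≤ j := by exact_mod_cast hij
    rw [wordDist_comm hS e γ.first] at a5
    rw [wordDist_comm hS (κ.pts b) (γ.pts j)] at a7
    rw [wordDist_comm hS p κ.last] at a9
    rw [wordDist_comm hS κ.last (κ.pts b)]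
    change (wordDist S γ.first (γ.pts j) : ℝ) = _ at a3
    change (wordDist S γ.first (γ.pts i) : ℝ) = _ at a6
    change (wordDist S κ.first (κ.pts b) : ℝ) = _ at a10
    change (wordDist S (κ.pts b) κ.last : ℝ) = _ at a11
    push_cast at *
    linarith
  · rintro _ ⟨m, hm, rfl⟩ q hq
    have hm' : m ≤ κ.len := hm
    have hfq := wordDist_triangle hS γ.first e q
    rcases lt_or_ge (wordDist S e q : ℝ) D with heq | heq
    · linarith
    obtain ⟨i, j, hij, hj, hi1, hj1⟩ := hγ.exists_near hS hD.le (κ.sub 0 m) (p := e) (q := q)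
      he (by rwa [GeodSeg.sub_last _ (Nat.zero_le _) hm']) heq
    rw [GeodSeg.sub_len _ hm'] at hj
    simp only [GeodSeg.sub_pts, Nat.zero_add] at hi1 hj1
    -- As `γ.first` projects near `κ.last`, the vertex `κ.pts i`, being close to `e` and so to
    -- `γ.first`, is near the end of `κ`. This leaves no room between `κ.pts i` and `κ.pts j`, hence
    -- none between `e` and `q`.
    have a1 := hκ.add_le hS hD.le hp (κ.pts_mem (i := i) (by omega))
    have a2 := wordDist_triangle hS γ.first e (κ.pts i)
    have a3 := wordDist_triangle hS κ.last p (κ.pts i)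
    have a4 := κ.dist_pts (i := i) (j := κ.len) (by omega) le_rfl
    have a5 := κ.dist_pts (i := i) (j := j) hij (by omega)
    have a6 := wordDist_triangle hS γ.first (κ.pts i) q
    have a7 := wordDist_triangle hS (κ.pts i) (κ.pts j) q
    have a8 : (j : ℝ) ≤ κ.len := by exact_mod_cast (by omega : j ≤ κ.len)
    have a9 : (0 : ℝ) ≤ wordDist S γ.first p := Nat.cast_nonneg _
    rw [wordDist_comm hS e] at a2
    change (wordDist S (κ.pts i) κ.last : ℝ) = _ at a4
    rw [wordDist_comm hS] at a4
    linarith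

/-! ### Hereditary constants -/

/-- If the projection `P` of the earlier point were far from `γ.first`, then `τ` would pass near
`P`, then near `γ.first`, then near `γ.last`. Additivity of lengths along `τ` would make `P` farther
from `γ.last` than `γ.first` is, which is impossible on `γ`. -/
theorem nearFirst_of_earlier (hS : Subgroup.closure (S : Set G) = ⊤) {D : ℝ} (hD : 0 < D)
    {τ γ : GeodSeg S} (hγ : IsContracting S D γ.carrier) {i i' j' : ℕ} (hii : i ≤ i')
    (hij : i' ≤ j') (hj : j' ≤ τ.len) (h1 : NearFirst S D γ (τ.pts i'))
    (h2 : NearLast S D γ (τ.pts j')) : NearFirst S (8 * D + 4) γ (τ.pts i) := by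
  intro P hP
  obtain ⟨p, hp⟩ := exists_isNearest (S := S) γ.carrier_nonempty (τ.pts i')
  obtain ⟨q, hq⟩ := exists_isNearest (S := S) γ.carrier_nonempty (τ.pts j')
  have hfp := h1 p hp
  have hlq := h2 q hq
  obtain ⟨b, hb, hbP⟩ := hP.1
  have hb' : b ≤ γ.len := hb
  have a1 := γ.dist_pts (Nat.zero_le b) hb'
  have a2 := γ.dist_pts hb' le_rfl
  have a3 : (b : ℝ) ≤ γ.len := by exact_mod_cast hb'
  change (wordDist S γ.first (γ.pts b) : ℝ) = _ at a1
  change (wordDist S (γ.pts b) γ.last : ℝ) = _ at a2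
  rw [hbP] at a1 a2
  have a4 := wordDist_triangle hS γ.first p P
  have a5 : (γ.len : ℝ) = wordDist S γ.first γ.last := by exact_mod_cast γ.len_eq
  have a6 := wordDist_triangle hS γ.first p γ.last
  have a7 := wordDist_triangle hS p q γ.last
  rw [wordDist_comm hS q γ.last] at a7
  push_cast at a1
  rcases lt_or_ge (wordDist S P p : ℝ) D with hPp | hPp
  · rw [wordDist_comm hS p P] at a4
    linarith
  -- If `p` and `q` are `D`-close, `γ` itself is shorter than `3 * D` and nothing is left to prove.
  rcases lt_or_ge (wordDist S p q : ℝ) D with hpq | hpq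
  · linarith
  obtain ⟨a, c, hac, hc, ha1, hc1⟩ := hγ.exists_near hS hD.le (τ.sub i i') (p := P) (q := p)
    hP (by rwa [GeodSeg.sub_last _ hii (by omega)]) hPp
  obtain ⟨-, e, -, he, -, he1⟩ := hγ.exists_near hS hD.le (τ.sub i' j') (p := p) (q := q)
    hp (by rwa [GeodSeg.sub_last _ hij hj]) hpq
  rw [GeodSeg.sub_len _ (by omega)] at hc he
  simp only [GeodSeg.sub_pts] at ha1 hc1 he1
  have b1 := τ.dist_pts (i := i + a) (j := i + c) (by omega) (by omega)
  have b2 := τ.dist_pts (i := i + c) (j := i' + e) (by omega) (by omega)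
  have b3 := τ.dist_pts (i := i + a) (j := i' + e) (by omega) (by omega)
  have b4 := wordDist_triangle hS (τ.pts (i + a)) P (τ.pts (i' + e))
  have b5 := wordDist_triangle hS P q (τ.pts (i' + e))
  have b6 := wordDist_triangle hS P γ.last q
  have b7 := wordDist_triangle hS P (τ.pts (i + a)) p
  have b8 := wordDist_triangle hS (τ.pts (i + a)) (τ.pts (i + c)) p
  have b9 := wordDist_triangle hS p (τ.pts (i + c)) q
  have b10 := wordDist_triangle hS (τ.pts (i + c)) (τ.pts (i' + e)) q
  rw [wordDist_comm hS q] at b5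
  rw [wordDist_comm hS P (τ.pts (i + a))] at b7
  rw [wordDist_comm hS p (τ.pts (i + c))] at b9
  rw [wordDist_comm hS p P] at a4
  linarith

theorem exists_isHereditaryConst (hS : Subgroup.closure (S : Set G) = ⊤) {D : ℝ} (hD : 0 < D) :
    ∃ E, IsHereditaryConst S D E := by
  refine ⟨16 * D + 8, by linarith, fun τ γ i i' j' j hi hij hj hlen hγ h => ?_⟩
  simp only [Aligned, List.isChain_cons_cons, List.isChain_singleton, and_true] at h ⊢
  have h1 := h.1.nearFirst_of_point
  have h2 := h.2.nearLast_of_point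
  refine ⟨pairAligned_point_left hS (C := 8 * D + 4) (by linarith) (by linarith) ?_,
    pairAligned_point_right hS (C := 8 * D + 4) (by linarith) (by linarith) ?_⟩
  · exact nearFirst_of_earlier hS hD hγ hi hij (hj.trans hlen) h1 h2
  · have hrev : ∀ m, m ≤ τ.len → (τ.rev hS).pts (τ.len - m) = τ.pts m := fun m hm => by
      simp only [GeodSeg.rev]
      congr 1
      omega
    have key := nearFirst_of_earlier hS hD (τ := τ.rev hS) (γ := γ.rev hS)
      (i := τ.len - j) (i' := τ.len - j') (j' := τ.len - i') (by rwa [GeodSeg.carrier_rev])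
      (by omega) (by omega) (Nat.sub_le _ _)
    rw [hrev j hlen, hrev j' (by omega), hrev i' (by omega)] at key
    rw [nearFirst_rev, nearFirst_rev, nearLast_rev] at key
    exact key h2 h1

/-! ### Subsegments that fellow travel a sequence of segments -/

/-- From the `a`-th vertex on, `τ` contains subsegments, in order, that `E`-fellow travel with
the terms of a list. -/
def FellowChain (S : Finset G) (E : ℝ) (τ : GeodSeg S) : ℕ → List (GeodSeg S) → Prop
  | a, [] => a ≤ τ.len
  | a, κ :: l => ∃ s t, a ≤ s ∧ s ≤ t ∧ t ≤ τ.len ∧ FellowTravel S E (τ.sub s t) κ ∧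
      FellowChain S E τ t l

/-- The recursive form suits induction along the list and cutting at a common prefix, which the
indexed form does not. -/
theorem fellowChain_iff {E : ℝ} {τ : GeodSeg S} {a : ℕ} {l : List (GeodSeg S)} :
    FellowChain S E τ a l ↔ a ≤ τ.len ∧ ∃ s t : Fin l.length → ℕ,
      (∀ i, a ≤ s i ∧ s i ≤ t i ∧ t i ≤ τ.len) ∧ (∀ i j, i < j → t i ≤ s j) ∧
      ∀ i, FellowTravel S E (τ.sub (s i) (t i)) (l.get i) := by
  induction l generalizing a with
  | nil =>
    exact ⟨fun h => ⟨h, fun _ => 0, fun _ => 0, fun i => i.elim0, fun i => i.elim0,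
      fun i => i.elim0⟩, fun h => h.1⟩
  | cons κ l ih =>
    constructor
    · rintro ⟨s, t, h1, h2, h3, h4, h5⟩
      obtain ⟨-, ss, tt, g1, g2, g3⟩ := ih.1 h5
      refine ⟨by omega, Fin.cons s ss, Fin.cons t tt, ?_, ?_, ?_⟩
      · refine Fin.cases ⟨h1, h2, h3⟩ fun i => ?_
        have := g1 i
        simp only [Fin.cons_succ]
        omega
      · refine Fin.cases (Fin.cases (fun h => absurd h (lt_irrefl _)) fun j _ => ?_)
          fun i => Fin.cases (fun h => absurd h (Fin.not_lt_zero _)) fun j hij => ?_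
        · simpa using (g1 j).1
        · simpa using g2 i j (by simpa using hij)
      · exact Fin.cases h4 g3
    · rintro ⟨h0, s, t, h1, h2, h3⟩
      refine ⟨s 0, t 0, (h1 0).1, (h1 0).2.1, (h1 0).2.2, h3 0, ih.2 ⟨(h1 0).2.2,
        fun i => s i.succ, fun i => t i.succ, fun i => ⟨h2 0 i.succ (Fin.succ_pos i),
          (h1 i.succ).2⟩, fun i j hij => h2 _ _ (Fin.succ_lt_succ_iff.2 hij), fun i => h3 i.succ⟩⟩

theorem containsFellow_iff {E : ℝ} {τ : GeodSeg S} {l : List (GeodSeg S)} :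
    ContainsFellow S E τ l ↔ FellowChain S E τ 0 l := by
  simp [fellowChain_iff, ContainsFellow]

/-! ### Concatenation constants -/

/-- Induction from the right end. With `γ` the segment after `κ`, the projections to `γ` of `y` and
of a point `z` of `κ` nearest to `y` are near opposite ends of `γ`. As `γ` is long, a geodesic from
`z` to `y` passes near `γ.first`, at a point whose nearest point on `κ` is still `z`. So `z` is
close to the projection of `γ.first`, that is, to `κ.last`. -/
theorem nearLast_of_aligned (hS : Subgroup.closure (S : Set G) = ⊤) {D L : ℝ} (hD : 0 < D)
    (hL : 10 * D + 3 ≤ L) (y : G) (l : List (GeodSeg S)) (κ : GeodSeg S)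
    (hl : ∀ γ ∈ κ :: l, IsContracting S D γ.carrier ∧ L < (γ.len : ℝ))
    (hal : Aligned S D (κ :: (l ++ [GeodSeg.point S y]))) : NearLast S (8 * D + 3) κ y := by
  induction l generalizing κ with
  | nil =>
    simp only [Aligned, List.nil_append, List.isChain_cons_cons, List.isChain_singleton,
      and_true] at hal
    exact hal.nearLast_of_point.mono (by linarith)
  | cons γ l ih =>
    simp only [Aligned, List.cons_append, List.isChain_cons_cons] at hal
    have hy := ih γ (fun x hx => hl x (List.mem_cons_of_mem _ hx)) hal.2
    obtain ⟨hγ, hγL⟩ := hl γ (by simp)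
    obtain ⟨hκ, -⟩ := hl κ (by simp)
    intro z hz
    obtain ⟨σ, rfl, rfl⟩ := exists_geodSeg hS z y
    obtain ⟨a, ha⟩ := exists_isNearest (S := S) γ.carrier_nonempty σ.first
    obtain ⟨b, hb⟩ := exists_isNearest (S := S) γ.carrier_nonempty σ.last
    obtain ⟨c, hc⟩ := exists_isNearest (S := S) κ.carrier_nonempty γ.first
    have h1 := hal.1.nearFirst hz.1 a ha
    have h2 := hy b hb
    have h3 := hal.1.nearLast γ.first_mem c hc
    have e1 : (γ.len : ℝ) = wordDist S γ.first γ.last := by exact_mod_cast γ.len_eq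
    have e2 := wordDist_triangle hS γ.first a γ.last
    have e3 := wordDist_triangle hS a b γ.last
    rw [wordDist_comm hS b] at e3
    obtain ⟨i, j, hij, hj, hi1, -⟩ := hγ.exists_near hS hD.le σ ha hb (by linarith)
    have hz' : IsNearest S κ.carrier (σ.pts i) σ.first := hz.of_between hS (by
      have g1 := σ.dist_pts (Nat.zero_le i) (hij.trans hj)
      have g2 := σ.dist_pts (hij.trans hj) le_rfl
      have g3 := σ.dist_pts (Nat.zero_le σ.len) le_rfl
      rw [GeodSeg.first, GeodSeg.last, g1, g2, g3]
      ring)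
    have e4 := hκ.dist_le hS hD.le hz' hc
    have e5 := wordDist_triangle hS (σ.pts i) a γ.first
    have e6 := wordDist_triangle hS κ.last c σ.first
    rw [wordDist_comm hS a γ.first] at e5
    rw [wordDist_comm hS c] at e6
    linarith

/-- Walking along `τ`: the vertex `a` projects near the start of the next segment and `τ.last` near
its end, so `τ` passes near both ends after `a` and fellow travels the segment by contraction. The
error in `hfirst` does not accumulate: it is renewed at each segment as `D + (10 * D + 4) + (4 * D +
2)`, that is, alignment, distance of `τ` from the end of the segment, and the Lipschitz error of the
projection. -/
theorem fellowChain_of_aligned (hS : Subgroup.closure (S : Set G) = ⊤) {D L : ℝ} (hD : 0 < D)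
    (hL : 24 * D + 9 ≤ L) (τ : GeodSeg S) (l : List (GeodSeg S)) (a : ℕ) (ha : a ≤ τ.len)
    (hl : ∀ γ ∈ l, IsContracting S D γ.carrier ∧ L < (γ.len : ℝ))
    (hal : Aligned S D (l ++ [GeodSeg.point S τ.last]))
    (hfirst : ∀ κ ∈ l.head?, NearFirst S (15 * D + 6) κ (τ.pts a)) :
    FellowChain S (169 * D + 72) τ a l := by
  induction l generalizing a with
  | nil => exact ha
  | cons κ l ih =>
    have hlast := nearLast_of_aligned hS hD (by linarith) τ.last l κ hl hal
    have hfst := hfirst κ (by simp)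
    obtain ⟨hκ, hκL⟩ := hl κ (by simp)
    obtain ⟨p, hp⟩ := exists_isNearest (S := S) κ.carrier_nonempty (τ.pts a)
    obtain ⟨q, hq⟩ := exists_isNearest (S := S) κ.carrier_nonempty τ.last
    have h1 := hfst p hp
    have h2 := hlast q hq
    have e1 : (κ.len : ℝ) = wordDist S κ.first κ.last := by exact_mod_cast κ.len_eq
    have e2 := wordDist_triangle hS κ.first p κ.last
    have e3 := wordDist_triangle hS p q κ.last
    rw [wordDist_comm hS q] at e3
    obtain ⟨i, j, hij, hj, hi1, hj1⟩ := hκ.exists_near hS hD.le (τ.sub a τ.len) (p := p) (q := q)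
      hp (by rwa [GeodSeg.sub_last _ ha le_rfl]) (by linarith)
    rw [GeodSeg.sub_len _ le_rfl] at hj
    simp only [GeodSeg.sub_pts] at hi1 hj1
    have f1 := wordDist_triangle hS (τ.pts (a + i)) p κ.first
    have f2 := wordDist_triangle hS (τ.pts (a + j)) q κ.last
    rw [wordDist_comm hS p] at f1
    rw [wordDist_comm hS q] at f2
    refine ⟨a + i, a + j, by omega, by omega, by omega, ?_, ?_⟩
    · refine hκ.fellowTravel hS hD.le κ _ (A := 17 * D + 7) ?_ ?_ (by linarith)
      · rw [GeodSeg.sub_first]; linarith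
      · rw [GeodSeg.sub_last _ (by omega) (by omega)]; linarith
    · refine ih (a + j) (by omega) (fun γ hγ => hl γ (List.mem_cons_of_mem _ hγ)) ?_ ?_
      · exact List.IsChain.tail hal
      · intro γ hγ P hP
        obtain ⟨l', rfl⟩ : ∃ l', l = γ :: l' := by
          cases l with
          | nil => simp at hγ
          | cons x l' => exact ⟨l', by simp at hγ; rw [hγ]⟩
        simp only [Aligned, List.cons_append, List.isChain_cons_cons] at hal
        obtain ⟨c, hc⟩ := exists_isNearest (S := S) γ.carrier_nonempty κ.last
        have g1 := hal.1.nearFirst κ.last_mem c hc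
        have g2 := (hl γ (by simp)).1.dist_le hS hD.le hc hP
        have g3 := wordDist_triangle hS γ.first c P
        rw [wordDist_comm hS κ.last] at g2
        linarith

/-- All larger lengths are allowed because in an admissible choice the same `L₁` has to serve both
`D₁` and `D₂`. -/
theorem exists_isConcatConst (hS : Subgroup.closure (S : Set G) = ⊤) {D : ℝ} (hD : 0 < D) :
    ∃ E L, ∀ L', L ≤ L' → IsConcatConst S D E L' := by
  refine ⟨169 * D + 72, 24 * D + 9, fun L' hL' => ⟨by linarith, by linarith,
    fun x y l hl hal τ hx hy => ?_⟩⟩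
  subst hx hy
  rw [containsFellow_iff]
  simp only [Aligned, List.cons_append] at hal
  refine fellowChain_of_aligned hS hD hL' τ l 0 (Nat.zero_le _) hl (List.IsChain.tail hal) ?_
  intro κ hκ
  cases l with
  | nil => simp at hκ
  | cons γ l' =>
    simp only [List.head?_cons, Option.mem_def, Option.some.injEq] at hκ
    subst hκ
    exact (List.isChain_cons_cons.1 hal).1.nearFirst_of_point.mono (by linarith)

/-! ### Converse constants -/

theorem GeodSeg.exists_of_mem_sub {τ : GeodSeg S} {s t : ℕ} (hst : s ≤ t) (ht : t ≤ τ.len) {w : G}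
    (hw : w ∈ (τ.sub s t).carrier) : ∃ k, s ≤ k ∧ k ≤ t ∧ w = τ.pts k := by
  obtain ⟨i, hi, rfl⟩ := hw
  have hi' : i ≤ (τ.sub s t).len := hi
  rw [GeodSeg.sub_len _ ht] at hi'
  exact ⟨s + i, by omega, by omega, rfl⟩

/-- The two segments follow consecutive stretches of `τ`. If `z` on `κ'` is near `τ.pts k'` and its
nearest point on `κ` is near `τ.pts k`, with `k ≤ t ≤ k'`, then comparison with `κ.last` gives `t -
k ≤ 4 * D`; otherwise `κ.last` would be nearer to `z`. -/
theorem pairAligned_of_fellowTravel (hS : Subgroup.closure (S : Set G) = ⊤) {D : ℝ} (hD : 0 < D)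
    {τ κ κ' : GeodSeg S} {s t s' t' : ℕ} (hst : s ≤ t) (hts : t ≤ s') (hst' : s' ≤ t')
    (ht' : t' ≤ τ.len) (h : FellowTravel S D (τ.sub s t) κ)
    (h' : FellowTravel S D (τ.sub s' t') κ') : PairAligned S (12 * D) κ κ' := by
  obtain ⟨-, hl, -, hn⟩ := h
  obtain ⟨hf', -, -, hn'⟩ := h'
  rw [GeodSeg.sub_last _ hst (by omega)] at hl
  rw [GeodSeg.sub_first] at hf'
  refine pairAligned_of_near hS (C := 6 * D) (by linarith) (by linarith) ?_ ?_
  · intro z hz p hp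
    obtain ⟨_, hw, hwz⟩ := hn' z hz
    obtain ⟨k', hk1, hk2, rfl⟩ := GeodSeg.exists_of_mem_sub hst' ht' hw
    obtain ⟨_, hw, hwp⟩ := hn p hp.1
    obtain ⟨k, hk3, hk4, rfl⟩ := GeodSeg.exists_of_mem_sub hst (by omega) hw
    have e1 := hp.le κ.last_mem
    have e2 := wordDist_triangle hS z (τ.pts k') κ.last
    have e3 := wordDist_triangle hS (τ.pts k') (τ.pts t) κ.last
    have e4 := τ.dist_pts (i := t) (j := k') (by omega) (by omega)
    have e5 := τ.dist_pts (i := k) (j := k') (by omega) (by omega)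
    have e6 := wordDist_triangle hS (τ.pts k) p (τ.pts k')
    have e7 := wordDist_triangle hS p z (τ.pts k')
    have e8 := τ.dist_pts (i := k) (j := t) (by omega) (by omega)
    have e9 := wordDist_triangle hS κ.last (τ.pts t) p
    have e10 := wordDist_triangle hS (τ.pts t) (τ.pts k) p
    rw [wordDist_comm hS z (τ.pts k')] at e2 e7
    rw [wordDist_comm hS (τ.pts k') (τ.pts t)] at e3
    rw [wordDist_comm hS p z] at e7
    rw [wordDist_comm hS κ.last (τ.pts t)] at e9
    rw [wordDist_comm hS (τ.pts t) (τ.pts k)] at e10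
    linarith
  · intro z hz p hp
    obtain ⟨_, hw, hwz⟩ := hn z hz
    obtain ⟨k, hk1, hk2, rfl⟩ := GeodSeg.exists_of_mem_sub hst (by omega) hw
    obtain ⟨_, hw, hwp⟩ := hn' p hp.1
    obtain ⟨k', hk3, hk4, rfl⟩ := GeodSeg.exists_of_mem_sub hst' ht' hw
    have e1 := hp.le κ'.first_mem
    have e2 := wordDist_triangle hS z (τ.pts k) κ'.first
    have e3 := wordDist_triangle hS (τ.pts k) (τ.pts s') κ'.first
    have e4 := τ.dist_pts (i := k) (j := s') (by omega) (by omega)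
    have e5 := τ.dist_pts (i := k) (j := k') (by omega) (by omega)
    have e6 := wordDist_triangle hS (τ.pts k) z (τ.pts k')
    have e7 := wordDist_triangle hS z p (τ.pts k')
    have e8 := τ.dist_pts (i := s') (j := k') (by omega) (by omega)
    have e9 := wordDist_triangle hS κ'.first (τ.pts s') p
    have e10 := wordDist_triangle hS (τ.pts s') (τ.pts k') p
    rw [wordDist_comm hS z (τ.pts k)] at e2
    rw [wordDist_comm hS p (τ.pts k')] at e7
    rw [wordDist_comm hS κ'.first (τ.pts s')] at e9
    linarith

theorem FellowChain.aligned (hS : Subgroup.closure (S : Set G) = ⊤) {D : ℝ} (hD : 0 < D)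
    {τ : GeodSeg S} {a : ℕ} {l : List (GeodSeg S)} (h : FellowChain S D τ a l) :
    Aligned S (12 * D) l := by
  induction l generalizing a with
  | nil => exact List.isChain_nil
  | cons κ l ih =>
    obtain ⟨s, t, h1, h2, h3, h4, h5⟩ := h
    cases l with
    | nil => exact List.isChain_singleton _
    | cons κ' l =>
      refine List.isChain_cons_cons.2 ⟨?_, ih h5⟩
      obtain ⟨s', t', g1, g2, g3, g4, -⟩ := h5
      exact pairAligned_of_fellowTravel hS hD h2 g1 g2 g3 h4 g4

theorem fellowTravel_point {D : ℝ} {τ : GeodSeg S} {s : ℕ} (hs : s ≤ τ.len) {x : G}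
    (h : (wordDist S (τ.pts s) x : ℝ) < D) : FellowTravel S D (τ.sub s s) (GeodSeg.point S x) := by
  refine ⟨h, by rwa [GeodSeg.sub_last _ le_rfl hs], ?_, ?_⟩
  · intro w hw
    obtain ⟨k, h1, h2, rfl⟩ := GeodSeg.exists_of_mem_sub le_rfl hs hw
    obtain rfl : k = s := by omega
    exact ⟨x, (GeodSeg.point S x).first_mem, h⟩
  · rintro _ ⟨i, -, rfl⟩
    exact ⟨τ.pts s, (τ.sub s s).first_mem, h⟩

theorem FellowChain.concat_last {D : ℝ} (hD : 0 < D) {τ : GeodSeg S} {a : ℕ}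
    {l : List (GeodSeg S)} (h : FellowChain S D τ a l) :
    FellowChain S D τ a (l ++ [GeodSeg.point S τ.last]) := by
  induction l generalizing a with
  | nil =>
    refine ⟨τ.len, τ.len, h, le_rfl, le_rfl, fellowTravel_point le_rfl ?_, le_rfl⟩
    rw [GeodSeg.last, wordDist_self]
    simpa using hD
  | cons κ l ih =>
    obtain ⟨s, t, h1, h2, h3, h4, h5⟩ := h
    exact ⟨s, t, h1, h2, h3, h4, ih h5⟩

/-- The endpoints of `τ` are degenerate segments that fellow travel degenerate stretches of `τ`, so
the whole sequence is treated uniformly. -/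
theorem isConcatConverseConst (hS : Subgroup.closure (S : Set G) = ⊤) {D : ℝ} (hD : 0 < D) :
    IsConcatConverseConst S D (12 * D) := by
  refine ⟨by linarith, fun τ l h => ?_⟩
  rw [containsFellow_iff] at h
  have h' : FellowChain S D τ 0 (GeodSeg.point S τ.first :: (l ++ [GeodSeg.point S τ.last])) := by
    refine ⟨0, 0, le_rfl, le_rfl, Nat.zero_le _, fellowTravel_point (Nat.zero_le _) ?_,
      h.concat_last hD⟩
    rw [GeodSeg.first, wordDist_self]
    simpa using hD
  exact h'.aligned hS hD

end Alignment

section Axes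

variable {G : Type*} [Group G] {S : Finset G}

/-! ### Segments with endpoints close to a contracting bi-infinite geodesic -/

theorem dist_line {c : ℤ → G} (hc : ∀ i j, (wordDist S (c i) (c j) : ℤ) = |i - j|) (i j : ℤ) :
    (wordDist S (c i) (c j) : ℝ) = |(i : ℝ) - j| := by
  exact_mod_cast hc i j

theorem isGeodesic_line {c : ℤ → G} (hc : ∀ i j, (wordDist S (c i) (c j) : ℤ) = |i - j|) :
    IsGeodesic S (Set.range c) :=
  ⟨Set.univ, c, ⟨0, trivial⟩, Set.ordConnected_univ, fun i _ j _ => hc i j, Set.image_univ.symm⟩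

theorem exists_near_line_between (hS : Subgroup.closure (S : Set G) = ⊤) {c : ℤ → G}
    (hc : ∀ i j, (wordDist S (c i) (c j) : ℤ) = |i - j|) {D A : ℝ} (hD : 0 ≤ D)
    (hΓ : IsContracting S D (Set.range c)) (τ : GeodSeg S) {i m j : ℤ}
    (him : i ≤ m) (hmj : m ≤ j)
    (hu : (wordDist S τ.first (c i) : ℝ) ≤ A) (hv : (wordDist S τ.last (c j) : ℝ) ≤ A) :
    ∃ k, k ≤ τ.len ∧ (wordDist S (τ.pts k) (c m) : ℝ) ≤ 9 * A + 16 * D + 8 := by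
  rw [← Set.image_univ] at hΓ
  exact hΓ.exists_near_between hS (fun i _ j _ => hc i j) hD τ trivial trivial trivial him hmj hu hv

/-- The points of a segment with endpoints close to `c a` and `c b` are close to points between
`c a` and `c b`. -/
theorem exists_near_Icc (hS : Subgroup.closure (S : Set G) = ⊤) {c : ℤ → G}
    (hc : ∀ i j, (wordDist S (c i) (c j) : ℤ) = |i - j|) {D A : ℝ} (hD : 0 ≤ D)
    (hΓ : IsContracting S D (Set.range c)) (κ : GeodSeg S) {a b : ℤ} (hab : a ≤ b)
    (hu : (wordDist S κ.first (c a) : ℝ) ≤ A) (hv : (wordDist S κ.last (c b) : ℝ) ≤ A) {k : ℕ}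
    (hk : k ≤ κ.len) :
    ∃ m, a ≤ m ∧ m ≤ b ∧ (wordDist S (κ.pts k) (c m) : ℝ) ≤ 9 * A + 16 * D + 8 := by
  have hA : 0 ≤ A := le_trans (Nat.cast_nonneg _) hu
  obtain ⟨_, hp⟩ := exists_isNearest (S := S) (A := Set.range c) ⟨c a, a, rfl⟩ (κ.pts k)
  obtain ⟨m, rfl⟩ := hp.1
  have h1 := hΓ.dist_le_of_endpoints hS hD κ ⟨a, rfl⟩ ⟨b, rfl⟩ hu hv hk hp
  have d1 := κ.dist_pts (Nat.zero_le k) hk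
  have d2 := κ.dist_pts hk le_rfl
  change (wordDist S κ.first (κ.pts k) : ℝ) = _ at d1
  change (wordDist S (κ.pts k) κ.last : ℝ) = _ at d2
  have d3 : (κ.len : ℝ) = wordDist S κ.first κ.last := by exact_mod_cast κ.len_eq
  have d4 := wordDist_triangle hS κ.first (c a) κ.last
  have d5 := wordDist_triangle hS (c a) (c b) κ.last
  have d6 := wordDist_triangle hS (c m) (κ.pts k) (c a)
  have d7 := wordDist_triangle hS (κ.pts k) κ.first (c a)
  have d8 := wordDist_triangle hS (c m) (κ.pts k) (c b)
  have d9 := wordDist_triangle hS (κ.pts k) κ.last (c b)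
  have d10 := wordDist_triangle hS (κ.pts k) (c m) (c a)
  have d11 := wordDist_triangle hS (κ.pts k) (c m) (c b)
  rw [wordDist_comm hS (c b) κ.last] at d5
  rw [wordDist_comm hS (c m) (κ.pts k)] at d6 d8
  rw [wordDist_comm hS (κ.pts k) κ.first] at d7
  rw [dist_line hc] at d5 d6 d8 d10 d11
  have hab' : (a : ℝ) ≤ b := by exact_mod_cast hab
  have ab := abs_of_nonpos (by linarith : (a : ℝ) - b ≤ 0)
  push_cast at d1
  rcases lt_or_ge m a with hm | hm
  · have hm' : (m : ℝ) < a := by exact_mod_cast hm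
    have e1 := abs_of_nonpos (by linarith : (m : ℝ) - a ≤ 0)
    have e2 := abs_of_nonpos (by linarith : (m : ℝ) - b ≤ 0)
    have hk0 : (0 : ℝ) ≤ k := Nat.cast_nonneg _
    exact ⟨a, le_rfl, hab, by linarith⟩
  rcases lt_or_ge b m with hm2 | hm2
  · have hm' : (b : ℝ) < m := by exact_mod_cast hm2
    have e1 := abs_of_nonneg (by linarith : 0 ≤ (m : ℝ) - a)
    have e2 := abs_of_nonneg (by linarith : 0 ≤ (m : ℝ) - b)
    have hk0 : (k : ℝ) ≤ κ.len := by exact_mod_cast hk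
    exact ⟨b, hab, le_rfl, by linarith⟩
  · exact ⟨m, hm, hm2, by linarith⟩

/-- The projection to a segment with endpoints close to `c a` and `c b` is, up to a bounded error,
the projection to the line `c` followed by the retraction to the interval `[a, b]`. -/
theorem dist_proj_segment_le (hS : Subgroup.closure (S : Set G) = ⊤) {c : ℤ → G}
    (hc : ∀ i j, (wordDist S (c i) (c j) : ℤ) = |i - j|) {D A : ℝ} (hD : 0 ≤ D)
    (hΓ : IsContracting S D (Set.range c)) (κ : GeodSeg S) {a b : ℤ} (hab : a ≤ b)
    (hu : (wordDist S κ.first (c a) : ℝ) ≤ A) (hv : (wordDist S κ.last (c b) : ℝ) ≤ A)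
    {x P : G} {i : ℤ} (hi : IsNearest S (Set.range c) x (c i)) (hP : IsNearest S κ.carrier x P) :
    (wordDist S P (c (max a (min b i))) : ℝ) ≤ 27 * A + 56 * D + 28 := by
  obtain ⟨k, hk, rfl⟩ := hP.1
  obtain ⟨m, ham, hmb, hm⟩ := exists_near_Icc hS hc hD hΓ κ hab hu hv hk
  set e := max a (min b i) with he
  have hae : a ≤ e := le_max_left _ _
  have heb : e ≤ b := max_le hab (min_le_left _ _)
  -- As `m` lies in `[a, b]`, the retraction `e` of `i` lies between `i` and `m`: the way from `x`
  -- to `c m` leads past `c i` and then past `c e`, which is close to a point of `κ`.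
  have hie : |i - m| = |i - e| + |e - m| := by
    rcases le_total i a with h | h
    · have : e = a := by omega
      rw [this, abs_of_nonpos (by omega), abs_of_nonpos (by omega), abs_of_nonpos (by omega)]
      ring
    · rcases le_total i b with h' | h'
      · have : e = i := by omega
        simp [this]
      · have : e = b := by omega
        rw [this, abs_of_nonneg (by omega), abs_of_nonneg (by omega), abs_of_nonneg (by omega)]
        ring
  obtain ⟨k', hk', hk2⟩ := exists_near_line_between hS hc hD hΓ κ hae heb hu hv
  have h1 := hP.le (κ.pts_mem hk')
  have h2 := hΓ.add_le hS hD hi ⟨m, rfl⟩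
  have h3 := wordDist_triangle hS x (c i) (κ.pts k')
  have h4 := wordDist_triangle hS (c i) (c e) (κ.pts k')
  have h5 := wordDist_triangle hS x (κ.pts k) (c m)
  have h6 := wordDist_triangle hS (κ.pts k) (c m) (c e)
  rw [wordDist_comm hS (c e) (κ.pts k')] at h4
  rw [wordDist_comm hS (c m) (c e)] at h6
  rw [dist_line hc] at h2 h4 h6
  have hie' : |(i : ℝ) - m| = |(i : ℝ) - e| + |(e : ℝ) - m| := by exact_mod_cast hie
  linarith

/-- Retraction to the interval spanned by `a` and `b` does not increase the distance from `a`. No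
order of `a` and `b` is assumed, since powers of an element may run along its axis in either
direction. -/
theorem dist_proj_segment_le' (hS : Subgroup.closure (S : Set G) = ⊤) {c : ℤ → G}
    (hc : ∀ i j, (wordDist S (c i) (c j) : ℤ) = |i - j|) {D A : ℝ} (hD : 0 ≤ D)
    (hΓ : IsContracting S D (Set.range c)) (κ : GeodSeg S) {a b : ℤ}
    (hu : (wordDist S κ.first (c a) : ℝ) ≤ A) (hv : (wordDist S κ.last (c b) : ℝ) ≤ A)
    {x P p : G} (hp : IsNearest S (Set.range c) x p) (hP : IsNearest S κ.carrier x P) :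
    (wordDist S P (c a) : ℝ) ≤ 27 * A + 56 * D + 28 + wordDist S (c a) p := by
  obtain ⟨i, rfl⟩ := hp.1
  have main : ∀ e, |a - e| ≤ |a - i| → (wordDist S P (c e) : ℝ) ≤ 27 * A + 56 * D + 28 →
      (wordDist S P (c a) : ℝ) ≤ 27 * A + 56 * D + 28 + wordDist S (c a) (c i) := by
    intro e he h
    have h1 := wordDist_triangle hS P (c e) (c a)
    rw [wordDist_comm hS (c e) (c a), dist_line hc] at h1
    rw [dist_line hc]
    have : |(a : ℝ) - e| ≤ |(a : ℝ) - i| := by exact_mod_cast he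
    linarith
  rcases le_total a b with hab | hab
  · refine main _ ?_ (dist_proj_segment_le hS hc hD hΓ κ hab hu hv hp hP)
    rw [abs_le, ← max_comm]
    constructor <;> rcases abs_cases (a - i) with ⟨h, _⟩ | ⟨h, _⟩ <;> omega
  · refine main _ ?_ (dist_proj_segment_le hS hc hD hΓ (κ.rev hS) hab
      (by rwa [GeodSeg.first_rev]) (by rwa [GeodSeg.last_rev]) hp
      (by rwa [GeodSeg.carrier_rev]))
    rw [abs_le]
    constructor <;> rcases abs_cases (a - i) with ⟨h, _⟩ | ⟨h, _⟩ <;> omega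

/-- A segment with endpoints close to a contracting bi-infinite geodesic is contracting. -/
theorem isContracting_segment (hS : Subgroup.closure (S : Set G) = ⊤) {c : ℤ → G}
    (hc : ∀ i j, (wordDist S (c i) (c j) : ℤ) = |i - j|) {D A : ℝ} (hD : 0 ≤ D)
    (hΓ : IsContracting S D (Set.range c)) (κ : GeodSeg S) {a b : ℤ}
    (hu : (wordDist S κ.first (c a) : ℝ) ≤ A) (hv : (wordDist S κ.last (c b) : ℝ) ≤ A) :
    IsContracting S (54 * A + 113 * D + 60) κ.carrier := by
  have hA : 0 ≤ A := le_trans (Nat.cast_nonneg _) hu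
  wlog hab : a ≤ b generalizing κ a b
  · have := this (κ.rev hS) (by rwa [GeodSeg.first_rev]) (by rwa [GeodSeg.last_rev]) (le_of_not_ge hab)
    rwa [GeodSeg.carrier_rev] at this
  intro η hη hfar P hP₀ Q hQ₀
  obtain ⟨x, hx, hP⟩ := mem_proj.1 hP₀
  obtain ⟨y, hy, hQ⟩ := mem_proj.1 hQ₀
  clear hP₀ hQ₀
  obtain ⟨_, hi⟩ := exists_isNearest (S := S) (A := Set.range c) ⟨c a, a, rfl⟩ x
  obtain ⟨i, rfl⟩ := hi.1
  obtain ⟨_, hj⟩ := exists_isNearest (S := S) (A := Set.range c) ⟨c a, a, rfl⟩ y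
  obtain ⟨j, rfl⟩ := hj.1
  wlog hij : i ≤ j generalizing i j x y P Q
  · rw [wordDist_comm hS]
    exact this Q P y hy hQ x hx hP j hj i hi (le_of_not_ge hij)
  by_contra hcon
  push Not at hcon
  have h1 := dist_proj_segment_le hS hc hD hΓ κ hab hu hv hi hP
  have h2 := dist_proj_segment_le hS hc hD hΓ κ hab hu hv hj hQ
  obtain ⟨e, he⟩ : ∃ e, e = max a (min b i) := ⟨_, rfl⟩
  obtain ⟨f, hf⟩ : ∃ f, f = max a (min b j) := ⟨_, rfl⟩
  rw [← he] at h1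
  rw [← hf] at h2
  have h3 := wordDist_triangle hS P (c e) Q
  have h4 := wordDist_triangle hS (c e) (c f) Q
  rw [wordDist_comm hS (c f), dist_line hc] at h4
  have hef : e ≤ f := by omega
  have hef' : (e : ℝ) ≤ f := by exact_mod_cast hef
  have h5 := abs_of_nonpos (by linarith : (e : ℝ) - f ≤ 0)
  have hlt : e < f := by
    have : (e : ℝ) < f := by linarith
    exact_mod_cast this
  -- Since the retractions satisfy `e < f`, the point `c e` lies between the projections of `x` and
  -- `y` to the line. Both `η` and `κ` then pass close to `c e`, which contradicts `hfar`.
  have hie : i ≤ e := by omega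
  have hej : e ≤ j := by omega
  have hfj : f ≤ j := by omega
  have hie' : (i : ℝ) ≤ e := by exact_mod_cast hie
  have hfj' : (f : ℝ) ≤ j := by exact_mod_cast hfj
  have h6 := abs_of_nonpos (by linarith : (i : ℝ) - j ≤ 0)
  obtain ⟨τ, rfl, rfl, hτ⟩ := hη.exists_geodSeg hS hx hy
  obtain ⟨k, l, hkl, hl, hk1, hl1⟩ := hΓ.exists_near hS hD τ hi hj
    (by rw [dist_line hc]; linarith)
  obtain ⟨m, hm, hm1⟩ := exists_near_line_between hS hc hD hΓ (τ.sub k l) (A := 2 * D + 1) hie hej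
    (by rwa [GeodSeg.sub_first]) (by rwa [GeodSeg.sub_last _ hkl hl])
  obtain ⟨n, hn, hn1⟩ := exists_near_line_between hS hc hD hΓ κ
    (by omega : a ≤ e) (by omega : e ≤ b) hu hv
  have h7 := hfar _ (κ.pts_mem hn) _ (hτ (GeodSeg.sub_carrier_subset _ hkl hl
    ((τ.sub k l).pts_mem hm)))
  have h8 := wordDist_triangle hS (κ.pts n) (c e) ((τ.sub k l).pts m)
  rw [wordDist_comm hS (c e)] at h8
  linarith

end Axes

/-! ### Contracting elements: conjugates, powers and almost-stabilisers of an axis. -/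

section Elements

variable {G : Type*} [Group G] {S : Finset G}

/-! ### Translates -/

theorem isNearest_translate {A : Set G} {h x p : G} :
    IsNearest S ((h * ·) '' A) (h * x) (h * p) ↔ IsNearest S A x p := by
  constructor
  · rintro ⟨⟨a, ha, hap⟩, h2⟩
    obtain rfl : a = p := mul_left_cancel hap
    refine ⟨ha, fun b hb => ?_⟩
    simpa only [wordDist_mul_left] using h2 _ ⟨b, hb, rfl⟩
  · rintro ⟨h1, h2⟩
    refine ⟨⟨p, h1, rfl⟩, ?_⟩
    rintro _ ⟨b, hb, rfl⟩
    simpa only [wordDist_mul_left] using h2 b hb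

theorem isNearest_translate_iff {A : Set G} {h x p : G} :
    IsNearest S ((h * ·) '' A) x p ↔ IsNearest S A (h⁻¹ * x) (h⁻¹ * p) := by
  rw [← isNearest_translate (h := h) (x := h⁻¹ * x), mul_inv_cancel_left, mul_inv_cancel_left]

theorem IsGeodesic.translate {η : Set G} (hη : IsGeodesic S η) (h : G) :
    IsGeodesic S ((h * ·) '' η) := by
  obtain ⟨J, c, h1, h2, h3, rfl⟩ := hη
  exact ⟨J, fun i => h * c i, h1, h2, fun i hi j hj => by rw [wordDist_mul_left, h3 i hi j hj],
    by rw [Set.image_image]⟩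

theorem DiamLT.proj_translate {A Y : Set G} {K : ℝ} (hd : DiamLT S (proj S A Y) K) (h : G) :
    DiamLT S (proj S ((h * ·) '' A) ((h * ·) '' Y)) K := by
  intro p hp q hq
  obtain ⟨_, ⟨x, hx, rfl⟩, hp⟩ := mem_proj.1 hp
  obtain ⟨_, ⟨y, hy, rfl⟩, hq⟩ := mem_proj.1 hq
  rw [isNearest_translate_iff, inv_mul_cancel_left] at hp hq
  have := hd _ (mem_proj.2 ⟨x, hx, hp⟩) _ (mem_proj.2 ⟨y, hy, hq⟩)
  rwa [wordDist_mul_left] at this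

theorem image_inv_mul_image (h : G) (A : Set G) : (h * ·) '' ((h⁻¹ * ·) '' A) = A := by
  rw [Set.image_image]
  simp only [mul_inv_cancel_left, Set.image_id']

theorem IsContracting.translate {D : ℝ} {Γ : Set G} (hΓ : IsContracting S D Γ) (h : G) :
    IsContracting S D ((h * ·) '' Γ) := by
  intro κ hκ hd
  have h1 := (hΓ ((h⁻¹ * ·) '' κ) (hκ.translate h⁻¹) (by
    rintro p hp _ ⟨q, hq, rfl⟩
    have := hd _ ⟨p, hp, rfl⟩ q hq
    rw [← wordDist_mul_left S h⁻¹] at this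
    simpa using this)).proj_translate h
  rwa [image_inv_mul_image] at h1

theorem IsAxis.conj (hS : Subgroup.closure (S : Set G) = ⊤) {g : G} {γ : Set G}
    (hγ : IsAxis S g γ) (h : G) : IsAxis S (h * g * h⁻¹) ((h * ·) '' γ) := by
  obtain ⟨⟨c, hc, rfl⟩, R, h1, h2⟩ := hγ
  have key : ∀ (p : G) (i : ℤ), wordDist S p (g ^ i) ≤ R →
      wordDist S (h * p) ((h * g * h⁻¹) ^ i) ≤ R + wordNorm S h⁻¹ := by
    intro p i hp
    have e1 := wordDist_triangle hS (h * p) (h * g ^ i) (h * g ^ i * h⁻¹)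
    have e2 : wordDist S (h * g ^ i) (h * g ^ i * h⁻¹) = wordNorm S h⁻¹ := by
      rw [wordDist, inv_mul_cancel_left]
    rw [wordDist_mul_left, e2] at e1
    rw [conj_zpow]
    have e3 : wordDist S (h * p) (h * g ^ i * h⁻¹) ≤ wordDist S p (g ^ i) + wordNorm S h⁻¹ := by
      exact_mod_cast e1
    omega
  refine ⟨⟨fun i => h * c i, fun i j => by rw [wordDist_mul_left, hc], ?_⟩,
    R + wordNorm S h⁻¹, ?_, ?_⟩
  · rw [← Set.range_comp]; rfl
  · rintro _ ⟨p, hp, rfl⟩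
    obtain ⟨i, hi⟩ := h1 p hp
    exact ⟨i, key p i hi⟩
  · intro i
    obtain ⟨p, hp, hi⟩ := h2 i
    exact ⟨_, ⟨p, hp, rfl⟩, key p i hi⟩

/-! ### Elements with an axis -/

theorem line_injective (hS : Subgroup.closure (S : Set G) = ⊤) {c : ℤ → G}
    (hc : ∀ i j, (wordDist S (c i) (c j) : ℤ) = |i - j|) : Function.Injective c := by
  intro i j hij
  have h := hc i j
  rw [(wordDist_eq_zero hS).2 hij] at h
  have := abs_eq_zero.1 h.symm
  omega

theorem IsAxis.not_isOfFinOrder (hS : Subgroup.closure (S : Set G) = ⊤) {g : G} {γ : Set G}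
    (hγ : IsAxis S g γ) : ¬ IsOfFinOrder g := by
  intro hfin
  obtain ⟨⟨c, hc, rfl⟩, R, h1, -⟩ := hγ
  have hz : (Subgroup.zpowers g : Set G).Finite := finite_zpowers.2 hfin
  have hfin2 : (Set.image2 (fun a b : G => a * b) (Subgroup.zpowers g : Set G)
      {b | wordNorm S b ≤ R}).Finite := hz.image2 _ (finite_wordNorm_le hS R)
  refine (Set.infinite_of_injective_forall_mem (line_injective hS hc) fun i => ?_) hfin2
  obtain ⟨k, hk⟩ := h1 (c i) ⟨i, rfl⟩
  rw [wordDist_comm hS] at hk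
  exact ⟨g ^ k, ⟨k, rfl⟩, (g ^ k)⁻¹ * c i, hk, by simp⟩

theorem exists_pow_norm (hS : Subgroup.closure (S : Set G) = ⊤) {a : G} (ha : ¬ IsOfFinOrder a)
    {L : ℝ} (hL : 0 < L) :
    ∃ p : ℕ, L ≤ wordNorm S (a ^ p) ∧ (wordNorm S (a ^ p) : ℝ) ≤ L + wordNorm S a := by
  classical
  have hex : ∃ p : ℕ, L ≤ wordNorm S (a ^ p) := by
    by_contra hcon
    push Not at hcon
    exact (Set.infinite_of_injective_forall_mem (injective_pow_iff_not_isOfFinOrder.2 ha)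
      fun p => (hcon p).le) (finite_ball hS L)
  refine ⟨Nat.find hex, Nat.find_spec hex, ?_⟩
  obtain ⟨m, hm⟩ : ∃ m, Nat.find hex = m + 1 := by
    refine ⟨Nat.find hex - 1, ?_⟩
    have : Nat.find hex ≠ 0 := fun h0 => by
      have := Nat.find_spec hex
      rw [h0, pow_zero, wordNorm_one] at this
      norm_num at this
      linarith
    omega
  have h1 := Nat.find_min hex (m := m) (by omega)
  push Not at h1
  rw [hm, pow_succ]
  have h2 : (wordNorm S (a ^ m * a) : ℝ) ≤ wordNorm S (a ^ m) + wordNorm S a := by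
    exact_mod_cast wordNorm_mul_le hS _ _
  linarith

/-- If the translate of a contracting axis by `h` has a large projection to the axis, then `h`
conjugates some power of `g` to a nontrivial power. -/
theorem exists_zpow_conj_of_proj (hS : Subgroup.closure (S : Set G) = ⊤) {c : ℤ → G}
    (hc : ∀ i j, (wordDist S (c i) (c j) : ℤ) = |i - j|) {D : ℝ} (hD : 0 ≤ D)
    (hΓ : IsContracting S D (Set.range c)) {g : G} {R : ℕ}
    (hR : ∀ i : ℤ, ∃ e : ℤ, wordDist S (c i) (g ^ e) ≤ R) :
    ∃ K : ℝ, 0 < K ∧ ∀ h : G, ¬ DiamLT S (proj S (Set.range c) ((h * ·) '' Set.range c)) K →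
      ∃ k m : ℤ, m ≠ 0 ∧ h * g ^ k * h⁻¹ = g ^ m := by
  obtain ⟨W, hW⟩ : ∃ W : ℝ, W = 34 * D + 17 + 2 * R := ⟨_, rfl⟩
  obtain ⟨N, hN⟩ : ∃ N : ℕ, N = (ball S W).ncard := ⟨_, rfl⟩
  -- A projection of this size has room for `N + 1` vertices with spacing `2 * R + 1`, one more than
  -- there are elements in the ball of radius `W`.
  refine ⟨N * (2 * R + 1) + D + 1, by positivity, fun h hbig => ?_⟩
  simp only [DiamLT, not_forall, not_lt] at hbig
  obtain ⟨p, hp, q, hq, hpq⟩ := hbig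
  obtain ⟨x, hx, hp⟩ := mem_proj.1 hp
  obtain ⟨y, hy, hq⟩ := mem_proj.1 hq
  obtain ⟨i, j, hij, x, y, hx, hy, hi, hj⟩ : ∃ i j : ℤ, (N * (2 * R + 1) + D + 1 : ℝ) ≤ j - i ∧
      ∃ x y, x ∈ (h * ·) '' Set.range c ∧ y ∈ (h * ·) '' Set.range c ∧
        IsNearest S (Set.range c) x (c i) ∧ IsNearest S (Set.range c) y (c j) := by
    obtain ⟨i, rfl⟩ := hp.1
    obtain ⟨j, rfl⟩ := hq.1
    rw [dist_line hc] at hpq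
    rcases abs_cases ((i : ℝ) - j) with ⟨h1, -⟩ | ⟨h1, -⟩
    · exact ⟨j, i, by linarith, y, x, hy, hx, hq, hp⟩
    · exact ⟨i, j, by linarith, x, y, hx, hy, hp, hq⟩
  obtain ⟨τ, rfl, rfl, hτ⟩ := ((isGeodesic_line hc).translate h).exists_geodSeg hS hx hy
  have hN0 : (0 : ℝ) ≤ N * (2 * R + 1) := by positivity
  obtain ⟨k, l, hkl, hl, hk1, hl1⟩ := hΓ.exists_near hS hD τ hi hj (by
    rw [dist_line hc, abs_sub_comm, abs_of_nonneg (by linarith)]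
    linarith)
  have near : ∀ m, i ≤ m → m ≤ j → ∃ e n : ℤ, wordDist S (c m) (g ^ e) ≤ R ∧
      (g ^ e)⁻¹ * (h * g ^ n) ∈ ball S W := by
    intro m him hmj
    obtain ⟨s, hs, hs1⟩ := exists_near_line_between hS hc hD hΓ (τ.sub k l) (A := 2 * D + 1) him hmj
      (by rwa [GeodSeg.sub_first]) (by rwa [GeodSeg.sub_last _ hkl hl])
    obtain ⟨_, ⟨t, rfl⟩, ht⟩ :=
      hτ (GeodSeg.sub_carrier_subset _ hkl hl ((τ.sub k l).pts_mem hs))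
    obtain ⟨e, he⟩ := hR m
    obtain ⟨n, hn⟩ := hR t
    refine ⟨e, n, he, ?_⟩
    change (wordDist S (g ^ e) (h * g ^ n) : ℝ) ≤ W
    rw [← ht] at hs1
    rw [← wordDist_mul_left S h] at hn
    have he' : (wordDist S (c m) (g ^ e) : ℝ) ≤ R := by exact_mod_cast he
    have hn' : (wordDist S (h * c t) (h * g ^ n) : ℝ) ≤ R := by exact_mod_cast hn
    have h1 := wordDist_triangle hS (g ^ e) (c m) (h * g ^ n)
    have h2 := wordDist_triangle hS (c m) (h * c t) (h * g ^ n)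
    rw [wordDist_comm hS (g ^ e) (c m)] at h1
    rw [wordDist_comm hS (c m) (h * c t)] at h2
    change (wordDist S (h * c t) (c m) : ℝ) ≤ _ at hs1
    linarith
  have near' : ∀ r : Fin (N + 1), ∃ e n : ℤ, wordDist S (c (i + r * (2 * R + 1))) (g ^ e) ≤ R ∧
      (g ^ e)⁻¹ * (h * g ^ n) ∈ ball S W := by
    intro r
    refine near _ (by nlinarith [r.2]) ?_
    have h1 : ((r : ℕ) : ℝ) ≤ N := by exact_mod_cast Nat.lt_succ_iff.1 r.2
    have h2 : ((r : ℕ) : ℝ) * (2 * R + 1) ≤ N * (2 * R + 1) :=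
      mul_le_mul_of_nonneg_right h1 (by positivity)
    have h3 : (i : ℝ) + (r : ℕ) * (2 * R + 1) ≤ j := by linarith
    exact_mod_cast h3
  choose e n he hmem using near'
  obtain ⟨r, -, r', -, hrr, heq⟩ := Finset.exists_ne_map_eq_of_card_lt_of_maps_to
    (s := Finset.univ) (t := (finite_ball hS W).toFinset)
    (f := fun r : Fin (N + 1) => (g ^ e r)⁻¹ * (h * g ^ n r)) (by
      rw [Finset.card_univ, Fintype.card_fin, ← Set.ncard_eq_toFinset_card _ (finite_ball hS W)]
      omega) (fun r _ => by simpa using hmem r)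
  refine ⟨n r - n r', e r - e r', ?_, ?_⟩
  -- Equal exponents would place two vertices at distance at least `2 * R + 1` within `R` of the
  -- same power of `g`.
  · intro h0
    have h0' : e r = e r' := by omega
    have h1 := wordDist_triangle hS (c (i + r * (2 * R + 1))) (g ^ e r) (c (i + r' * (2 * R + 1)))
    have h2 : (wordDist S (c (i + r * (2 * R + 1))) (g ^ e r) : ℝ) ≤ R := by exact_mod_cast he r
    have h3 : (wordDist S (g ^ e r) (c (i + r' * (2 * R + 1))) : ℝ) ≤ R := by
      rw [h0', wordDist_comm hS]
      exact_mod_cast he r'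
    rw [dist_line hc] at h1
    have h4 : |(i + (r : ℤ) * (2 * R + 1)) - (i + (r' : ℤ) * (2 * R + 1))| ≤ 2 * (R : ℤ) := by
      have : |((i + (r : ℤ) * (2 * R + 1) : ℤ) : ℝ) - ((i + (r' : ℤ) * (2 * R + 1) : ℤ) : ℝ)|
          ≤ 2 * (R : ℝ) := by linarith
      exact_mod_cast this
    have h5 : (i + (r : ℤ) * (2 * R + 1)) - (i + (r' : ℤ) * (2 * R + 1)) =
        ((r : ℤ) - r') * (2 * R + 1) := by ring
    rw [h5, abs_mul, abs_of_nonneg (by positivity : (0 : ℤ) ≤ 2 * R + 1)] at h4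
    have h6 : 1 ≤ |(r : ℤ) - r'| := Int.one_le_abs (by
      intro h
      exact hrr (Fin.ext (by omega)))
    nlinarith
  · have h1 : h * g ^ n r = g ^ e r * ((g ^ e r')⁻¹ * (h * g ^ n r')) := by
      rw [← heq, mul_inv_cancel_left]
    rw [zpow_sub, zpow_sub, ← mul_assoc, h1]
    group

/-- Elements that conjugate a nontrivial power of `g` to a power of `g` lie close to `⟨g⟩`. -/
theorem exists_near_zpow_of_conj (hS : Subgroup.closure (S : Set G) = ⊤) {c : ℤ → G}
    (hc : ∀ i j, (wordDist S (c i) (c j) : ℤ) = |i - j|) {D : ℝ} (hD : 0 ≤ D)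
    (hΓ : IsContracting S D (Set.range c)) {g : G} {R : ℕ}
    (hR : ∀ i : ℤ, ∃ e : ℤ, wordDist S (c i) (g ^ e) ≤ R)
    (hR' : ∀ e : ℤ, ∃ i : ℤ, wordDist S (c i) (g ^ e) ≤ R) :
    ∃ W : ℝ, ∀ h : G, (∃ k m : ℤ, k ≠ 0 ∧ h * g ^ k * h⁻¹ = g ^ m) →
      ∃ e : ℤ, (g ^ e)⁻¹ * h ∈ ball S W := by
  refine ⟨wordNorm S (c 0) + (12 * D + 6) + R, fun h ⟨k, m, hk, hkm⟩ => ?_⟩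
  -- The translated axis stays in a bounded neighbourhood of the axis, because `h * g ^ e` depends
  -- on `e` only modulo `k` up to a power of `g` on the left. This bound `T` still depends on `h`.
  obtain ⟨T, hT⟩ : ∃ T : ℝ, ∀ n : ℤ, ∃ i : ℤ, (wordDist S (h * c n) (c i) : ℝ) ≤ T := by
    obtain ⟨T, hT⟩ := ((Set.finite_Ico (0 : ℤ) |k|).image fun r => wordNorm S (h * g ^ r)).bddAbove
    refine ⟨R + T + R, fun n => ?_⟩
    obtain ⟨e, he⟩ := hR n
    obtain ⟨i, hi⟩ := hR' (m * (e / k))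
    refine ⟨i, ?_⟩
    have h1 : h * g ^ e = g ^ (m * (e / k)) * (h * g ^ (e % k)) := by
      conv_lhs => rw [← Int.mul_ediv_add_emod e k]
      rw [zpow_add, zpow_mul, zpow_mul, ← hkm, conj_zpow]
      group
    have h2 : wordNorm S (h * g ^ (e % k)) ≤ T :=
      hT ⟨e % k, ⟨Int.emod_nonneg _ hk, Int.emod_lt_abs _ hk⟩, rfl⟩
    have h3 : wordDist S (g ^ (m * (e / k))) (h * g ^ e) ≤ T := by
      rw [h1, wordDist, inv_mul_cancel_left]
      exact h2
    rw [← wordDist_mul_left S h] at he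
    have e1 := wordDist_triangle hS (h * c n) (h * g ^ e) (c i)
    have e2 := wordDist_triangle hS (h * g ^ e) (g ^ (m * (e / k))) (c i)
    rw [wordDist_comm hS (h * g ^ e) (g ^ (m * (e / k)))] at e2
    rw [wordDist_comm hS (c i)] at hi
    have f1 : (wordDist S (h * c n) (h * g ^ e) : ℝ) ≤ R := by exact_mod_cast he
    have f2 : (wordDist S (g ^ (m * (e / k))) (c i) : ℝ) ≤ R := by exact_mod_cast hi
    have f3 : (wordDist S (g ^ (m * (e / k))) (h * g ^ e) : ℝ) ≤ T := by exact_mod_cast h3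
    linarith
  have hT0 : 0 ≤ T := by
    obtain ⟨i, hi⟩ := hT 0
    exact le_trans (Nat.cast_nonneg _) hi
  -- The dependence on `h` is removed by a long segment of the translated axis centred at `h * c 0`:
  -- its ends are only `T`-close to the axis, but its midpoint is `(12 * D + 6)`-close by
  -- contraction.
  obtain ⟨n, hn⟩ := exists_nat_ge (T + 3 * D + 1)
  obtain ⟨τ, hτ⟩ : ∃ τ : GeodSeg S, τ.len = 2 * n ∧ ∀ i, τ.pts i = h * c (i - n) :=
    ⟨⟨2 * n, fun i => h * c (i - n), fun i k _ => by
      rw [wordDist_mul_left]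
      have := hc (i - n) ((i + k : ℕ) - n)
      push_cast at this
      rw [show (i : ℤ) - n - (i + k - n) = -k by ring, abs_neg, Nat.abs_cast] at this
      exact_mod_cast this⟩, rfl, fun i => rfl⟩
  obtain ⟨hlen, hpts⟩ := hτ
  obtain ⟨p, hp⟩ := exists_isNearest (S := S) (Set.range_nonempty c) τ.first
  obtain ⟨q, hq⟩ := exists_isNearest (S := S) (Set.range_nonempty c) τ.last
  obtain ⟨o, ho⟩ := exists_isNearest (S := S) (Set.range_nonempty c) (τ.pts n)
  obtain ⟨i₁, hi₁⟩ := hT ((0 : ℕ) - n)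
  obtain ⟨i₂, hi₂⟩ := hT ((2 * n : ℕ) - n)
  have hp' : (wordDist S τ.first p : ℝ) ≤ T := by
    refine (hp.le ⟨i₁, rfl⟩).trans ?_
    rwa [GeodSeg.first, hpts]
  have hq' : (wordDist S τ.last q : ℝ) ≤ T := by
    refine (hq.le ⟨i₂, rfl⟩).trans ?_
    rwa [GeodSeg.last, hpts, hlen]
  have hlen' : (τ.len : ℝ) = 2 * n := by exact_mod_cast hlen
  have d1 : (τ.len : ℝ) = wordDist S τ.first τ.last := by exact_mod_cast τ.len_eq
  have d2 := wordDist_triangle hS τ.first p τ.last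
  have d3 := wordDist_triangle hS p q τ.last
  rw [wordDist_comm hS q] at d3
  obtain ⟨i, j, hij, hj, hi1, hj1⟩ := hΓ.exists_near hS hD τ hp hq (by linarith)
  have d4 := wordDist_triangle hS τ.first p (τ.pts i)
  rw [wordDist_comm hS p] at d4
  have d5 := wordDist_triangle hS (τ.pts j) q τ.last
  rw [wordDist_comm hS q] at d5
  have d6 := τ.dist_pts (Nat.zero_le i) (hij.trans hj)
  have d7 := τ.dist_pts hj le_rfl
  change (wordDist S τ.first (τ.pts i) : ℝ) = _ at d6
  change (wordDist S (τ.pts j) τ.last : ℝ) = _ at d7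
  push_cast at d6
  have hin : i ≤ n := by
    have : (i : ℝ) ≤ n := by linarith
    exact_mod_cast this
  have hnj : n ≤ j := by
    have : (n : ℝ) ≤ j := by linarith
    exact_mod_cast this
  have hfin := hΓ.dist_le_of_endpoints hS hD (τ.sub i j) (A := 2 * D + 1) (k := n - i) (p := o)
    hp.1 hq.1 (by rwa [GeodSeg.sub_first]) (by rwa [GeodSeg.sub_last _ hij hj])
    (by rw [GeodSeg.sub_len _ hj]; omega)
    (by rw [GeodSeg.sub_pts]; rwa [show i + (n - i) = n by omega])
  rw [GeodSeg.sub_pts, show i + (n - i) = n by omega, hpts, sub_self] at hfin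
  obtain ⟨s, rfl⟩ := ho.1
  obtain ⟨e, he⟩ := hR s
  refine ⟨e, ?_⟩
  change (wordDist S (g ^ e) h : ℝ) ≤ _
  have he' : (wordDist S (c s) (g ^ e) : ℝ) ≤ R := by exact_mod_cast he
  have g1 := wordDist_triangle hS (g ^ e) (c s) h
  have g2 := wordDist_triangle hS (c s) (h * c 0) h
  have g3 : wordDist S (h * c 0) h = wordNorm S (c 0) := by
    rw [wordDist_comm hS, wordDist, inv_mul_cancel_left]
  rw [wordDist_comm hS (g ^ e) (c s)] at g1
  rw [wordDist_comm hS (c s) (h * c 0), g3] at g2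
  linarith

open scoped Pointwise in
-- Taking inverses yields a cover of `G` by finitely many left cosets of `⟨g⟩` and of `⟨h₀ g h₀⁻¹⟩`.
-- By B. H. Neumann's lemma one of these cyclic subgroups has finite index.
theorem isVirtuallyCyclic_of_cover {g h₀ : G} {B : Set G} (hB : B.Finite)
    (hcov : ∀ h : G, (∃ e : ℤ, (g ^ e)⁻¹ * h ∈ B) ∨ ∃ e : ℤ, (g ^ e)⁻¹ * (h₀⁻¹ * h) ∈ B) :
    IsVirtuallyCyclic G := by
  have hcover : ⋃ i ∈ (Finset.univ : Finset Bool) ×ˢ hB.toFinset,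
      (bif i.1 then i.2⁻¹ * h₀⁻¹ else i.2⁻¹) •
        ((bif i.1 then Subgroup.zpowers (h₀ * g * h₀⁻¹) else Subgroup.zpowers g : Subgroup G) :
          Set G) = Set.univ := by
    refine Set.eq_univ_of_forall fun h => ?_
    rcases hcov h⁻¹ with ⟨e, he⟩ | ⟨e, he⟩
    · refine Set.mem_biUnion (x := (false, (g ^ e)⁻¹ * h⁻¹)) (by simpa using he) ?_
      exact ⟨(g ^ e)⁻¹, (Subgroup.zpowers g).inv_mem ⟨e, rfl⟩, by simp⟩
    · refine Set.mem_biUnion (x := (true, (g ^ e)⁻¹ * (h₀⁻¹ * h⁻¹))) (by simpa using he) ?_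
      refine ⟨((h₀ * g * h₀⁻¹) ^ e)⁻¹, (Subgroup.zpowers _).inv_mem ⟨e, rfl⟩, ?_⟩
      simp only [conj_zpow, cond_true, smul_eq_mul]
      group
  obtain ⟨i, -, hi⟩ := Subgroup.exists_finiteIndex_of_leftCoset_cover hcover
  refine ⟨_, ?_, hi⟩
  cases i.1 <;> simp only [cond_true, cond_false] <;> infer_instance

end Elements

/-! ### Existence of admissible choices. -/

section Existence

variable {G : Type*} [Group G] {S : Finset G}

/-- In a group that is not virtually cyclic, some contracting element has three translates of its
axis with uniformly bounded projections to each other. -/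
theorem exists_translates (hS : Subgroup.closure (S : Set G) = ⊤) (hG : ¬ IsVirtuallyCyclic G)
    {g : G} {D : ℝ} (hD : 0 ≤ D) {γ : Set G} (hγ : IsAxis S g γ) (hΓ : IsContracting S D γ) :
    ∃ (t : Fin 3 → G) (K : ℝ), 0 < K ∧ ∀ i j, i ≠ j →
      DiamLT S (proj S ((t i * ·) '' γ) ((t j * ·) '' γ)) K := by
  have hord := hγ.not_isOfFinOrder hS
  obtain ⟨⟨c, hc, rfl⟩, R, h1, h2⟩ := hγ
  have hR : ∀ i : ℤ, ∃ e : ℤ, wordDist S (c i) (g ^ e) ≤ R := fun i => h1 _ ⟨i, rfl⟩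
  have hR' : ∀ e : ℤ, ∃ i : ℤ, wordDist S (c i) (g ^ e) ≤ R := fun e => by
    obtain ⟨_, ⟨i, rfl⟩, hi⟩ := h2 e
    exact ⟨i, hi⟩
  obtain ⟨K, hK, hproj⟩ := exists_zpow_conj_of_proj hS hc hD hΓ hR
  obtain ⟨W, hW⟩ := exists_near_zpow_of_conj hS hc hD hΓ hR hR'
  have hne : ∀ n : ℤ, g ^ n = 1 → n = 0 := fun n hn => by
    by_contra h0
    exact hord (isOfFinOrder_iff_zpow_eq_one.2 ⟨n, h0, hn⟩)
  -- `Q` says that `h` commensurates `⟨g⟩`. Requiring both exponents to be nonzero makes it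
  -- invariant under inversion.
  let Q : G → Prop := fun h => ∃ k m : ℤ, k ≠ 0 ∧ m ≠ 0 ∧ h * g ^ k * h⁻¹ = g ^ m
  have hQinv : ∀ h, Q h⁻¹ → Q h := by
    rintro h ⟨k, m, hk, hm, hkm⟩
    refine ⟨m, k, hm, hk, ?_⟩
    rw [← hkm]
    group
  have hQW : ∀ h, Q h → ∃ e : ℤ, (g ^ e)⁻¹ * h ∈ ball S W := by
    rintro h ⟨k, m, hk, hm, hkm⟩
    exact hW h ⟨k, m, hk, hkm⟩
  have hQproj : ∀ h, ¬ Q h → DiamLT S (proj S (Set.range c) ((h * ·) '' Set.range c)) K := by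
    intro h hh
    by_contra hcon
    obtain ⟨k, m, hm, hkm⟩ := hproj h hcon
    refine hh ⟨k, m, fun hk => hm (hne m ?_), hm, hkm⟩
    rw [← hkm, hk]
    simp
  -- Otherwise either all elements satisfy `Q`, or for one fixed `u` outside `Q` every `h` has `Q h`
  -- or `Q (u⁻¹ * h)`. Both cases give a finite coset cover as in `isVirtuallyCyclic_of_cover`.
  have hex : ∃ u v : G, ¬ Q u ∧ ¬ Q v ∧ ¬ Q (u⁻¹ * v) := by
    by_contra hcon
    push Not at hcon
    refine hG ?_
    by_cases hall : ∀ h, Q h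
    · exact isVirtuallyCyclic_of_cover (g := g) (h₀ := 1) (finite_ball hS W)
        fun h => Or.inl (hQW h (hall h))
    · push Not at hall
      obtain ⟨u, hu⟩ := hall
      refine isVirtuallyCyclic_of_cover (g := g) (h₀ := u) (finite_ball hS W) fun h => ?_
      by_cases hh : Q h
      · exact Or.inl (hQW h hh)
      · exact Or.inr (hQW _ (hcon u h hu hh))
  obtain ⟨u, v, hu, hv, huv⟩ := hex
  refine ⟨![1, u, v], K, hK, fun i j hij => ?_⟩
  have key : ∀ x y : G, ¬ Q (x⁻¹ * y) →
      DiamLT S (proj S ((x * ·) '' Set.range c) ((y * ·) '' Set.range c)) K := by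
    intro x y hxy
    have := (hQproj _ hxy).proj_translate x
    rw [Set.image_image (x * ·)] at this
    simpa only [mul_assoc, mul_inv_cancel_left] using this
  refine key _ _ ?_
  have hsymm : ∀ x y : G, ¬ Q (x⁻¹ * y) → ¬ Q (y⁻¹ * x) := fun x y h h' =>
    h (hQinv _ (by simpa using h'))
  have hu' : ¬ Q ((1 : G)⁻¹ * u) := by simpa using hu
  have hv' : ¬ Q ((1 : G)⁻¹ * v) := by simpa using hv
  fin_cases i <;> fin_cases j
  · exact absurd rfl hij
  · exact hu'
  · exact hv'
  · exact hsymm _ _ hu'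
  · exact absurd rfl hij
  · exact huv
  · exact hsymm _ _ hv'
  · exact hsymm _ _ huv
  · exact absurd rfl hij

/-- Projections of powers of an element with axis `c'` to powers of an element with axis `c`, when
the axis `c'` has bounded projection to `c`. -/
theorem norm_proj_power_le (hS : Subgroup.closure (S : Set G) = ⊤) {c c' : ℤ → G}
    (hc : ∀ i j, (wordDist S (c i) (c j) : ℤ) = |i - j|) {D A K : ℝ} (hD : 0 ≤ D)
    (hΓ : IsContracting S D (Set.range c)) (hΓ' : IsContracting S D (Set.range c'))
    (hK : DiamLT S (proj S (Set.range c) (Set.range c')) K) (κ κ' : GeodSeg S) {a b a' b' : ℤ}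
    (h1 : κ.first = 1) (h1' : κ'.first = 1)
    (ha : (wordDist S κ.first (c a) : ℝ) ≤ A) (hb : (wordDist S κ.last (c b) : ℝ) ≤ A)
    (ha' : (wordDist S κ'.first (c' a') : ℝ) ≤ A) (hb' : (wordDist S κ'.last (c' b') : ℝ) ≤ A)
    {q : G} (hq : q ∈ proj S κ.carrier κ'.carrier) :
    (wordNorm S q : ℝ) ≤ 34 * A + 76 * D + 34 + K := by
  obtain ⟨x, hx, hq⟩ := mem_proj.1 hq
  obtain ⟨k, hk, rfl⟩ := hx
  obtain ⟨p, hp⟩ := exists_isNearest (S := S) (Set.range_nonempty c) (κ'.pts k)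
  obtain ⟨x', hx'⟩ := exists_isNearest (S := S) (Set.range_nonempty c') (κ'.pts k)
  obtain ⟨p', hp'⟩ := exists_isNearest (S := S) (Set.range_nonempty c) x'
  obtain ⟨o, ho⟩ := exists_isNearest (S := S) (Set.range_nonempty c) (c' a')
  have e1 := dist_proj_segment_le' hS hc hD hΓ κ ha hb hp hq
  have e2 := hΓ'.dist_le_of_endpoints hS hD κ' ⟨a', rfl⟩ ⟨b', rfl⟩ ha' hb' hk hx'
  have e3 := hΓ.dist_le hS hD hp hp'
  have e4 := hK o (mem_proj.2 ⟨_, ⟨a', rfl⟩, ho⟩) p' (mem_proj.2 ⟨_, hx'.1, hp'⟩)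
  have e5 := ho.le ⟨a, rfl⟩
  rw [h1] at ha
  rw [h1'] at ha'
  have f1 := wordDist_triangle hS (c' a') 1 (c a)
  have f2 := wordDist_triangle hS (c a) (c' a') o
  have f3 := wordDist_triangle hS (c a) o p
  have f4 := wordDist_triangle hS o p' p
  have f5 := wordDist_triangle hS 1 (c a) q
  rw [wordDist_comm hS (c' a') 1] at f1
  rw [wordDist_comm hS (c a) (c' a')] at f2
  rw [wordDist_comm hS p' p] at f4
  rw [wordDist_comm hS (c a) q, wordDist_one q] at f5
  linarith

theorem nonempty_contractingTriple (hS : Subgroup.closure (S : Set G) = ⊤)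
    (hG : ¬ IsVirtuallyCyclic G) (hc : ∃ (g : G) (K : ℝ), IsContractingElement S K g) :
    Nonempty (ContractingTriple S) := by
  obtain ⟨g, D₀, hD₀, γ, hγ, hΓ⟩ := hc
  obtain ⟨t, K, hK, hproj⟩ := exists_translates hS hG hD₀.le hγ hΓ
  have haxis : ∀ i, IsAxis S (t i * g * (t i)⁻¹) ((t i * ·) '' γ) := fun i => hγ.conj hS (t i)
  have hcontr : ∀ i, IsContracting S D₀ ((t i * ·) '' γ) := fun i => hΓ.translate (t i)
  have hord := fun i => (haxis i).not_isOfFinOrder hS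
  obtain ⟨a, ha⟩ : ∃ a : Fin 3 → G, ∀ i, a i = t i * g * (t i)⁻¹ := ⟨_, fun _ => rfl⟩
  simp only [← ha] at haxis hord
  have hdata : ∀ i, ∃ (c : ℤ → G) (R : ℕ), (∀ k l, (wordDist S (c k) (c l) : ℤ) = |k - l|) ∧
      (t i * ·) '' γ = Set.range c ∧ ∀ n : ℤ, ∃ k : ℤ, wordDist S (a i ^ n) (c k) ≤ R := by
    intro i
    obtain ⟨⟨c, hc, he⟩, R, -, h2⟩ := haxis i
    refine ⟨c, R, hc, he, fun n => ?_⟩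
    obtain ⟨p, hp, hn⟩ := h2 n
    rw [he] at hp
    obtain ⟨k, rfl⟩ := hp
    exact ⟨k, by rwa [wordDist_comm hS]⟩
  choose c R hc he hR using hdata
  have hproj' : ∀ i j, i ≠ j → DiamLT S (proj S (Set.range (c i)) (Set.range (c j))) K := by
    intro i j hij
    have := hproj i j hij
    rwa [he i, he j] at this
  have hcontr' : ∀ i, IsContracting S D₀ (Set.range (c i)) := fun i => he i ▸ hcontr i
  obtain ⟨A, hA⟩ : ∃ A : ℝ, A = ∑ i, (R i : ℝ) := ⟨_, rfl⟩
  have hRA : ∀ i, (R i : ℝ) ≤ A := fun i => by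
    rw [hA]
    exact Finset.single_le_sum (f := fun i => (R i : ℝ)) (fun _ _ => Nat.cast_nonneg _)
      (Finset.mem_univ i)
  have hA0 : 0 ≤ A := le_trans (Nat.cast_nonneg _) (hRA 0)
  have hnear : ∀ i (n : ℤ), ∃ k : ℤ, (wordDist S (a i ^ n) (c i k) : ℝ) ≤ A := fun i n => by
    obtain ⟨k, hk⟩ := hR i n
    exact ⟨k, le_trans (by exact_mod_cast hk) (hRA i)⟩
  have hnear1 : ∀ i, ∃ k : ℤ, (wordDist S 1 (c i k) : ℝ) ≤ A := fun i => by
    simpa using hnear i 0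
  obtain ⟨N, hN⟩ : ∃ N : ℝ, N = ∑ i, (wordNorm S (a i) : ℝ) := ⟨_, rfl⟩
  have hNa : ∀ i, (wordNorm S (a i) : ℝ) ≤ N := fun i => by
    rw [hN]
    exact Finset.single_le_sum (f := fun i => (wordNorm S (a i) : ℝ))
      (fun _ _ => Nat.cast_nonneg _) (Finset.mem_univ i)
  have hN0 : 0 ≤ N := le_trans (Nat.cast_nonneg _) (hNa 0)
  -- One `D` dominates the contraction constant of segments, the bound for mutual projections and
  -- the norms of the three elements.
  obtain ⟨D, hDdef⟩ : ∃ D : ℝ, D = 54 * A + 113 * D₀ + 60 + K + N := ⟨_, rfl⟩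
  have hD : 0 < D := by linarith
  obtain ⟨D₁, hD₁⟩ := exists_isPairConst hS (D := 45 * D) (by linarith)
  have hD₁0 : 0 < D₁ := by linarith [hD₁.1]
  obtain ⟨D₂, l₁, hD₂⟩ := exists_isConcatConst hS hD₁0
  have hD₂0 : 0 < D₂ := hD₁0.trans (hD₂ l₁ le_rfl).1
  obtain ⟨E₁, l₂, hL₁⟩ := exists_isConcatConst hS hD₂0
  have hD₃ := isConcatConverseConst hS hD₂0
  -- Here `D₃ = 12 * D₂`, so `12 * D₃` is `12 * (12 * D₂)`.
  obtain ⟨D₄, hD₄⟩ := exists_isHereditaryConst hS (D := 12 * (12 * D₂)) (by linarith)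
  have hD₄0 : 0 < D₄ := by linarith [hD₄.1]
  obtain ⟨E₂, l₃, hL₂⟩ := exists_isConcatConst hS hD₄0
  have hLpos : 0 < max l₁ l₂ + l₃ := by
    have h1 := (hD₂ (max l₁ l₂) (le_max_left _ _)).2.1
    have h2 := (hL₂ l₃ le_rfl).2.1
    linarith
  choose p hp hp' using fun i => exists_pow_norm hS (hord i) hLpos
  exact ⟨{
    a := a
    p := p
    D := D
    D₁ := D₁
    D₂ := D₂
    D₃ := 12 * D₂
    D₄ := D₄
    L₁ := max l₁ l₂
    L₂ := l₃
    contracting := fun i => ⟨hD, _, haxis i, (hcontr i).mono (by linarith)⟩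
    independent := fun i j hij => ⟨K, hK, _, _, haxis i, haxis j, hproj i j hij,
      hproj j i hij.symm⟩
    norm_le := fun i => (hNa i).trans (by linarith)
    power_contracting := by
      intro i n κ h1 h2
      obtain ⟨k, hk⟩ := hnear1 i
      obtain ⟨l, hl⟩ := hnear i n
      rw [← h1] at hk
      rw [← h2] at hl
      exact (isContracting_segment hS (hc i) hD₀.le (hcontr' i) κ hk hl).mono (by linarith)
    power_proj := by
      intro i j n m κ κ' hij h1 h2 h1' h2' q hq
      obtain ⟨k, hk⟩ := hnear1 i
      obtain ⟨l, hl⟩ := hnear i n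
      obtain ⟨k', hk'⟩ := hnear1 j
      obtain ⟨l', hl'⟩ := hnear j m
      rw [← h1] at hk
      rw [← h2] at hl
      rw [← h1'] at hk'
      rw [← h2'] at hl'
      have := norm_proj_power_le hS (hc i) hD₀.le (hcontr' i) (hcontr' j) (hproj' i j hij) κ κ'
        h1 h1' hk hl hk' hl' hq
      linarith
    hD₁ := hD₁
    hD₂ := hD₂ _ (le_max_left _ _)
    hL₁ := ⟨E₁, hL₁ _ (le_max_right _ _)⟩
    hD₃ := hD₃
    hD₄ := hD₄
    hL₂ := ⟨E₂, hL₂ _ le_rfl⟩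
    le_norm_h := hp
    norm_h_le := fun i => (hp' i).trans (by linarith [hNa i]) }⟩

end Existence

/-! ### Translation invariance of alignment. -/

section Translates

variable {G : Type*} [Group G] {S : Finset G}

theorem nearFirst_translate {C : ℝ} {κ : GeodSeg S} {g x : G} :
    NearFirst S C (κ.translate g) (g * x) ↔ NearFirst S C κ x := by
  simp only [NearFirst, GeodSeg.carrier_translate, GeodSeg.first_translate]
  constructor
  · intro h p hp
    have := h (g * p) (isNearest_translate.2 hp)
    rwa [wordDist_mul_left] at this
  · intro h p hp
    rw [isNearest_translate_iff, inv_mul_cancel_left] at hp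
    have := h _ hp
    rwa [← wordDist_mul_left S g, mul_inv_cancel_left] at this

theorem nearLast_translate {C : ℝ} {κ : GeodSeg S} {g x : G} :
    NearLast S C (κ.translate g) (g * x) ↔ NearLast S C κ x := by
  simp only [NearLast, GeodSeg.carrier_translate, GeodSeg.last_translate]
  constructor
  · intro h p hp
    have := h (g * p) (isNearest_translate.2 hp)
    rwa [wordDist_mul_left] at this
  · intro h p hp
    rw [isNearest_translate_iff, inv_mul_cancel_left] at hp
    have := h _ hp
    rwa [← wordDist_mul_left S g, mul_inv_cancel_left] at this

theorem PairAligned.translate {C : ℝ} {κ κ' : GeodSeg S} (h : PairAligned S C κ κ') (g : G) :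
    PairAligned S C (κ.translate g) (κ'.translate g) := by
  have key : ∀ (A Y : Set G) (o : G), DiamLT S (proj S A {o} ∪ proj S A Y) C →
      DiamLT S (proj S ((g * ·) '' A) {g * o} ∪ proj S ((g * ·) '' A) ((g * ·) '' Y)) C := by
    intro A Y o hd
    have hmem : ∀ p ∈ proj S ((g * ·) '' A) {g * o} ∪ proj S ((g * ·) '' A) ((g * ·) '' Y),
        g⁻¹ * p ∈ proj S A {o} ∪ proj S A Y := by
      rintro p (hp | hp)
      · obtain ⟨y, rfl, hp'⟩ := mem_proj.1 hp
        rw [isNearest_translate_iff, inv_mul_cancel_left] at hp'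
        exact Or.inl (mem_proj.2 ⟨o, rfl, hp'⟩)
      · obtain ⟨_, ⟨y, hy, rfl⟩, hp'⟩ := mem_proj.1 hp
        rw [isNearest_translate_iff, inv_mul_cancel_left] at hp'
        exact Or.inr (mem_proj.2 ⟨y, hy, hp'⟩)
    intro p hp q hq
    have := hd _ (hmem p hp) _ (hmem q hq)
    rwa [wordDist_mul_left] at this
  refine ⟨?_, ?_⟩
  · rw [GeodSeg.carrier_translate, GeodSeg.carrier_translate]
    exact key _ _ _ h.1
  · rw [GeodSeg.carrier_translate, GeodSeg.carrier_translate]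
    exact key _ _ _ h.2

theorem GeodSeg.translate_translate (g h : G) (κ : GeodSeg S) :
    (κ.translate h).translate g = κ.translate (g * h) := by
  simp [GeodSeg.translate, mul_assoc]

theorem GeodSeg.translate_point (g x : G) :
    (GeodSeg.point S x).translate g = GeodSeg.point S (g * x) := rfl

end Translates

/-! ### First consequences of an admissible choice; selection of indices. -/

namespace ContractingTriple

variable {G : Type*} [Group G] {S : Finset G}

/-- An element with an axis has infinite order, hence is nontrivial. The bound serves to absorb
additive constants into multiples of `D`. -/
theorem one_le_D (hS : Subgroup.closure (S : Set G) = ⊤) (T : ContractingTriple S) : 1 ≤ T.D := by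
  obtain ⟨-, γ, hγ, -⟩ := T.contracting 0
  have h1 : T.a 0 ≠ 1 := by
    intro h
    have := hγ.not_isOfFinOrder hS
    rw [h] at this
    exact this IsOfFinOrder.one
  have h2 : wordNorm S (T.a 0) ≠ 0 := fun h => h1 ((wordNorm_eq_zero hS).1 h)
  have h3 : (1 : ℝ) ≤ wordNorm S (T.a 0) := by exact_mod_cast Nat.one_le_iff_ne_zero.2 h2
  exact h3.trans (T.norm_le 0)

theorem D_lt_D₁ (T : ContractingTriple S) : 45 * T.D < T.D₁ := T.hD₁.1

theorem D₁_lt_D₂ (T : ContractingTriple S) : T.D₁ < T.D₂ := T.hD₂.1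

theorem D₂_lt_D₃ (T : ContractingTriple S) : T.D₂ < T.D₃ := T.hD₃.1

theorem D₃_lt_D₄ (T : ContractingTriple S) : 12 * T.D₃ < T.D₄ := T.hD₄.1

theorem D₄_lt_L₂ (T : ContractingTriple S) : T.D₄ < T.L₂ := by
  obtain ⟨E, hE⟩ := T.hL₂
  exact hE.2.1

theorem D₂_lt_L₁ (T : ContractingTriple S) : T.D₂ < T.L₁ := by
  obtain ⟨E, hE⟩ := T.hL₁
  exact hE.2.1

/-- `σ i` is a geodesic from `e` to `h i`, for all `i`. -/
def IsChoice (T : ContractingTriple S) (σ : Fin 3 → GeodSeg S) : Prop :=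
  ∀ i, (σ i).first = 1 ∧ (σ i).last = T.h i

theorem exists_isChoice (hS : Subgroup.closure (S : Set G) = ⊤) (T : ContractingTriple S) :
    ∃ σ, T.IsChoice σ := by
  choose σ h1 h2 using fun i => exists_geodSeg hS 1 (T.h i)
  exact ⟨σ, fun i => ⟨h1 i, h2 i⟩⟩

theorem IsChoice.contracting {T : ContractingTriple S} {σ : Fin 3 → GeodSeg S} (hσ : T.IsChoice σ)
    (i : Fin 3) (g : G) : IsContracting S T.D ((σ i).translate g).carrier := by
  rw [GeodSeg.carrier_translate]
  exact (T.power_contracting i (T.p i) (σ i) (hσ i).1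
    (by rw [(hσ i).2, zpow_natCast]; rfl)).translate g

theorem IsChoice.lt_len {T : ContractingTriple S} (hD : 1 ≤ T.D) {σ : Fin 3 → GeodSeg S}
    (hσ : T.IsChoice σ) (i : Fin 3) (g : G) : T.L₁ < ((σ i).translate g).len := by
  rw [GeodSeg.len_translate, GeodSeg.len_eq, (hσ i).1, (hσ i).2, wordDist_one]
  have h1 := T.le_norm_h i
  have h2 := T.D₄_lt_L₂
  have h3 := T.D₃_lt_D₄
  have h4 := T.D₂_lt_D₃
  have h5 := T.D₁_lt_D₂
  have h6 := T.D_lt_D₁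
  rw [h]
  linarith

/-- The projection of `x` is close to `e` for one of two geodesics `[e, a_i ^ n]`,
`[e, a_j ^ m]`, `i ≠ j`. -/
theorem nearFirst_or (hS : Subgroup.closure (S : Set G) = ⊤) (T : ContractingTriple S)
    {i j : Fin 3} (hij : i ≠ j) {n m : ℤ} {κ κ' : GeodSeg S} (h1 : κ.first = 1)
    (h2 : κ.last = T.a i ^ n) (h1' : κ'.first = 1) (h2' : κ'.last = T.a j ^ m) (x : G) :
    NearFirst S (8 * T.D + 1) κ x ∨ NearFirst S (8 * T.D + 1) κ' x := by
  have hD := T.one_le_D hS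
  by_contra hcon
  simp only [NearFirst, not_or, not_forall, not_lt, h1, h1', wordDist_one] at hcon
  obtain ⟨⟨p, hp, hp'⟩, q, hq, hq'⟩ := hcon
  -- If both projections `p`, `q` of `x` are far from `e`, a geodesic from `q` to `x` passes near
  -- the projection `o` of `q` to `κ`, and `o` is near `e`. At that vertex `q` is still the nearest
  -- point of `κ'`, although `e` is on `κ'` and close: so `q` is close to `e` after all.
  obtain ⟨σ, rfl, rfl⟩ := exists_geodSeg hS q x
  have hκ := T.power_contracting i n κ h1 h2
  obtain ⟨o, ho⟩ := exists_isNearest (S := S) κ.carrier_nonempty σ.first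
  have ho' := T.power_proj i j n m κ κ' hij h1 h2 h1' h2' o (mem_proj.2 ⟨_, hq.1, ho⟩)
  have e1 := wordNorm_le_add_wordDist hS o p
  obtain ⟨k, l, hkl, hl, hk, -⟩ := hκ.exists_near hS (by linarith) σ ho hp (by linarith)
  have hk' : k ≤ σ.len := hkl.trans hl
  have hq2 : IsNearest S κ'.carrier (σ.pts k) σ.first := hq.of_between hS (by
    have g1 := σ.dist_pts (Nat.zero_le k) hk'
    have g2 := σ.dist_pts hk' le_rfl
    have g3 := σ.dist_pts (Nat.zero_le σ.len) le_rfl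
    rw [GeodSeg.first, GeodSeg.last, g1, g2, g3]
    ring)
  have e2 := hq2.le (h1' ▸ κ'.first_mem)
  have e3 := wordNorm_le_add_wordDist hS o (σ.pts k)
  have e4 := wordNorm_le_add_wordDist hS (σ.pts k) σ.first
  rw [wordDist_comm hS (σ.pts k) 1, wordDist_one] at e2
  rw [wordDist_comm hS o] at e3
  linarith

/-- Reversing `[e, h i]` and translating by `(h i)⁻¹` exchanges its ends and yields a geodesic from
`e` to a negative power, to which the previous alternative applies. -/
theorem nearLast_or (hS : Subgroup.closure (S : Set G) = ⊤) (T : ContractingTriple S)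
    {i j : Fin 3} (hij : i ≠ j) {κ κ' : GeodSeg S} (h1 : κ.first = 1)
    (h2 : κ.last = T.h i) (h1' : κ'.first = 1) (h2' : κ'.last = T.h j) (x : G) :
    NearLast S (8 * T.D + 1) κ (T.h i * x) ∨ NearLast S (8 * T.D + 1) κ' (T.h j * x) := by
  have key := T.nearFirst_or hS hij (n := -(T.p i)) (m := -(T.p j))
    (κ := (κ.rev hS).translate (T.h i)⁻¹) (κ' := (κ'.rev hS).translate (T.h j)⁻¹)
    (by rw [GeodSeg.first_translate, GeodSeg.first_rev, h2, inv_mul_cancel])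
    (by rw [GeodSeg.last_translate, GeodSeg.last_rev, h1, zpow_neg, zpow_natCast, mul_one]; rfl)
    (by rw [GeodSeg.first_translate, GeodSeg.first_rev, h2', inv_mul_cancel])
    (by rw [GeodSeg.last_translate, GeodSeg.last_rev, h1', zpow_neg, zpow_natCast, mul_one]; rfl) x
  refine key.imp (fun h => ?_) (fun h => ?_)
  · rw [← inv_mul_cancel_left (T.h i) x, nearFirst_translate, nearFirst_rev] at h
    exact h
  · rw [← inv_mul_cancel_left (T.h j) x, nearFirst_translate, nearFirst_rev] at h
    exact h

/-- One of the three elements `h i` is good for prescribed predecessor `x` and successor `y`. -/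
theorem exists_good_index (hS : Subgroup.closure (S : Set G) = ⊤) (T : ContractingTriple S)
    (x y : G) : ∃ i : Fin 3, ∀ κ : GeodSeg S, κ.first = 1 → κ.last = T.h i →
      NearFirst S (8 * T.D + 1) κ x ∧ NearLast S (8 * T.D + 1) κ (T.h i * y) := by
  have hA : ∀ i j : Fin 3, i ≠ j →
      (∀ κ : GeodSeg S, κ.first = 1 → κ.last = T.h i → NearFirst S (8 * T.D + 1) κ x) ∨
      (∀ κ : GeodSeg S, κ.first = 1 → κ.last = T.h j → NearFirst S (8 * T.D + 1) κ x) := by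
    intro i j hij
    by_contra hcon
    simp only [not_or, not_forall] at hcon
    obtain ⟨⟨κ, h1, h2, h3⟩, κ', h1', h2', h3'⟩ := hcon
    rcases T.nearFirst_or hS hij (n := T.p i) (m := T.p j) h1 (by rw [h2, zpow_natCast]; rfl)
      h1' (by rw [h2', zpow_natCast]; rfl) x with h | h
    exacts [h3 h, h3' h]
  have hB : ∀ i j : Fin 3, i ≠ j →
      (∀ κ : GeodSeg S, κ.first = 1 → κ.last = T.h i →
        NearLast S (8 * T.D + 1) κ (T.h i * y)) ∨
      (∀ κ : GeodSeg S, κ.first = 1 → κ.last = T.h j →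
        NearLast S (8 * T.D + 1) κ (T.h j * y)) := by
    intro i j hij
    by_contra hcon
    simp only [not_or, not_forall] at hcon
    obtain ⟨⟨κ, h1, h2, h3⟩, κ', h1', h2', h3'⟩ := hcon
    rcases T.nearLast_or hS hij h1 h2 h1' h2' y with h | h
    exacts [h3 h, h3' h]
  -- Each of the two requirements fails for at most one index, so one of the three indices meets
  -- both.
  have pick : ∀ P Q : Fin 3 → Prop, (∀ i j, i ≠ j → P i ∨ P j) → (∀ i j, i ≠ j → Q i ∨ Q j) →
      ∃ i, P i ∧ Q i := by
    intro P Q hP hQ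
    have := hP 0 1 (by decide)
    have := hP 0 2 (by decide)
    have := hP 1 2 (by decide)
    have := hQ 0 1 (by decide)
    have := hQ 0 2 (by decide)
    have := hQ 1 2 (by decide)
    by_contra hcon
    push Not at hcon
    have h0 := hcon 0
    have h1 := hcon 1
    have h2 := hcon 2
    tauto
  obtain ⟨i, hi1, hi2⟩ := pick _ _ hA hB
  exact ⟨i, fun κ h1 h2 => ⟨hi1 κ h1 h2, hi2 κ h1 h2⟩⟩

end ContractingTriple

/-- A letter records one replacement: the number of the block, the word `gap` kept before it, the
indices of the two inserted elements `h i`, `h j`, and the word removed. -/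
@[ext]
structure Letter (G : Type*) where
  block : ℕ
  gap : G
  i : Fin 3
  j : Fin 3
  word : G

/-! ### Replacing words along a geodesic, and the codes that record it. -/

namespace ContractingTriple

variable {G : Type*} [Group G] {S : Finset G}

/-- The element inserted for a letter, together with the gap before it. -/
def repl (T : ContractingTriple S) (f : G) (x : Letter G) : G :=
  x.gap * T.h x.i * f * T.h x.j

/-- The product of the inserted elements and gaps. -/
def replProd (T : ContractingTriple S) (f : G) (l : List (Letter G)) : G :=
  (l.map (T.repl f)).prod

theorem replProd_cons (T : ContractingTriple S) (f : G) (x : Letter G) (l : List (Letter G)) :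
    T.replProd f (x :: l) = T.repl f x * T.replProd f l := by simp [replProd]

/-- The segments `[e, h i]`, `[e, h j]` inserted for the letters, starting from the point `z`. -/
def segs (T : ContractingTriple S) (f : G) (σ σ' : Fin 3 → GeodSeg S) :
    G → List (Letter G) → List (GeodSeg S)
  | _, [] => []
  | z, x :: l => (σ x.i).translate (z * x.gap) ::
      (σ' x.j).translate (z * x.gap * T.h x.i * f) :: segs T f σ σ' (z * T.repl f x) l

theorem segs_append (T : ContractingTriple S) (f : G) (σ σ' : Fin 3 → GeodSeg S) (z : G)
    (p l : List (Letter G)) :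
    T.segs f σ σ' z (p ++ l) = T.segs f σ σ' z p ++ T.segs f σ σ' (z * T.replProd f p) l := by
  induction p generalizing z with
  | nil => simp [segs, replProd]
  | cons x p ih => simp [segs, ih, replProd_cons, mul_assoc]

/-- The blocks `[α j, β j]`, `j < m`, of positions on a geodesic of length `n` at which words are
replaced. -/
structure IsBlocks (T : ContractingTriple S) (f : G) (I : Set ℕ) (n m : ℕ) (M : ℝ)
    (α β : ℕ → ℕ) : Prop where
  le_n : ∀ j < m, β j ≤ n
  lower : ∀ j < m, 2 * (T.L + T.D) + wordNorm S f ≤ (β j : ℝ) - α j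
  upper : ∀ j < m, (β j : ℝ) - α j ≤ M
  le_of_lt : ∀ j k, j < k → k < m → β j ≤ α k
  spaced : ∀ j k, j < k → k < m →
    6 * T.D₂ + 2 * (T.L + T.D) + wordNorm S f ≤ (α k : ℝ) - α j
  mem : ∀ j < m, ∀ t : ℕ, (α j : ℝ) - 6 * T.D₂ ≤ t → t ≤ α j → t ∈ I

/-- The position on the geodesic after the last replaced word. -/
def endPos {G : Type*} (β : ℕ → ℕ) : ℕ → List (Letter G) → ℕ
  | b, [] => b
  | _, x :: l => endPos β (β x.block) l

/-- The letters record replacements in the word read along `τ` from position `b` on. -/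
def IsCode (τ : GeodSeg S) (m : ℕ) (α β : ℕ → ℕ) : ℕ → List (Letter G) → Prop
  | _, [] => True
  | b, x :: l => x.block < m ∧ b ≤ α x.block ∧
      x.gap = (τ.pts b)⁻¹ * τ.pts (α x.block) ∧
      x.word = (τ.pts (α x.block))⁻¹ * τ.pts (β x.block) ∧ IsCode τ m α β (β x.block) l

theorem IsCode.of_append {τ : GeodSeg S} {m : ℕ} {α β : ℕ → ℕ} {b : ℕ} {p l : List (Letter G)}
    (h : IsCode τ m α β b (p ++ l)) :
    IsCode τ m α β b p ∧ IsCode τ m α β (endPos β b p) l := by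
  induction p generalizing b with
  | nil => exact ⟨trivial, h⟩
  | cons x p ih =>
    obtain ⟨h1, h2, h3, h4, h5⟩ := h
    exact ⟨⟨h1, h2, h3, h4, (ih h5).1⟩, (ih h5).2⟩

theorem IsCode.pts_endPos {τ : GeodSeg S} {m : ℕ} {α β : ℕ → ℕ} {b : ℕ} {l : List (Letter G)}
    (h : IsCode τ m α β b l) :
    τ.pts (endPos β b l) = τ.pts b * (l.map fun x => x.gap * x.word).prod := by
  induction l generalizing b with
  | nil => simp [endPos]
  | cons x l ih =>
    obtain ⟨h1, h2, h3, h4, h5⟩ := h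
    rw [endPos, ih h5, List.map_cons, List.prod_cons, h3, h4]
    group

theorem IsCode.endPos_le {T : ContractingTriple S} {f : G} {I : Set ℕ} {n m : ℕ} {M : ℝ}
    {α β : ℕ → ℕ} (hb : T.IsBlocks f I n m M α β) {τ : GeodSeg S} {b : ℕ} (hbn : b ≤ n)
    {l : List (Letter G)} (h : IsCode τ m α β b l) : endPos β b l ≤ n := by
  induction l generalizing b with
  | nil => exact hbn
  | cons x l ih => exact ih (hb.le_n _ h.1) h.2.2.2.2

theorem IsBlocks.le {T : ContractingTriple S} {f : G} {I : Set ℕ} {n m : ℕ} {M : ℝ}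
    {α β : ℕ → ℕ} (hb : T.IsBlocks f I n m M α β) (hD : 0 ≤ T.D) {j : ℕ} (hj : j < m) :
    α j ≤ β j := by
  have h1 := hb.lower j hj
  have h2 : 0 ≤ T.L := by
    have h3 := T.D₂_lt_L₁
    have h4 := T.D₄_lt_L₂
    have h5 := T.D₃_lt_D₄
    have h6 := T.D₂_lt_D₃
    have h7 := T.D₁_lt_D₂
    have h8 := T.D_lt_D₁
    rw [L]
    linarith
  have h3 : (0 : ℝ) ≤ wordNorm S f := Nat.cast_nonneg _
  have : (α j : ℝ) ≤ β j := by linarith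
  exact_mod_cast this

/-- The element obtained from the endpoint of `τ` by the replacements. -/
def encode (T : ContractingTriple S) (f : G) (τ : GeodSeg S) (β : ℕ → ℕ) (b : ℕ)
    (l : List (Letter G)) : G :=
  T.replProd f l * (τ.pts (endPos β b l))⁻¹ * τ.last

theorem norm_repl_le (hS : Subgroup.closure (S : Set G) = ⊤) (T : ContractingTriple S) (f : G)
    (x : Letter G) :
    (wordNorm S (T.repl f x) : ℝ) ≤
      wordNorm S x.gap + (2 * (T.L + T.D) + wordNorm S f) := by
  have h1 := wordNorm_mul_le hS (x.gap * T.h x.i * f) (T.h x.j)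
  have h2 := wordNorm_mul_le hS (x.gap * T.h x.i) f
  have h3 := wordNorm_mul_le hS x.gap (T.h x.i)
  have h4 := T.norm_h_le x.i
  have h5 := T.norm_h_le x.j
  have h6 : (wordNorm S (T.repl f x) : ℝ) ≤ wordNorm S x.gap + wordNorm S (T.h x.i) +
      wordNorm S f + wordNorm S (T.h x.j) := by
    rw [repl]
    exact_mod_cast (by omega)
  rw [← h] at h4 h5
  rw [L]
  linarith

theorem IsCode.norm_gap {τ : GeodSeg S} {b c : ℕ} (hbc : b ≤ c) (hc : c ≤ τ.len) :
    (wordNorm S ((τ.pts b)⁻¹ * τ.pts c) : ℝ) = c - b := τ.dist_pts hbc hc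

/-- By `IsBlocks.lower`, a removed word is at least as long as the bound `2 * (T.L + T.D) + wordNorm
S f` for the norm of what is inserted. -/
theorem IsCode.norm_encode_le (hS : Subgroup.closure (S : Set G) = ⊤) {T : ContractingTriple S}
    (hD : 0 ≤ T.D)
    {f : G} {I : Set ℕ} {m : ℕ} {M : ℝ} {α β : ℕ → ℕ} {τ : GeodSeg S}
    (hb : T.IsBlocks f I τ.len m M α β) {b : ℕ} (hbn : b ≤ τ.len) {l : List (Letter G)}
    (h : IsCode τ m α β b l) : (wordNorm S (T.encode f τ β b l) : ℝ) ≤ τ.len - b := by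
  induction l generalizing b with
  | nil =>
    simp only [encode, replProd, endPos, List.map_nil, List.prod_nil, one_mul]
    exact (IsCode.norm_gap hbn le_rfl).le
  | cons x l ih =>
    obtain ⟨h1, h2, h3, h4, h5⟩ := h
    have e1 := ih (hb.le_n _ h1) h5
    have e2 := T.norm_repl_le hS f x
    have e3 := hb.lower _ h1
    have e4 := IsCode.norm_gap (τ := τ) h2 ((hb.le hD h1).trans (hb.le_n _ h1))
    rw [← h3] at e4
    have e5 : T.encode f τ β b (x :: l) = T.repl f x * T.encode f τ β (β x.block) l := by
      simp [encode, replProd_cons, endPos, mul_assoc]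
    have e6 : (wordNorm S (T.encode f τ β b (x :: l)) : ℝ) ≤
        wordNorm S (T.repl f x) + wordNorm S (T.encode f τ β (β x.block) l) := by
      rw [e5]
      exact_mod_cast wordNorm_mul_le hS _ _
    linarith

/-- Greedy choice from left to right: the first index depends on the previous inserted element `y`
and the gap before the block, the second on the first and on the gap after the block. The gaps are
known in advance, being read off `τ`. In the invariant on the head, `z * y⁻¹` is the starting point
of the previous inserted segment. -/
theorem exists_code (hS : Subgroup.closure (S : Set G) = ⊤) (T : ContractingTriple S) (f : G)
    {I : Set ℕ} {m : ℕ} {M : ℝ} {α β : ℕ → ℕ} (τ : GeodSeg S)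
    (hb : T.IsBlocks f I τ.len m M α β) (js : List ℕ) (hjs : js.Pairwise (· < ·)) (b : ℕ)
    (hb' : ∀ j ∈ js, j < m ∧ b ≤ α j) (y : G) :
    ∃ l : List (Letter G), l.map Letter.block = js ∧ IsCode τ m α β b l ∧
      ∀ σ σ', T.IsChoice σ → T.IsChoice σ' → ∀ z : G,
        Aligned S T.D₁ (T.segs f σ σ' z l ++ [GeodSeg.point S (z * T.encode f τ β b l)]) ∧
        ∀ κ ∈ (T.segs f σ σ' z l).head?,
          PairAligned S (45 * T.D) (GeodSeg.point S (z * y⁻¹)) κ := by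
  have hD := T.one_le_D hS
  have hD1 := T.D_lt_D₁
  induction js generalizing b y with
  | nil =>
    refine ⟨[], rfl, trivial, fun σ σ' _ _ z => ⟨List.isChain_singleton _, ?_⟩⟩
    simp [segs]
  | cons j js ih =>
    rw [List.pairwise_cons] at hjs
    obtain ⟨hjm, hbj⟩ := hb' j (by simp)
    obtain ⟨r, hr⟩ : ∃ r, r = (τ.pts b)⁻¹ * τ.pts (α j) := ⟨_, rfl⟩
    -- The word kept after this block; the default `τ.len` makes it the tail of `τ` when no block
    -- remains.
    obtain ⟨r', hr'⟩ : ∃ r', r' = (τ.pts (β j))⁻¹ * τ.pts ((js.head?.map α).getD τ.len) :=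
      ⟨_, rfl⟩
    obtain ⟨i₁, hi₁⟩ := T.exists_good_index hS (y * r)⁻¹ f
    obtain ⟨i₂, hi₂⟩ := T.exists_good_index hS (T.h i₁ * f)⁻¹ r'
    obtain ⟨l, hl1, hl2, hl3⟩ := ih hjs.2 (β j)
      (fun k hk => ⟨(hb' k (by simp [hk])).1, hb.le_of_lt j k (hjs.1 k hk) (hb' k (by simp [hk])).1⟩)
      (T.h i₂)
    obtain ⟨x, hx⟩ : ∃ x : Letter G, x = ⟨j, r, i₁, i₂, (τ.pts (α j))⁻¹ * τ.pts (β j)⟩ := ⟨_, rfl⟩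
    have hrepl : T.repl f x = r * T.h i₁ * f * T.h i₂ := by rw [hx]; rfl
    refine ⟨x :: l, by simp [hx, hl1], by subst hx; exact ⟨hjm, hbj, hr, rfl, hl2⟩, ?_⟩
    intro σ σ' hσ hσ' z
    obtain ⟨hal, hhead⟩ := hl3 σ σ' hσ hσ' (z * T.repl f x)
    obtain ⟨κ, hκ⟩ : ∃ κ, κ = (σ i₁).translate (z * r) := ⟨_, rfl⟩
    obtain ⟨κ', hκ'⟩ : ∃ κ', κ' = (σ' i₂).translate (z * r * T.h i₁ * f) := ⟨_, rfl⟩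
    have hsegs : T.segs f σ σ' z (x :: l) =
        κ :: κ' :: T.segs f σ σ' (z * T.repl f x) l := by rw [hκ, hκ', hx]; rfl
    have hκc : IsContracting S (45 * T.D) κ.carrier := by
      rw [hκ]; exact (hσ.contracting i₁ _).mono (by linarith)
    have hκc' : IsContracting S (45 * T.D) κ'.carrier := by
      rw [hκ']; exact (hσ'.contracting i₂ _).mono (by linarith)
    have hκf : κ.first = z * r := by rw [hκ, GeodSeg.first_translate, (hσ i₁).1, mul_one]
    have hκf' : κ'.first = z * r * T.h i₁ * f := by
      rw [hκ', GeodSeg.first_translate, (hσ' i₂).1, mul_one]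
    have henc : T.encode f τ β b (x :: l) = T.repl f x * T.encode f τ β (β j) l := by
      rw [hx]; simp [encode, replProd_cons, endPos, mul_assoc]
    obtain ⟨g1, g2⟩ := hi₁ (σ i₁) (hσ i₁).1 (hσ i₁).2
    obtain ⟨g3, g4⟩ := hi₂ (σ' i₂) (hσ' i₂).1 (hσ' i₂).2
    have a1 : PairAligned S (45 * T.D) (GeodSeg.point S (z * y⁻¹)) κ := by
      refine pairAligned_point_left hS (C := 8 * T.D + 1) (by linarith) (by linarith) ?_
      rw [hκ, show z * y⁻¹ = (z * r) * (y * r)⁻¹ by group, nearFirst_translate]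
      exact g1
    have a2 : PairAligned S (45 * T.D) κ (GeodSeg.point S κ'.first) := by
      refine pairAligned_point_right hS (C := 8 * T.D + 1) (by linarith) (by linarith) ?_
      rw [hκf', hκ, show z * r * T.h i₁ * f = (z * r) * (T.h i₁ * f) by group, nearLast_translate]
      exact g2
    have a3 : PairAligned S (45 * T.D) (GeodSeg.point S κ.first) κ' := by
      refine pairAligned_point_left hS (C := 8 * T.D + 1) (by linarith) (by linarith) ?_
      have := (nearFirst_translate (g := z * r * T.h i₁ * f)).2 g3
      rwa [show z * r * T.h i₁ * f * (T.h i₁ * f)⁻¹ = z * r by group, ← hκ', ← hκf] at this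
    have a4 : PairAligned S (45 * T.D) κ' (GeodSeg.point S (z * T.repl f x * r')) := by
      refine pairAligned_point_right hS (C := 8 * T.D + 1) (by linarith) (by linarith) ?_
      rw [hκ', hrepl, show z * (r * T.h i₁ * f * T.h i₂) * r' =
        (z * r * T.h i₁ * f) * (T.h i₂ * r') by group, nearLast_translate]
      exact g4
    -- The selection of indices only controls projections of endpoints; the pair constant upgrades
    -- this to alignment of the segments.
    have pair : ∀ κ γ : GeodSeg S, IsContracting S (45 * T.D) κ.carrier →
        IsContracting S (45 * T.D) γ.carrier →
        PairAligned S (45 * T.D) κ (GeodSeg.point S γ.first) →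
        PairAligned S (45 * T.D) (GeodSeg.point S κ.first) γ → PairAligned S T.D₁ κ γ := by
      intro κ γ h1 h2 h3 h4
      have := T.hD₁.2 κ γ h1 h2 (by simpa [Aligned] using h3) (by simpa [Aligned] using h4)
      simpa [Aligned] using this
    refine ⟨?_, ?_⟩
    · rw [hsegs, henc, ← mul_assoc z]
      refine List.isChain_cons_cons.2 ⟨pair κ κ' hκc hκc' a2 a3, ?_⟩
      refine List.isChain_cons.2 ⟨?_, hal⟩
      cases l with
      | nil =>
        have hjs0 : js = [] := by simpa using hl1.symm
        intro γ hγ₀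
        have hγ : GeodSeg.point S (z * T.repl f x * T.encode f τ β (β j) []) = γ :=
          Option.some.inj hγ₀
        rw [← hγ]
        have : T.encode f τ β (β j) ([] : List (Letter G)) = r' := by
          rw [hr', hjs0]
          simp [encode, replProd, endPos, GeodSeg.last]
        rw [this]
        exact a4.mono (by linarith)
      | cons x₂ l₂ =>
        intro γ hγ₀
        have hγ : (σ x₂.i).translate (z * T.repl f x * x₂.gap) = γ := Option.some.inj hγ₀
        have hr2 : r' = x₂.gap := by
          rw [hr', ← hl1, hl2.2.2.1]
          rfl
        have hγ1 : γ.first = z * T.repl f x * r' := by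
          rw [← hγ, GeodSeg.first_translate, (hσ _).1, mul_one, hr2]
        refine pair κ' γ hκc' ?_ (by rw [hγ1]; exact a4) ?_
        · rw [← hγ]; exact (hσ.contracting _ _).mono (by linarith)
        · have := hhead γ (by simp [segs, hγ])
          rw [hrepl, show z * (r * T.h i₁ * f * T.h i₂) * (T.h i₂)⁻¹ =
            z * r * T.h i₁ * f by group, ← hκf'] at this
          exact this
    · intro γ hγ
      rw [hsegs] at hγ
      simp only [List.head?_cons, Option.mem_def, Option.some.injEq] at hγ
      rw [← hγ]
      exact a1

end ContractingTriple

/-! ### Good codes, and the comparison of two codes with the same result. -/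

namespace ContractingTriple

variable {G : Type*} [Group G] {S : Finset G}

/-- A code along `τ` for which the inserted segments are aligned. -/
def IsGoodCode (T : ContractingTriple S) (f : G) (τ : GeodSeg S) (m : ℕ) (α β : ℕ → ℕ)
    (l : List (Letter G)) : Prop :=
  IsCode τ m α β 0 l ∧ ∀ σ σ', T.IsChoice σ → T.IsChoice σ' →
    Aligned S T.D₁ ([GeodSeg.point S 1] ++ T.segs f σ σ' 1 l ++
      [GeodSeg.point S (T.encode f τ β 0 l)])

theorem exists_isGoodCode (hS : Subgroup.closure (S : Set G) = ⊤) (T : ContractingTriple S) (f : G)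
    {I : Set ℕ} {m : ℕ} {M : ℝ} {α β : ℕ → ℕ} (τ : GeodSeg S)
    (hb : T.IsBlocks f I τ.len m M α β) (js : List ℕ) (hjs : js.Pairwise (· < ·))
    (hjm : ∀ j ∈ js, j < m) :
    ∃ l : List (Letter G), l.map Letter.block = js ∧ T.IsGoodCode f τ m α β l := by
  have hD := T.one_le_D hS
  have hD1 := T.D_lt_D₁
  obtain ⟨l, h1, h2, h3⟩ := T.exists_code hS f τ hb js hjs 0
    (fun j hj => ⟨hjm j hj, Nat.zero_le _⟩) 1
  refine ⟨l, h1, h2, fun σ σ' hσ hσ' => ?_⟩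
  obtain ⟨g1, g2⟩ := h3 σ σ' hσ hσ' 1
  rw [one_mul] at g1
  rw [inv_one, one_mul] at g2
  refine List.isChain_cons.2 ⟨?_, g1⟩
  cases l with
  | nil =>
    intro κ hκ
    have hκ' : GeodSeg.point S (T.encode f τ β 0 []) = κ := Option.some.inj hκ
    rw [← hκ']
    exact pairAligned_point_right hS (C := 1) one_pos (by linarith) (nearLast_point one_pos)
  | cons x l =>
    intro κ hκ
    exact (g2 κ hκ).mono hD1.le

/-- The last segment inserted for a prefix ends at the product of the prefix. So `ρ` has a vertex
near that product, from which the comparison of two codes with this prefix starts. -/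
theorem fellowChain_segs_append {T : ContractingTriple S} {f : G} {σ σ' : Fin 3 → GeodSeg S}
    (hσ' : T.IsChoice σ') {D : ℝ} {ρ : GeodSeg S} {a : ℕ} {z : G}
    (hz : (wordDist S (ρ.pts a) z : ℝ) < D) {p : List (Letter G)} {rest : List (GeodSeg S)}
    (h : FellowChain S D ρ a (T.segs f σ σ' z p ++ rest)) :
    ∃ t, (wordDist S (ρ.pts t) (z * T.replProd f p) : ℝ) < D ∧ FellowChain S D ρ t rest := by
  induction p generalizing a z with
  | nil => exact ⟨a, by simpa [replProd] using hz, h⟩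
  | cons x p ih =>
    obtain ⟨s, t, -, -, -, -, s', t', -, h6, h7, h8, h9⟩ := h
    obtain ⟨u, hu1, hu2⟩ := ih (a := t') (z := z * T.repl f x) (by
      have := h8.2.1
      rw [GeodSeg.sub_last _ h6 h7, GeodSeg.last_translate, (hσ' _).2] at this
      simpa only [repl, mul_assoc] using this) h9
    exact ⟨u, by simpa only [replProd_cons, mul_assoc] using hu1, hu2⟩

theorem IsGoodCode.fellowChain {T : ContractingTriple S} (hD : 1 ≤ T.D) {f : G} {τ : GeodSeg S}
    {m : ℕ} {α β : ℕ → ℕ} {p l : List (Letter G)} (h : T.IsGoodCode f τ m α β (p ++ l))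
    {σ σ' : Fin 3 → GeodSeg S} (hσ : T.IsChoice σ) (hσ' : T.IsChoice σ') {ρ : GeodSeg S}
    (hρ : ρ.first = 1) (hρ' : ρ.last = T.encode f τ β 0 (p ++ l)) :
    ∃ t, (wordDist S (ρ.pts t) (T.replProd f p) : ℝ) < T.D₂ ∧
      FellowChain S T.D₂ ρ t (T.segs f σ σ' (T.replProd f p) l) := by
  have hD1 := T.D_lt_D₁
  have hD2 := T.D₁_lt_D₂
  have hmem : ∀ (q : List (Letter G)) (z : G), ∀ κ ∈ T.segs f σ σ' z q,
      IsContracting S T.D₁ κ.carrier ∧ T.L₁ < (κ.len : ℝ) := by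
    intro q
    induction q with
    | nil => intro z κ hκ; simp [segs] at hκ
    | cons x q ih =>
      intro z κ hκ
      rcases List.mem_cons.1 hκ with rfl | hκ
      · exact ⟨(hσ.contracting _ _).mono (by linarith), hσ.lt_len hD _ _⟩
      rcases List.mem_cons.1 hκ with rfl | hκ
      · exact ⟨(hσ'.contracting _ _).mono (by linarith), hσ'.lt_len hD _ _⟩
      · exact ih _ κ hκ
  have h1 := T.hD₂.2.2 1 (T.encode f τ β 0 (p ++ l)) (T.segs f σ σ' 1 (p ++ l)) (hmem _ _)
    (h.2 σ σ' hσ hσ') ρ hρ hρ'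
  rw [containsFellow_iff, segs_append, one_mul] at h1
  have h2 := fellowChain_segs_append (z := 1) hσ' (by
    rw [← hρ, GeodSeg.first, wordDist_self]
    push_cast
    linarith) h1
  simpa only [one_mul] using h2

/-- A pair of inserted segments that occurs on a geodesic between two points of a translate of `τ̃`
puts the endpoint of `τ̃` into the set `𝒜`. -/
theorem mem_setA_of_pattern (hS : Subgroup.closure (S : Set G) = ⊤) (T : ContractingTriple S)
    {f : G} {I : ℕ → Set ℕ} {τ ρ : GeodSeg S} (h1 : τ.first = 1) {b e A : ℕ}
    (hbe : b ≤ e) (hen : e ≤ τ.len) {z : G} {x : Letter G}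
    (hgap : (wordNorm S x.gap : ℝ) = A - b)
    (hI : ∀ t : ℕ, (A : ℝ) - 6 * T.D₂ ≤ t → t ≤ A → t ∈ I τ.len)
    (hpat : ∀ σ σ', T.IsChoice σ → T.IsChoice σ' → ∃ t₀ s₁ t₁ s₂ t₂ t', t₀ ≤ s₁ ∧ s₁ ≤ t₁ ∧
      t₁ ≤ s₂ ∧ s₂ ≤ t₂ ∧ t₂ ≤ t' ∧ t' ≤ ρ.len ∧
      (wordDist S (ρ.pts t₀) z : ℝ) < T.D₂ ∧
      (wordDist S (ρ.pts t') (z * ((τ.pts b)⁻¹ * τ.pts e)) : ℝ) < T.D₂ ∧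
      FellowTravel S T.D₂ (ρ.sub s₁ t₁) ((σ x.i).translate (z * x.gap)) ∧
      FellowTravel S T.D₂ (ρ.sub s₂ t₂) ((σ' x.j).translate (z * x.gap * T.h x.i * f))) :
    τ.last ∈ T.setA f I := by
  have hD := T.one_le_D hS
  have hD1 := T.D_lt_D₁
  have hD2 := T.D₁_lt_D₂
  have hD3 := T.D₂_lt_D₃
  have hD4 := T.D₃_lt_D₄
  have hlast : wordNorm S τ.last = τ.len := by
    rw [τ.len_eq, h1, wordDist_one]
  have hnb : (wordNorm S (τ.pts b) : ℝ) = b := by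
    have := τ.dist_pts (Nat.zero_le b) (hbe.trans hen)
    change (wordDist S τ.first (τ.pts b) : ℝ) = _ at this
    rw [h1, wordDist_one] at this
    simpa using this
  have hne : (wordNorm S (τ.pts e) : ℝ) = e := by
    have := τ.dist_pts (Nat.zero_le e) hen
    change (wordDist S τ.first (τ.pts e) : ℝ) = _ at this
    rw [h1, wordDist_one] at this
    simpa using this
  -- Left translation by `u` carries the picture along `ρ` to `τ`, with `z` going to `τ.pts b`.
  obtain ⟨u, hu⟩ : ∃ u, u = τ.pts b * z⁻¹ := ⟨_, rfl⟩
  have huz : u * z = τ.pts b := by rw [hu]; group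
  have hue : u * (z * ((τ.pts b)⁻¹ * τ.pts e)) = τ.pts e := by rw [hu]; group
  refine ⟨τ.pts b * x.gap, T.h x.i, T.h x.j,
    (τ.pts b * x.gap * T.h x.i * f * T.h x.j)⁻¹ * τ.last, by group, ⟨_, rfl⟩, ⟨_, rfl⟩, ?_, ?_⟩
  · rw [hlast]
    obtain ⟨σ, hσ⟩ := T.exists_isChoice hS
    obtain ⟨t₀, s₁, t₁, s₂, t₂, t', g1, g2, g3, g4, g5, g6, g7, g8, g9, -⟩ := hpat σ σ hσ hσ
    have e1 := g9.1
    rw [GeodSeg.sub_first, GeodSeg.first_translate, (hσ _).1, mul_one] at e1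
    have e2 := ρ.dist_pts (i := t₀) (j := s₁) g1 (by omega)
    have e3 := ρ.dist_pts (i := t₀) (j := t') (by omega) g6
    have e4 := ρ.dist_pts (i := s₁) (j := t') (by omega) g6
    have e5 := wordDist_triangle hS z (ρ.pts t₀) (z * x.gap)
    have e6 := wordDist_triangle hS (ρ.pts t₀) (ρ.pts s₁) (z * x.gap)
    have e7 : (wordDist S z (z * x.gap) : ℝ) = A - b := by
      rw [wordDist, inv_mul_cancel_left, hgap]
    have e8 := wordDist_triangle hS (ρ.pts t₀) z (ρ.pts t')
    have e9 := wordDist_triangle hS z (z * ((τ.pts b)⁻¹ * τ.pts e)) (ρ.pts t')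
    have e10 : (wordDist S z (z * ((τ.pts b)⁻¹ * τ.pts e)) : ℝ) = e - b := by
      rw [wordDist, inv_mul_cancel_left]
      exact τ.dist_pts hbe hen
    have e11 := wordDist_triangle hS (z * x.gap) (ρ.pts s₁) (z * ((τ.pts b)⁻¹ * τ.pts e))
    have e12 := wordDist_triangle hS (ρ.pts s₁) (ρ.pts t') (z * ((τ.pts b)⁻¹ * τ.pts e))
    have e13 : wordDist S (z * x.gap) (z * ((τ.pts b)⁻¹ * τ.pts e)) =
        wordDist S (τ.pts b * x.gap) (τ.pts e) := by
      rw [← wordDist_mul_left S u, hue, ← mul_assoc, huz]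
    have e14 := wordNorm_le_add_wordDist hS (τ.pts b * x.gap) (τ.pts e)
    rw [wordDist_comm hS z (ρ.pts t₀)] at e5
    rw [wordDist_comm hS (z * ((τ.pts b)⁻¹ * τ.pts e)) (ρ.pts t')] at e9
    rw [e13, wordDist_comm hS (z * x.gap) (ρ.pts s₁)] at e11
    -- The norm of `τ.pts b * x.gap` is at most `A` by the triangle inequality, and at least `A - 6
    -- * D₂` because this point is nearly on the way from `τ.pts b` to `τ.pts e`.
    refine hI _ (by linarith) ?_
    have e15 : (wordNorm S (τ.pts b * x.gap) : ℝ) ≤ wordNorm S (τ.pts b) + wordNorm S x.gap := by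
      exact_mod_cast wordNorm_mul_le hS _ _
    have e16 : (wordNorm S (τ.pts b * x.gap) : ℝ) ≤ A := by linarith
    exact_mod_cast e16
  · intro κ₁ κ₂ hf1 hl1 hf2 hl2
    obtain ⟨σ₀, hσ₀⟩ := T.exists_isChoice hS
    -- Membership in `𝒜` concerns all geodesics `[e, v₁]`, `[e, v₂]`. Overwriting one value in each
    -- of two separate choices realises any given pair, even when `x.i = x.j`.
    have hupd : ∀ (i : Fin 3) (κ : GeodSeg S), κ.first = 1 → κ.last = T.h i →
        T.IsChoice (Function.update σ₀ i κ) := by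
      intro i κ hf hl k
      by_cases hk : k = i
      · subst hk; simpa using ⟨hf, hl⟩
      · simpa [Function.update_of_ne hk] using hσ₀ k
    have hc1 := (hupd _ _ hf1 hl1).contracting x.i (τ.pts b * x.gap)
    have hc2 := (hupd _ _ hf2 hl2).contracting x.j (τ.pts b * x.gap * T.h x.i * f)
    obtain ⟨t₀, s₁, t₁, s₂, t₂, t', g1, g2, g3, g4, g5, g6, g7, g8, g9, g10⟩ :=
      hpat _ _ (hupd _ _ hf1 hl1) (hupd _ _ hf2 hl2)
    rw [Function.update_self] at g9 g10 hc1 hc2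
    have tr1 : (κ₁.translate (z * x.gap)).translate u = κ₁.translate (τ.pts b * x.gap) := by
      rw [GeodSeg.translate_translate, ← mul_assoc, huz]
    have tr2 : (κ₂.translate (z * x.gap * T.h x.i * f)).translate u =
        κ₂.translate (τ.pts b * x.gap * T.h x.i * f) := by
      rw [GeodSeg.translate_translate]
      simp only [← mul_assoc]
      rw [huz]
    have middle : ∀ (s t : ℕ) (κ : GeodSeg S), t₀ ≤ s → s ≤ t → t ≤ t' →
        IsContracting S T.D (κ.translate u).carrier →
        FellowTravel S T.D₂ (ρ.sub s t) κ →
        PairAligned S T.D₄ (GeodSeg.point S 1) (κ.translate u) ∧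
          PairAligned S T.D₄ (κ.translate u) (GeodSeg.point S τ.last) := by
      intro s t κ hs hst ht hcon hft
      have hch : FellowChain S T.D₂ ρ 0 [GeodSeg.point S z, κ,
          GeodSeg.point S (z * ((τ.pts b)⁻¹ * τ.pts e))] :=
        ⟨t₀, t₀, Nat.zero_le _, le_rfl, by omega, fellowTravel_point (by omega) g7,
          s, t, hs, hst, by omega, hft, t', t', ht, le_rfl, g6, fellowTravel_point g6 g8, g6⟩
      have hal := T.hD₃.2 ρ _ (containsFellow_iff.2 hch)
      simp only [Aligned, List.cons_append, List.nil_append, List.isChain_cons_cons,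
        List.isChain_singleton, and_true] at hal
      obtain ⟨-, a1, a2, -⟩ := hal
      have a1' := a1.translate u
      have a2' := a2.translate u
      rw [GeodSeg.translate_point, huz] at a1'
      rw [GeodSeg.translate_point, hue] at a2'
      have her := T.hD₄.2 τ (κ.translate u) 0 b e τ.len (Nat.zero_le _) hbe hen le_rfl
        (hcon.mono (by linarith)) (by
          simp only [Aligned, List.isChain_cons_cons, List.isChain_singleton, and_true]
          exact ⟨a1'.mono (by linarith), a2'.mono (by linarith)⟩)
      simp only [Aligned, List.isChain_cons_cons, List.isChain_singleton, and_true] at her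
      change PairAligned S T.D₄ (GeodSeg.point S τ.first) _ ∧ _ at her
      rw [h1] at her
      exact her
    have m1 := middle s₁ t₁ _ g1 g2 (by omega) (by rwa [tr1]) g9
    have m2 := middle s₂ t₂ _ (by omega) g4 g5 (by rwa [tr2]) g10
    have hch : FellowChain S T.D₂ ρ 0 [κ₁.translate (z * x.gap),
        κ₂.translate (z * x.gap * T.h x.i * f)] :=
      ⟨s₁, t₁, Nat.zero_le _, g2, by omega, g9, s₂, t₂, g3, g4, by omega, g10, by
        change t₂ ≤ ρ.len
        omega⟩
    have hal := T.hD₃.2 ρ _ (containsFellow_iff.2 hch)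
    simp only [Aligned, List.cons_append, List.nil_append, List.isChain_cons_cons,
      List.isChain_singleton, and_true] at hal
    have m3 := hal.2.1.translate u
    rw [tr1] at m1 m3
    rw [tr2] at m2 m3
    simp only [Aligned, List.isChain_cons_cons, List.isChain_singleton, and_true]
    exact ⟨m1.1, m3.mono (by linarith), m2.2⟩

section Compare

variable {T : ContractingTriple S} {f : G} {I : ℕ → Set ℕ} {n m : ℕ} {M : ℝ} {α β : ℕ → ℕ}
  {τ τ' : GeodSeg S} {p : List (Letter G)}

/-- Given two good codes of the same element that extend the same list, the second one does not
end first. -/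
theorem IsGoodCode.ne_nil (hS : Subgroup.closure (S : Set G) = ⊤)
    (hb : T.IsBlocks f (I n) n m M α β) (hn : τ.len = n) (hn' : τ'.len = n) (h1 : τ'.first = 1)
    (hA : τ'.last ∉ T.setA f I) {x : Letter G} {l : List (Letter G)}
    (hl : T.IsGoodCode f τ m α β (p ++ x :: l)) (hl' : T.IsGoodCode f τ' m α β p) :
    T.encode f τ β 0 (p ++ x :: l) ≠ T.encode f τ' β 0 p := by
  intro heq
  have hD := T.one_le_D hS
  have hD1 := T.D_lt_D₁
  have hD2 := T.D₁_lt_D₂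
  obtain ⟨ρ, hρ, hρ'⟩ := exists_geodSeg hS 1 (T.encode f τ β 0 (p ++ x :: l))
  obtain ⟨hxm, hxb, hxg, -, -⟩ := hl.1.of_append.2
  have hbn : endPos β 0 p ≤ n := hl'.1.endPos_le hb (Nat.zero_le _)
  refine hA (mem_setA_of_pattern hS T (ρ := ρ) (b := endPos β 0 p) (e := n) (A := α x.block)
    (z := T.replProd f p) (x := x) h1 hbn hn'.ge ?_ ?_ ?_)
  · rw [hxg]
    exact IsCode.norm_gap hxb (hn ▸ ((hb.le (by linarith) hxm).trans (hb.le_n _ hxm)))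
  · rw [hn']; exact hb.mem _ hxm
  · intro σ σ' hσ hσ'
    obtain ⟨t, ht, s₁, t₁, g1, g2, g3, g4, s₂, t₂, g5, g6, g7, g8, -⟩ :=
      hl.fellowChain hD hσ hσ' hρ hρ'
    refine ⟨t, s₁, t₁, s₂, t₂, ρ.len, g1, g2, g5, g6, g7, le_rfl, ht, ?_, g4, g8⟩
    have : T.replProd f p * ((τ'.pts (endPos β 0 p))⁻¹ * τ'.pts n) = ρ.last := by
      rw [hρ', heq, encode, ← mul_assoc, GeodSeg.last, hn']
    rw [this, GeodSeg.last, wordDist_self]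
    push_cast
    linarith

/-- If `x` used an earlier block, its two inserted segments would occur on `ρ` before the first
segment of `y`, hence along a gap where `τ'` is unmodified. This is a pattern that puts `τ'.last`
into `𝒜`. -/
theorem IsGoodCode.not_lt (hS : Subgroup.closure (S : Set G) = ⊤)
    (hb : T.IsBlocks f (I n) n m M α β) (hn : τ.len = n) (hn' : τ'.len = n) (h1 : τ'.first = 1)
    (hA : τ'.last ∉ T.setA f I) {x y : Letter G} {l l' : List (Letter G)}
    (hl : T.IsGoodCode f τ m α β (p ++ x :: l)) (hl' : T.IsGoodCode f τ' m α β (p ++ y :: l'))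
    (heq : T.encode f τ β 0 (p ++ x :: l) = T.encode f τ' β 0 (p ++ y :: l')) :
    ¬ x.block < y.block := by
  intro hxy
  have hD := T.one_le_D hS
  have hD1 := T.D_lt_D₁
  have hD2 := T.D₁_lt_D₂
  obtain ⟨ρ, hρ, hρ'⟩ := exists_geodSeg hS 1 (T.encode f τ β 0 (p ++ x :: l))
  obtain ⟨hxm, hxb, hxg, -, -⟩ := hl.1.of_append.2
  obtain ⟨hym, hyb, hyg, -, -⟩ := hl'.1.of_append.2
  have hyn : α y.block ≤ n := (hb.le (by linarith) hym).trans (hb.le_n _ hym)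
  have hxgap : (wordNorm S x.gap : ℝ) = α x.block - endPos β 0 p := by
    rw [hxg]
    exact IsCode.norm_gap hxb (hn ▸ ((hb.le (by linarith) hxm).trans (hb.le_n _ hxm)))
  have hygap : (wordNorm S y.gap : ℝ) = α y.block - endPos β 0 p := by
    rw [hyg]
    exact IsCode.norm_gap hyb (hn'.symm ▸ hyn)
  refine hA (mem_setA_of_pattern hS T (ρ := ρ) (b := endPos β 0 p) (e := α y.block)
    (A := α x.block) (z := T.replProd f p) (x := x) h1 hyb (hn'.symm ▸ hyn) hxgap ?_ ?_)
  · rw [hn']; exact hb.mem _ hxm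
  · intro σ σ' hσ hσ'
    obtain ⟨t, ht, s₁, t₁, g1, g2, g3, g4, s₂, t₂, g5, g6, g7, g8, -⟩ :=
      hl.fellowChain hD hσ hσ' hρ hρ'
    obtain ⟨t', ht', s', u', k1, k2, k3, k4, -⟩ := hl'.fellowChain hD hσ hσ' hρ (hρ'.trans heq)
    rw [← hyg]
    have e1 := k4.1
    rw [GeodSeg.sub_first, GeodSeg.first_translate, (hσ _).1, mul_one] at e1
    have e2 := g8.2.1
    rw [GeodSeg.sub_last _ g6 g7, GeodSeg.last_translate, (hσ' _).2] at e2
    -- The spacing of blocks exceeds the norm of the element inserted for `x` by `6 * D₂`, which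
    -- covers the fellow traveling errors.
    have key : t₂ ≤ s' := by
      have hsp := hb.spaced _ _ hxy hym
      obtain ⟨z, hz⟩ : ∃ z, z = T.replProd f p := ⟨_, rfl⟩
      obtain ⟨v, hv⟩ : ∃ v, v = z * x.gap * T.h x.i * f * T.h x.j := ⟨_, rfl⟩
      rw [← hz, ← hv] at e2
      rw [← hz] at e1 ht ht'
      have e3 : (wordDist S z v : ℝ) ≤ wordNorm S x.gap + (2 * (T.L + T.D) + wordNorm S f) := by
        have := T.norm_repl_le hS f x
        rw [wordDist, hv]
        simpa only [repl, ← mul_assoc, inv_mul_cancel, one_mul] using this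
      have e4 : (wordDist S z (z * y.gap) : ℝ) = wordNorm S y.gap := by
        rw [wordDist, inv_mul_cancel_left]
      have e5 := ρ.dist_pts (i := t) (j := t₂) (by omega) g7
      have e6 := ρ.dist_pts (i := t') (j := s') k1 (by omega)
      have e7 := ρ.dist_pts_abs hS (i := t) (j := t') (by omega) (by omega)
      have e8 := wordDist_triangle hS (ρ.pts t) z (ρ.pts t₂)
      have e9 := wordDist_triangle hS z v (ρ.pts t₂)
      have e10 := wordDist_triangle hS z (ρ.pts t') (z * y.gap)
      have e11 := wordDist_triangle hS (ρ.pts t') (ρ.pts s') (z * y.gap)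
      have e12 := wordDist_triangle hS (ρ.pts t) z (ρ.pts t')
      rw [wordDist_comm hS v (ρ.pts t₂)] at e9
      rw [wordDist_comm hS z (ρ.pts t')] at e10 e12
      have e13 := le_abs_self ((t : ℝ) - t')
      have : (t₂ : ℝ) ≤ s' := by linarith
      exact_mod_cast this
    exact ⟨t, s₁, t₁, s₂, t₂, s', g1, g2, g5, g6, key, by omega, ht, e1, g4, g8⟩

/-- With the same prefix and block, both gaps have the same norm. The next inserted segments
therefore start near vertices of `ρ` that are at most `6 * D₂` apart, and each start is within `D₂`
of its vertex. -/
theorem IsGoodCode.norm_gap_le (hS : Subgroup.closure (S : Set G) = ⊤)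
    (hb : T.IsBlocks f (I n) n m M α β) (hn : τ.len = n) (hn' : τ'.len = n)
    {x y : Letter G} {l l' : List (Letter G)}
    (hl : T.IsGoodCode f τ m α β (p ++ x :: l)) (hl' : T.IsGoodCode f τ' m α β (p ++ y :: l'))
    (heq : T.encode f τ β 0 (p ++ x :: l) = T.encode f τ' β 0 (p ++ y :: l'))
    (hxy : x.block = y.block) : (wordNorm S (x.gap⁻¹ * y.gap) : ℝ) ≤ 8 * T.D₂ := by
  have hD := T.one_le_D hS
  obtain ⟨ρ, hρ, hρ'⟩ := exists_geodSeg hS 1 (T.encode f τ β 0 (p ++ x :: l))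
  obtain ⟨hxm, hxb, hxg, -, -⟩ := hl.1.of_append.2
  obtain ⟨hym, hyb, hyg, -, -⟩ := hl'.1.of_append.2
  have hyn : α y.block ≤ n := (hb.le (by linarith) hym).trans (hb.le_n _ hym)
  have hxgap : (wordNorm S x.gap : ℝ) = α x.block - endPos β 0 p := by
    rw [hxg]
    exact IsCode.norm_gap hxb (hn ▸ ((hb.le (by linarith) hxm).trans (hb.le_n _ hxm)))
  have hygap : (wordNorm S y.gap : ℝ) = α y.block - endPos β 0 p := by
    rw [hyg]
    exact IsCode.norm_gap hyb (hn'.symm ▸ hyn)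
  obtain ⟨σ, hσ⟩ := T.exists_isChoice hS
  obtain ⟨t, ht, s, u, g1, g2, g3, g4, -⟩ := hl.fellowChain hD hσ hσ hρ hρ'
  obtain ⟨t', ht', s', u', k1, k2, k3, k4, -⟩ := hl'.fellowChain hD hσ hσ hρ (hρ'.trans heq)
  have e1 := k4.1
  have e2 := g4.1
  rw [GeodSeg.sub_first, GeodSeg.first_translate, (hσ _).1, mul_one] at e1 e2
  obtain ⟨z, hz⟩ : ∃ z, z = T.replProd f p := ⟨_, rfl⟩
  rw [← hz] at e1 e2 ht ht'
  have e3 : (wordDist S z (z * x.gap) : ℝ) = wordNorm S x.gap := by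
    rw [wordDist, inv_mul_cancel_left]
  have e4 : (wordDist S z (z * y.gap) : ℝ) = wordNorm S y.gap := by
    rw [wordDist, inv_mul_cancel_left]
  have e5 := ρ.dist_pts (i := t) (j := s) g1 (by omega)
  have e6 := ρ.dist_pts (i := t') (j := s') k1 (by omega)
  have e7 := ρ.dist_pts_abs hS (i := t) (j := t') (by omega) (by omega)
  have e8 := ρ.dist_pts_abs hS (i := s) (j := s') (by omega) (by omega)
  have a1 := wordDist_triangle hS (ρ.pts t) z (ρ.pts s)
  have a2 := wordDist_triangle hS z (z * x.gap) (ρ.pts s)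
  have a3 := wordDist_triangle hS z (ρ.pts t) (z * x.gap)
  have a4 := wordDist_triangle hS (ρ.pts t) (ρ.pts s) (z * x.gap)
  have b1 := wordDist_triangle hS (ρ.pts t') z (ρ.pts s')
  have b2 := wordDist_triangle hS z (z * y.gap) (ρ.pts s')
  have b3 := wordDist_triangle hS z (ρ.pts t') (z * y.gap)
  have b4 := wordDist_triangle hS (ρ.pts t') (ρ.pts s') (z * y.gap)
  have b5 := wordDist_triangle hS (ρ.pts t) z (ρ.pts t')
  have c1 := wordDist_triangle hS (z * x.gap) (ρ.pts s) (z * y.gap)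
  have c2 := wordDist_triangle hS (ρ.pts s) (ρ.pts s') (z * y.gap)
  have c3 : wordDist S (z * x.gap) (z * y.gap) = wordNorm S (x.gap⁻¹ * y.gap) := by
    rw [wordDist_mul_left, wordDist]
  rw [wordDist_comm hS (z * x.gap) (ρ.pts s)] at a2 c1
  rw [wordDist_comm hS (z * y.gap) (ρ.pts s')] at b2
  rw [wordDist_comm hS z (ρ.pts t)] at a3
  rw [wordDist_comm hS z (ρ.pts t')] at b3 b5
  have d1 := le_abs_self ((t : ℝ) - t')
  have d2 := neg_abs_le ((t : ℝ) - t')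
  rw [c3] at c1
  rw [hxy] at hxgap
  have d3 : |(s : ℝ) - s'| ≤ 6 * T.D₂ := by
    rw [abs_le]
    constructor <;> linarith
  linarith

end Compare

end ContractingTriple

/-- Kraft's inequality for a prefix-free set of words in which every prefix has at most `K`
continuations. -/
theorem sum_inv_pow_length_le_one {X : Type*} {K : ℕ} (hK : 0 < K) (N : ℕ) (A : Finset (List X))
    (hN : ∀ l ∈ A, l.length ≤ N) (hpre : ∀ p ∈ A, ∀ l, p ++ l ∈ A → l = [])
    (hbr : ∀ p, ∃ F : Finset X, F.card ≤ K ∧ ∀ x l, p ++ x :: l ∈ A → x ∈ F) :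
    ∑ l ∈ A, (1 / (K : ℝ)) ^ l.length ≤ 1 := by
  classical
  have hK' : (0 : ℝ) < K := by exact_mod_cast hK
  induction N generalizing A with
  | zero =>
    have hsub : A ⊆ {[]} := fun l hl => by
      simpa using List.length_eq_zero_iff.1 (Nat.le_zero.1 (hN l hl))
    refine (Finset.sum_le_sum_of_subset_of_nonneg hsub fun _ _ _ => by positivity).trans ?_
    simp
  | succ N ih =>
    by_cases hnil : [] ∈ A
    · have hsub : A ⊆ {[]} := fun l hl => by simpa using hpre [] hnil l hl
      refine (Finset.sum_le_sum_of_subset_of_nonneg hsub fun _ _ _ => by positivity).trans ?_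
      simp
    obtain ⟨F, hF, hF'⟩ := hbr []
    have hmap : ∀ l ∈ A, l.head? ∈ F.image some := by
      intro l hl
      cases l with
      | nil => exact absurd hl hnil
      | cons x l => simpa using hF' x l hl
    -- Splitting by the first letter: there are at most `K` classes, and by induction on the length
    -- each contributes at most `1 / K`.
    rw [← Finset.sum_fiberwise_of_maps_to hmap, Finset.sum_image (by simp)]
    have hx : ∀ x ∈ F, ∑ l ∈ A with l.head? = some x, (1 / (K : ℝ)) ^ l.length ≤ 1 / K := by
      intro x _
      have hform : ∀ l ∈ A.filter fun l => l.head? = some x, ∃ l', l = x :: l' := by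
        intro l hl
        obtain ⟨-, hl⟩ := Finset.mem_filter.1 hl
        cases l with
        | nil => simp at hl
        | cons y l' =>
          simp only [List.head?_cons, Option.some.injEq] at hl
          exact ⟨l', by rw [hl]⟩
      have hmem : ∀ l, l ∈ (A.filter fun l => l.head? = some x).image List.tail ↔ x :: l ∈ A := by
        intro l
        rw [Finset.mem_image]
        constructor
        · rintro ⟨l₁, h1, h2⟩
          obtain ⟨l', rfl⟩ := hform l₁ h1
          simp only [List.tail_cons] at h2
          rw [← h2]
          exact (Finset.mem_filter.1 h1).1
        · intro h
          exact ⟨x :: l, Finset.mem_filter.2 ⟨h, rfl⟩, rfl⟩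
      have hlen' : ∀ l ∈ (A.filter fun l => l.head? = some x).image List.tail, l.length ≤ N := by
        intro l hl
        simpa using hN _ ((hmem l).1 hl)
      have hpre' : ∀ p ∈ (A.filter fun l => l.head? = some x).image List.tail,
          ∀ l, p ++ l ∈ (A.filter fun l => l.head? = some x).image List.tail → l = [] := by
        intro p hp l hl
        refine hpre (x :: p) ((hmem p).1 hp) l ?_
        rw [List.cons_append]
        exact (hmem (p ++ l)).1 hl
      have hbr' : ∀ p, ∃ F : Finset X, F.card ≤ K ∧ ∀ y l,
          p ++ y :: l ∈ (A.filter fun l => l.head? = some x).image List.tail → y ∈ F := by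
        intro p
        obtain ⟨F', h1, h2⟩ := hbr (x :: p)
        refine ⟨F', h1, fun y l hl => h2 y l ?_⟩
        rw [List.cons_append]
        exact (hmem (p ++ y :: l)).1 hl
      have key := ih _ hlen' hpre' hbr'
      rw [Finset.sum_image (by
        intro l₁ h1 l₂ h2 h12
        obtain ⟨m₁, rfl⟩ := hform l₁ h1
        obtain ⟨m₂, rfl⟩ := hform l₂ h2
        simp only [List.tail_cons] at h12
        rw [h12])] at key
      calc ∑ l ∈ A with l.head? = some x, (1 / (K : ℝ)) ^ l.length
          = ∑ l ∈ A with l.head? = some x, (1 / (K : ℝ)) * (1 / (K : ℝ)) ^ l.tail.length := by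
            refine Finset.sum_congr rfl fun l hl => ?_
            obtain ⟨l', rfl⟩ := hform l hl
            simp only [List.length_cons, List.tail_cons, pow_succ]
            ring
        _ = (1 / (K : ℝ)) * ∑ l ∈ A with l.head? = some x, (1 / (K : ℝ)) ^ l.tail.length := by
            rw [Finset.mul_sum]
        _ ≤ 1 / K := mul_le_of_le_one_right (by positivity) key
    calc ∑ x ∈ F, ∑ l ∈ A with l.head? = some x, (1 / (K : ℝ)) ^ l.length
        ≤ ∑ _x ∈ F, (1 / (K : ℝ)) := Finset.sum_le_sum hx
      _ = F.card / K := by rw [Finset.sum_const, nsmul_eq_mul]; ring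
      _ ≤ 1 := by
        rw [div_le_one hK']
        exact_mod_cast hF

/-- An order-connected finite set of natural numbers contains an interval of its cardinality. -/
theorem exists_interval_subset {I : Set ℕ} (hI : I.OrdConnected) (hfin : I.Finite) :
    ∃ a, ∀ t, a ≤ t → t < a + I.ncard → t ∈ I := by
  rcases I.eq_empty_or_nonempty with rfl | hne
  · exact ⟨0, fun t _ h => by simp at h⟩
  obtain ⟨a, ha, ha'⟩ := Set.exists_min_image I id hfin hne
  obtain ⟨b, hb, hb'⟩ := Set.exists_max_image I id hfin hne
  have hIcc : I = Set.Icc a b :=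
    Set.Subset.antisymm (fun t ht => ⟨ha' t ht, hb' t ht⟩) (hI.out ha hb)
  have hab : a ≤ b := ha' b hb
  refine ⟨a, fun t h1 h2 => ?_⟩
  have hcard : I.ncard = b + 1 - a := by
    rw [hIcc, Set.ncard_eq_toFinset_card']
    simp
  rw [hIcc]
  exact ⟨h1, by omega⟩

/-! ### Choice of the blocks, and the counting argument. -/

namespace ContractingTriple

variable {G : Type*} [Group G] {S : Finset G}

/-- Consecutive runs of `N = ⌊M⌋` integers are cut from `I`. In each run the first `c = ⌈6 D₂⌉`
positions are a margin, needed because the norm of `u₁` is known only up to `6 D₂`, and the replaced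
block is the rest. The lower bound on `M` keeps this rest long enough. -/
theorem exists_isBlocks (hS : Subgroup.closure (S : Set G) = ⊤) (T : ContractingTriple S) (f : G)
    {I : Set ℕ} {n : ℕ} (hI : I.OrdConnected) (hIn : I ⊆ Set.Iic n) {M : ℝ}
    (hM : 10 * (T.L + T.D₂) + wordNorm S f < M) :
    ∃ α β, T.IsBlocks f I n ⌊(I.ncard : ℝ) / M⌋₊ M α β := by
  have hD := T.one_le_D hS
  have hD1 := T.D_lt_D₁
  have hD2 := T.D₁_lt_D₂
  have hD3 := T.D₂_lt_D₃
  have hD4 := T.D₃_lt_D₄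
  have hL1 := T.D₂_lt_L₁
  have hL2 := T.D₄_lt_L₂
  have hL : T.D₂ < T.L := by rw [L]; linarith
  have hf : (0 : ℝ) ≤ wordNorm S f := Nat.cast_nonneg _
  have hM0 : 0 < M := by linarith
  obtain ⟨a, ha⟩ := exists_interval_subset hI ((Set.finite_Iic n).subset hIn)
  obtain ⟨m, hm⟩ : ∃ m, m = ⌊(I.ncard : ℝ) / M⌋₊ := ⟨_, rfl⟩
  obtain ⟨N, hN⟩ : ∃ N, N = ⌊M⌋₊ := ⟨_, rfl⟩
  obtain ⟨c, hc⟩ : ∃ c, c = ⌈6 * T.D₂⌉₊ := ⟨_, rfl⟩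
  have hN1 : (N : ℝ) ≤ M := by rw [hN]; exact Nat.floor_le hM0.le
  have hN2 : M < N + 1 := by rw [hN]; exact Nat.lt_floor_add_one M
  have hc1 : 6 * T.D₂ ≤ c := by rw [hc]; exact Nat.le_ceil _
  have hc2 : (c : ℝ) < 6 * T.D₂ + 1 := by rw [hc]; exact Nat.ceil_lt_add_one (by linarith)
  have hmN : m * N ≤ I.ncard := by
    have h1 : (m : ℝ) ≤ (I.ncard : ℝ) / M := by rw [hm]; exact Nat.floor_le (by positivity)
    rw [le_div_iff₀ hM0] at h1
    have h2 : (m : ℝ) * N ≤ m * M := mul_le_mul_of_nonneg_left hN1 (Nat.cast_nonneg _)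
    exact_mod_cast h2.trans h1
  have hcN : c + 1 < N := by
    have : (c : ℝ) + 1 < N := by linarith
    exact_mod_cast this
  have hblock : ∀ j < m, j * N + N ≤ I.ncard := fun j hj => by
    have : (j + 1) * N ≤ m * N := Nat.mul_le_mul_right _ hj
    linarith [add_mul j 1 N]
  have hmem : ∀ j < m, ∀ t, a + j * N ≤ t → t < a + j * N + N → t ∈ I := fun j hj t h1 h2 =>
    ha t (by omega) (by have := hblock j hj; omega)
  have hlen : ∀ j : ℕ, ((a + j * N + (N - 1) : ℕ) : ℝ) - ((a + j * N + c : ℕ) : ℝ) = N - 1 - c := by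
    intro j
    push_cast [Nat.cast_sub (by omega : 1 ≤ N)]
    ring
  have hstep : ∀ j k : ℕ, j < k → j * N + N ≤ k * N := fun j k hjk => by
    have : (j + 1) * N ≤ k * N := Nat.mul_le_mul_right _ hjk
    linarith [add_mul j 1 N]
  rw [← hm]
  refine ⟨fun j => a + j * N + c, fun j => a + j * N + (N - 1), ?_, ?_, ?_, ?_, ?_, ?_⟩
  · intro j hj
    exact hIn (hmem j hj _ (by omega) (by omega))
  · intro j _
    rw [hlen]
    linarith
  · intro j _
    rw [hlen]
    have : (0 : ℝ) ≤ c := Nat.cast_nonneg _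
    linarith
  · intro j k hjk _
    have := hstep j k hjk
    show a + j * N + (N - 1) ≤ a + k * N + c
    omega
  · intro j k hjk _
    have : ((j * N + N : ℕ) : ℝ) ≤ ((k * N : ℕ) : ℝ) := by exact_mod_cast hstep j k hjk
    push_cast at this ⊢
    linarith
  · intro j hj t h1 h2
    refine hmem j hj t ?_ (by omega)
    push_cast at h1
    have : ((a + j * N : ℕ) : ℝ) ≤ t := by push_cast; linarith
    exact_mod_cast this

/-- The letters that can follow a common prefix of good codes of one element. -/
theorem exists_finset_letters (hS : Subgroup.closure (S : Set G) = ⊤) {T : ContractingTriple S}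
    {f : G} {I : ℕ → Set ℕ} {n m : ℕ} {M : ℝ} {α β : ℕ → ℕ}
    (hb : T.IsBlocks f (I n) n m M α β) (g' : G) (p : List (Letter G)) :
    ∃ F : Finset (Letter G), F.card ≤ 9 * (ball S (8 * T.D₂)).ncard * (ball S M).ncard ∧
      ∀ (τ : GeodSeg S) x l, τ.first = 1 → τ.len = n → τ.last ∉ T.setA f I →
        T.IsGoodCode f τ m α β (p ++ x :: l) → T.encode f τ β 0 (p ++ x :: l) = g' → x ∈ F := by
  classical
  have hD := T.one_le_D hS
  by_cases hex : ∃ (τ : GeodSeg S) (x : Letter G) (l : List (Letter G)), τ.first = 1 ∧ τ.len = n ∧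
      τ.last ∉ T.setA f I ∧ T.IsGoodCode f τ m α β (p ++ x :: l) ∧
      T.encode f τ β 0 (p ++ x :: l) = g'
  · obtain ⟨τ₀, x₀, l₀, h1, h2, h3, h4, h5⟩ := hex
    obtain ⟨U, hU⟩ : ∃ U, U = (finite_ball hS (8 * T.D₂)).toFinset := ⟨_, rfl⟩
    obtain ⟨V, hV⟩ : ∃ V, V = (finite_ball hS M).toFinset := ⟨_, rfl⟩
    -- Relative to one reference letter `x₀`, a letter is given by its two indices, the small
    -- discrepancy of its gap and its removed word; the block is forced.
    refine ⟨(((Finset.univ : Finset (Fin 3 × Fin 3)) ×ˢ U) ×ˢ V).image fun q =>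
      ⟨x₀.block, x₀.gap * q.1.2, q.1.1.1, q.1.1.2, q.2⟩, ?_, ?_⟩
    · refine Finset.card_image_le.trans (le_of_eq ?_)
      rw [Finset.card_product, Finset.card_product, Set.ncard_eq_toFinset_card _ (finite_ball hS M),
        Set.ncard_eq_toFinset_card _ (finite_ball hS (8 * T.D₂)), hU, hV]
      simp
    · intro τ x l k1 k2 k3 k4 k5
      have hblock : x.block = x₀.block := by
        rcases lt_trichotomy x.block x₀.block with h | h | h
        · exact absurd h (k4.not_lt hS hb k2 h2 h1 h3 h4 (k5.trans h5.symm))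
        · exact h
        · exact absurd h (h4.not_lt hS hb h2 k2 k1 k3 k4 (h5.trans k5.symm))
      have hgap := h4.norm_gap_le hS hb h2 k2 k4 (h5.trans k5.symm) hblock.symm
      obtain ⟨hxm, hxb, -, hxw, -⟩ := k4.1.of_append.2
      have hword : (wordNorm S x.word : ℝ) ≤ M := by
        rw [hxw, IsCode.norm_gap (hb.le (by linarith) hxm) (k2.symm ▸ hb.le_n _ hxm)]
        exact hb.upper _ hxm
      refine Finset.mem_image.2 ⟨(((x.i, x.j), x₀.gap⁻¹ * x.gap), x.word), ?_, ?_⟩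
      · simp only [Finset.mem_product, Finset.mem_univ, true_and, hU, hV, Set.Finite.mem_toFinset]
        exact ⟨hgap, hword⟩
      · ext <;> simp [hblock]
  · refine ⟨∅, by simp, fun τ x l k1 k2 k3 k4 k5 => ?_⟩
    exact absurd ⟨τ, x, l, k1, k2, k3, k4, k5⟩ hex

/-- Double counting of pairs (element of `ℬ_n`, set of blocks) with weight `K ^ (-cardinality)`: the
total is computed by the binomial theorem, and each fibre over a point of the ball has weight at
most `1` by Kraft's inequality. -/
theorem ncard_setB_mul_le (hS : Subgroup.closure (S : Set G) = ⊤) (T : ContractingTriple S)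
    (f : G) {I : ℕ → Set ℕ} {n m : ℕ} {M : ℝ} {α β : ℕ → ℕ}
    (hb : T.IsBlocks f (I n) n m M α β) {K : ℕ} (hK0 : 0 < K)
    (hK : 9 * (ball S (8 * T.D₂)).ncard * (ball S M).ncard ≤ K) :
    ((T.setB f I n).ncard : ℝ) * (1 + 1 / (K : ℝ)) ^ m ≤ (ball S (n : ℝ)).ncard := by
  classical
  have hD := T.one_le_D hS
  have hBfin : (T.setB f I n).Finite := (finite_ball hS n).subset fun g hg => by
    change (wordNorm S g : ℝ) ≤ n
    rw [hg.2]
  obtain ⟨B, hB⟩ : ∃ B, B = hBfin.toFinset := ⟨_, rfl⟩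
  obtain ⟨U, hU⟩ : ∃ U, U = (finite_ball hS (n : ℝ)).toFinset := ⟨_, rfl⟩
  have hBmem : ∀ g ∈ B, g ∉ T.setA f I ∧ wordNorm S g = n := fun g hg => by
    rw [hB, Set.Finite.mem_toFinset] at hg
    exact hg
  choose τ hτ1 hτ2 using fun g : G => exists_geodSeg hS 1 g
  have hlen : ∀ g ∈ B, (τ g).len = n := fun g hg => by
    rw [GeodSeg.len_eq, hτ1, hτ2, wordDist_one, (hBmem g hg).2]
  have hcode : ∀ q : G × Finset ℕ, ∃ l : List (Letter G), q ∈ B ×ˢ (Finset.range m).powerset →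
      l.map Letter.block = q.2.sort ∧ T.IsGoodCode f (τ q.1) m α β l := by
    intro q
    by_cases hq : q ∈ B ×ˢ (Finset.range m).powerset
    · obtain ⟨hq1, hq2⟩ := Finset.mem_product.1 hq
      obtain ⟨l, h1, h2⟩ := T.exists_isGoodCode hS f (τ q.1) (I := I n) (M := M) (α := α) (β := β)
        (m := m) (by rw [hlen _ hq1]; exact hb) q.2.sort (Finset.sortedLT_sort _).pairwise
        (fun j hj => by
          rw [Finset.mem_sort] at hj
          exact Finset.mem_range.1 (Finset.mem_powerset.1 hq2 hj))
      exact ⟨l, fun _ => ⟨h1, h2⟩⟩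
    · exact ⟨[], fun h => absurd h hq⟩
  choose c hc using hcode
  obtain ⟨e, he⟩ : ∃ e : G × Finset ℕ → G, ∀ q, e q = T.encode f (τ q.1) β 0 (c q) :=
    ⟨_, fun _ => rfl⟩
  obtain ⟨Ω, hΩ⟩ : ∃ Ω, Ω = B ×ˢ (Finset.range m).powerset := ⟨_, rfl⟩
  rw [← hΩ] at hc
  have hΩB : ∀ q ∈ Ω, q.1 ∈ B := fun q hq => by
    rw [hΩ] at hq
    exact (Finset.mem_product.1 hq).1
  have hlenc : ∀ q ∈ Ω, (c q).length = q.2.card := fun q hq => by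
    have := congrArg List.length (hc q hq).1
    rwa [List.length_map, Finset.length_sort] at this
  have heU : ∀ q ∈ Ω, e q ∈ U := fun q hq => by
    have hq1 := hΩB q hq
    have h1 := (hc q hq).2.1.norm_encode_le hS (by linarith) (M := M) (I := I n)
      (by rw [hlen _ hq1]; exact hb) (Nat.zero_le _)
    rw [hU, Set.Finite.mem_toFinset, he]
    rw [hlen _ hq1] at h1
    simpa [ball] using h1
  have hsum : ∑ q ∈ Ω, (1 / (K : ℝ)) ^ q.2.card = B.card * (1 + 1 / (K : ℝ)) ^ m := by
    rw [hΩ, Finset.sum_product]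
    simp only
    have h1 := Finset.sum_pow_mul_eq_add_pow (1 / (K : ℝ)) 1 (Finset.range m)
    simp only [one_pow, mul_one, Finset.card_range] at h1
    rw [h1, Finset.sum_const, nsmul_eq_mul, add_comm]
  have hfiber : ∀ g' ∈ U, ∑ q ∈ Ω with e q = g', (1 / (K : ℝ)) ^ q.2.card ≤ 1 := by
    intro g' _
    -- Within a fibre the code determines the pair: its blocks give the set, and its gaps and
    -- removed words together with the result give back the original element.
    have hinj : Set.InjOn c (Ω.filter fun q => e q = g' : Finset (G × Finset ℕ)) := by
      intro q hq q' hq' hcc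
      obtain ⟨h1, h2⟩ := Finset.mem_filter.1 hq
      obtain ⟨h1', h2'⟩ := Finset.mem_filter.1 hq'
      have hs : q.2 = q'.2 := by
        have h3 := (hc q h1).1
        rw [hcc, (hc q' h1').1] at h3
        rw [← Finset.sort_toFinset q.2 (· ≤ ·), ← Finset.sort_toFinset q'.2 (· ≤ ·), h3]
      refine Prod.ext ?_ hs
      have key : ∀ q ∈ Ω, q.1 = ((c q).map fun x => x.gap * x.word).prod *
          (T.replProd f (c q))⁻¹ * e q := by
        intro q hq
        have h5 := (hc q hq).2.1.pts_endPos
        have h6 : (τ q.1).pts 0 = 1 := hτ1 q.1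
        rw [h6, one_mul] at h5
        rw [he, encode, h5, hτ2]
        group
      rw [key q h1, key q' h1', hcc, h2, h2']
    have hkraft := sum_inv_pow_length_le_one hK0
      (((Ω.filter fun q => e q = g').image c).sup List.length)
      ((Ω.filter fun q => e q = g').image c) (fun l hl => Finset.le_sup (f := List.length) hl)
      (by
        intro p hp l hl
        obtain ⟨q, hq, rfl⟩ := Finset.mem_image.1 hp
        obtain ⟨q', hq', hcc⟩ := Finset.mem_image.1 hl
        obtain ⟨h1, h2⟩ := Finset.mem_filter.1 hq
        obtain ⟨h1', h2'⟩ := Finset.mem_filter.1 hq'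
        cases l with
        | nil => rfl
        | cons x l =>
          have hg' := (hc q' h1').2
          rw [hcc] at hg'
          rw [he] at h2 h2'
          rw [hcc] at h2'
          refine absurd (h2'.trans h2.symm) (hg'.ne_nil hS hb (hlen _ (hΩB _ h1'))
            (hlen _ (hΩB _ h1)) (hτ1 _) ?_ (hc q h1).2)
          rw [hτ2]
          exact (hBmem _ (hΩB _ h1)).1)
      (by
        intro p
        obtain ⟨F, hF1, hF2⟩ := exists_finset_letters hS hb g' p
        refine ⟨F, hF1.trans hK, fun x l hl => ?_⟩
        obtain ⟨q, hq, hcq⟩ := Finset.mem_image.1 hl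
        obtain ⟨h1, h2⟩ := Finset.mem_filter.1 hq
        rw [he, hcq] at h2
        refine hF2 (τ q.1) x l (hτ1 _) (hlen _ (hΩB _ h1)) ?_ (hcq ▸ (hc q h1).2) h2
        rw [hτ2]
        exact (hBmem _ (hΩB _ h1)).1)
    rw [Finset.sum_image hinj] at hkraft
    refine le_trans (le_of_eq (Finset.sum_congr rfl fun q hq => ?_)) hkraft
    rw [hlenc q (Finset.mem_filter.1 hq).1]
  have htotal : ∑ q ∈ Ω, (1 / (K : ℝ)) ^ q.2.card ≤ U.card := by
    rw [← Finset.sum_fiberwise_of_maps_to heU]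
    refine (Finset.sum_le_sum hfiber).trans ?_
    simp
  rw [hsum] at htotal
  rw [Set.ncard_eq_toFinset_card _ hBfin, Set.ncard_eq_toFinset_card _ (finite_ball hS (n : ℝ)),
    ← hB, ← hU]
  exact htotal

end ContractingTriple

end GrowthGap

theorem proposition3p5 {G : Type*} [Group G] (S : Finset G)
    (hS : Subgroup.closure (S : Set G) = ⊤) (hG : ¬ IsVirtuallyCyclic G)
    (hc : ∃ (g : G) (K : ℝ), IsContractingElement S K g) :
    Nonempty (ContractingTriple S) ∧
    ∀ T : ContractingTriple S, ∃ C : ℝ, 0 < C ∧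
      ∀ (f : G) (I : ℕ → Set ℕ), (∀ n, (I n).OrdConnected ∧ I n ⊆ Set.Iic n) →
      ∀ M : ℝ, 10 * (T.L + T.D₂) + (wordNorm S f : ℝ) < M →
      ∀ n : ℕ, 1 ≤ n →
        ((ball S (n : ℝ)).ncard : ℝ) ≥
          ((T.setB f I n).ncard : ℝ) * (1 / (C * ((ball S M).ncard : ℝ))) *
            (1 + 1 / (C * ((ball S M).ncard : ℝ))) ^ ⌊((I n).ncard : ℝ) / M⌋₊ := by
  refine ⟨nonempty_contractingTriple hS hG hc, fun T => ?_⟩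
  have hD := T.one_le_D hS
  have hD1 := T.D_lt_D₁
  have hD2 := T.D₁_lt_D₂
  have hD3 := T.D₂_lt_D₃
  have hD4 := T.D₃_lt_D₄
  have hL1 := T.D₂_lt_L₁
  have hL2 := T.D₄_lt_L₂
  have hL : T.D₂ < T.L := by rw [ContractingTriple.L]; linarith
  have hpos : 0 < (ball S (8 * T.D₂)).ncard := ncard_ball_pos hS (by linarith)
  -- With this `C`, the product of `C` and `#B(e, M)` is the branching bound `K`.
  refine ⟨9 * ((ball S (8 * T.D₂)).ncard : ℝ), by positivity, fun f I hI M hM n _ => ?_⟩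
  have hf : (0 : ℝ) ≤ wordNorm S f := Nat.cast_nonneg _
  have hposM : 0 < (ball S M).ncard := ncard_ball_pos hS (by linarith)
  obtain ⟨α, β, hb⟩ := T.exists_isBlocks hS f (hI n).1 (hI n).2 hM
  obtain ⟨K, hK⟩ : ∃ K, K = 9 * (ball S (8 * T.D₂)).ncard * (ball S M).ncard := ⟨_, rfl⟩
  have hK0 : 0 < K := by rw [hK]; positivity
  have hcast : 9 * ((ball S (8 * T.D₂)).ncard : ℝ) * ((ball S M).ncard : ℝ) = K := by
    rw [hK]; push_cast; ring
  have h := T.ncard_setB_mul_le hS f hb hK0 hK.ge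
  -- The counting argument gives the estimate without the first factor, which is at most `1`.
  have hone : 1 / (K : ℝ) ≤ 1 := by
    rw [div_le_one (by exact_mod_cast hK0)]
    exact_mod_cast hK0
  rw [hcast, ge_iff_le]
  refine le_trans ?_ h
  gcongr
  exact mul_le_of_le_one_right (Nat.cast_nonneg _) hone
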